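/- Let $\mathcal C$ be a connected commutative affine algebraic group of dimension one over $\mathbb C$ (for example $\mathbb C^*$ or $\mathbb C$), written multiplicatively with identity $1$, and let $q\in\mathcal C$ with $q^2\neq 1$ (so $q\ne\pm1$ for $\mathcal C=\mathbb C^*$; for $\mathcal C=\mathbb C$ this reads $q\neq 0$, and $q^{-2}$ is the point $-2q$). Let $A=(a_{ij})$ be an $n\times n$ Cartan matrix of finite type. Let $X$ be a free abelian group of rank $2n-\operatorname{rk}A$, let $X^\vee=\operatorname{Hom}(X,\mathbb Z)$, and let $\alpha_1,\dots,\alpha_n\in X$ and $\alpha_1^\vee,\dots,\alpha_n^\vee\in X^\vee$ be linearly independent families with $\langle\alpha_i^\vee,\alpha_j\rangle=a_{ij}$. Let $W\subset GL(X)$ be the Weyl group, generated by the reflections $s_i(x)=x-\langle\alpha_i^\vee,x\rangle\alpha_i$; let $R=W\{\alpha_1,\dots,\alpha_n\}$ be the set of (real) roots, $R_+$ the set of roots that are nonnegative integral combinations of the $\alpha_i$, $R_-=-R_+$, and for $\alpha=v\alpha_i$ with $v\in W$ put $s_\alpha=vs_iv^{-1}$. Put $T_{\mathcal C}=\mathcal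 C\otimes_{\mathbb Z}X^\vee$, with coordinate ring $\mathbb C[T_{\mathcal C}]$ and function field $\mathbb C(T_{\mathcal C})$, on which $W$ acts. Each $\alpha\in X$ defines a homomorphism $\alpha:T_{\mathcal C}\to\mathcal C$, $c\otimes\nu\mapsto c^{\langle\alpha,\nu\rangle}$; for $x\in\mathcal C$ let $T_{\alpha,x}=\{t\in T_{\mathcal C}:\alpha(t)=x\}$. Consider the elements $\sum_{w\in W}f_w w$ of the skew group ring $\mathbb C(T_{\mathcal C})*W$ such that 1. each $f_w$ has at most first order poles along finitely many divisors $T_{\alpha,1}$, $\alpha\in R_+$, and no other singularities; 2. $\operatorname{Res}_{T_{\alpha,1}}(f_w)+\operatorname{Res}_{T_{\alpha,1}}(f_{s_\alpha w})=0$ for all $w\in W$ and $\alpha\in R_+$, where residues are taken with respect to the function $u\circ\alpha$, $u$ a local parameter of $\mathcal C$ at $1$ (the condition does not depend on $u$); 3. $f_w$ vanishes on $T_{\alpha,q^{-2}}$ whenever $\alpha\in R_+$ and $w^{-1}(\alpha)\in R_-$. Then these elements form a $\mathbb C$-subalgebra $\mathsf H_q(\mathcal C,A)$ of $\mathbb C(T_{\mathcal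 C})*W$. The ring $\mathsf H_q(\mathcal C,A)$ is left and right Noetherian, it is a prime ring, and it is a left and right Goldie ring. Its center is $\mathbb C[T_{\mathcal C}]^W$ (embedded in $\mathbb C(T_{\mathcal C})*W$ as $f\mapsto f\cdot 1$). -/

import Mathlib

open scoped TensorProduct

namespace ResidueHecke

noncomputable section

/-! ### Cartan matrices, realizations and Weyl groups -/

/-- Generalized Cartan matrices. -/
structure IsGeneralizedCartan {n : ℕ} (A : Matrix (Fin n) (Fin n) ℤ) : Prop where
  diag : ∀ i, A i i = 2
  nonpos : ∀ i j, i ≠ j → A i j ≤ 0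
  zero_symm : ∀ i j, A i j = 0 → A j i = 0

/-- A generalized Cartan matrix is of finite type if `D * A` is symmetric and positive definite for
some diagonal matrix `D` with positive diagonal entries. -/
def IsFiniteType {n : ℕ} (A : Matrix (Fin n) (Fin n) ℤ) : Prop :=
  IsGeneralizedCartan A ∧
    ∃ d : Fin n → ℝ, (∀ i, 0 < d i) ∧
      (Matrix.diagonal d * A.map (fun a : ℤ => (a : ℝ))).PosDef

/-- A realization over `ℤ` of a generalized Cartan matrix `A` of size `n`, with character lattice
`X` of rank `2 n - rank A` and cocharacter lattice `Hom(X, ℤ)`. -/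
structure Realization {n : ℕ} (A : Matrix (Fin n) (Fin n) ℤ) (X : Type*) [AddCommGroup X] where
  cartan : IsGeneralizedCartan A
  /-- the simple roots -/
  root : Fin n → X
  /-- the simple coroots -/
  coroot : Fin n → Module.Dual ℤ X
  pairing : ∀ i j, coroot i (root j) = A i j
  root_indep : LinearIndependent ℤ root
  coroot_indep : LinearIndependent ℤ coroot
  rank_eq : Module.finrank ℤ X + (A.map (fun a : ℤ => (a : ℚ))).rank = 2 * n

section Weyl

variable {n : ℕ} {A : Matrix (Fin n) (Fin n) ℤ} {X : Type*} [AddCommGroup X]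

/-- The simple reflection `x ↦ x - ⟨αᵢ^∨, x⟩ αᵢ` of `X`. -/
def Realization.simpleReflection (D : Realization A X) (i : Fin n) : X ≃ₗ[ℤ] X :=
  Module.reflection (x := D.root i) (f := D.coroot i)
    (by rw [D.pairing, D.cartan.diag])

/-- The Weyl group, generated by the simple reflections. -/
def Realization.weyl (D : Realization A X) : Subgroup (X ≃ₗ[ℤ] X) :=
  Subgroup.closure (Set.range D.simpleReflection)

/-- The simple reflection as an element of the Weyl group. -/
def Realization.s (D : Realization A X) (i : Fin n) : D.weyl :=
  ⟨D.simpleReflection i, Subgroup.subset_closure ⟨i, rfl⟩⟩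

/-- Positive real roots: elements of the `W`-orbits of the simple roots that are nonnegative
integral combinations of simple roots. -/
def Realization.IsPosRealRoot (D : Realization A X) (α : X) : Prop :=
  (∃ (v : D.weyl) (i : Fin n), α = v.1 (D.root i)) ∧
    α ∈ AddSubmonoid.closure (Set.range D.root)

/-- `σ` is the reflection attached to the real root `α`: if `α = v αᵢ` with `v ∈ W`, it is
`v sᵢ v⁻¹`. -/
def Realization.IsReflectionOf (D : Realization A X) (σ : D.weyl) (α : X) : Prop :=
  ∃ (v : D.weyl) (i : Fin n), α = v.1 (D.root i) ∧ σ = v * D.s i * v⁻¹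

end Weyl

/-! ### The group `𝒞` and the variety `T = 𝒞 ⊗ Hom(X, ℤ)` -/

section Torus

/-- The commutative group of complex points of the affine algebraic group whose coordinate Hopf
algebra is `O` (with the convolution product). -/
def Points (O : Type*) [CommRing O] [HopfAlgebra ℂ O] : Type _ := WithConv (O →ₐ[ℂ] ℂ)

variable (O : Type*) [CommRing O] [HopfAlgebra ℂ O]

/-- A local parameter at the identity of the curve with coordinate ring `O`: a function in
`𝔪 ∖ 𝔪²`, where `𝔪` is the maximal ideal of the identity. -/
def IsLocalParameter {O : Type*} [CommRing O] [HopfAlgebra ℂ O] (u : O) : Prop :=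
  u ∈ RingHom.ker (Bialgebra.counitAlgHom ℂ O) ∧
    u ∉ RingHom.ker (Bialgebra.counitAlgHom ℂ O) ^ 2

variable [Coalgebra.IsCocomm ℂ O] (X : Type*) [AddCommGroup X]

instance : CommGroup (Points O) := inferInstanceAs (CommGroup (WithConv (O →ₐ[ℂ] ℂ)))

variable {O} in
/-- The value of a regular function at a point. -/
def Points.eval (c : Points O) (v : O) : ℂ := WithConv.ofConv c v

/-- (The points of) the variety `T = 𝒞 ⊗ Hom(X, ℤ)`, with group law written additively. -/
abbrev Torus : Type _ := Additive (Points O) ⊗[ℤ] Module.Dual ℤ X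

variable {X} in
/-- The homomorphism `T → 𝒞`, `c ⊗ ν ↦ c ^ ⟨x, ν⟩`, given by `x ∈ X`. -/
def character (x : X) : Torus O X →+ Additive (Points O) :=
  ((TensorProduct.rid ℤ (Additive (Points O))).toLinearMap ∘ₗ
    LinearMap.lTensor (Additive (Points O)) (Module.Dual.eval ℤ X x)).toAddMonoidHom

theorem character_tmul (x : X) (c : Points O) (ν : Module.Dual ℤ X) :
    character O x (Additive.ofMul c ⊗ₜ[ℤ] ν) = Additive.ofMul (c ^ (ν x)) := by
  change TensorProduct.rid ℤ (Additive (Points O)) (Additive.ofMul c ⊗ₜ[ℤ] ν x) = _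
  rw [TensorProduct.rid_tmul, ofMul_zpow]

/-- The function `v ∘ x` on `T`, for a regular function `v` on `𝒞` and `x ∈ X`. -/
def pullbackFun (x : X) (v : O) : Torus O X → ℂ :=
  fun t => (character O x t).toMul.eval v

/-- The coordinate ring `ℂ[T]`, as an algebra of functions on `T`: generated by the functions
`v ∘ x`. -/
def coordinateRing : Subalgebra ℂ (Torus O X → ℂ) :=
  Algebra.adjoin ℂ {f | ∃ (x : X) (v : O), f = pullbackFun O X x v}

variable {O X} in
/-- `v ∘ x` as an element of `ℂ[T]`. -/
def pullback (x : X) (v : O) : coordinateRing O X :=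
  ⟨pullbackFun O X x v, Algebra.subset_adjoin ⟨x, v, rfl⟩⟩

/-- The action `c ⊗ ν ↦ c ⊗ (ν ∘ w⁻¹)` of an automorphism `w` of `X` on `T`. -/
def torusAct (w : X ≃ₗ[ℤ] X) : Torus O X →+ Torus O X :=
  (LinearMap.lTensor (Additive (Points O))
    ((w⁻¹ : X ≃ₗ[ℤ] X).toLinearMap.dualMap)).toAddMonoidHom

theorem torusAct_tmul (w : X ≃ₗ[ℤ] X) (c : Additive (Points O)) (ν : Module.Dual ℤ X) :
    torusAct O X w (c ⊗ₜ[ℤ] ν) = c ⊗ₜ[ℤ] (ν ∘ₗ (w⁻¹ : X ≃ₗ[ℤ] X).toLinearMap) := rfl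

theorem torusAct_one (t : Torus O X) : torusAct O X 1 t = t := by
  induction t using TensorProduct.induction_on with
  | zero => exact map_zero _
  | tmul c ν => rfl
  | add a b ha hb => rw [map_add, ha, hb]

theorem torusAct_mul (w y : X ≃ₗ[ℤ] X) (t : Torus O X) :
    torusAct O X (w * y) t = torusAct O X w (torusAct O X y t) := by
  induction t using TensorProduct.induction_on with
  | zero => simp only [map_zero]
  | tmul c ν =>
    rw [torusAct_tmul, torusAct_tmul, torusAct_tmul, mul_inv_rev]
    rfl
  | add a b ha hb => rw [map_add, ha, hb, map_add, map_add]

theorem character_torusAct (w : X ≃ₗ[ℤ] X) (x : X) (t : Torus O X) :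
    character O x (torusAct O X w⁻¹ t) = character O (w x) t := by
  induction t using TensorProduct.induction_on with
  | zero => simp only [map_zero]
  | tmul c ν =>
    rw [torusAct_tmul, inv_inv]
    exact (character_tmul O X x c.toMul _).trans (character_tmul O X (w x) c.toMul ν).symm
  | add a b ha hb => rw [map_add, map_add, map_add, ha, hb]

theorem comp_torusAct_mem (w : X ≃ₗ[ℤ] X) {f : Torus O X → ℂ} (hf : f ∈ coordinateRing O X) :
    (fun t => f (torusAct O X w⁻¹ t)) ∈ coordinateRing O X := by
  induction hf using Algebra.adjoin_induction with
  | mem f hf =>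
    obtain ⟨x, v, rfl⟩ := hf
    refine Algebra.subset_adjoin ⟨w x, v, ?_⟩
    funext t
    simp only [pullbackFun, character_torusAct]
  | algebraMap r => exact (coordinateRing O X).algebraMap_mem r
  | add f g _ _ hf hg => exact add_mem hf hg
  | mul f g _ _ hf hg => exact mul_mem hf hg

/-- Automorphisms of `X` act on `ℂ[T]` by `(w • f)(t) = f (w⁻¹ t)`. -/
instance : MulSemiringAction (X ≃ₗ[ℤ] X) (coordinateRing O X) where
  smul w f := ⟨fun t => f.1 (torusAct O X w⁻¹ t), comp_torusAct_mem O X w f.2⟩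
  one_smul f := by
    apply Subtype.ext
    funext t
    change f.1 (torusAct O X 1⁻¹ t) = f.1 t
    rw [inv_one, torusAct_one]
  mul_smul w y f := by
    apply Subtype.ext
    funext t
    change f.1 (torusAct O X (w * y)⁻¹ t) = f.1 (torusAct O X y⁻¹ (torusAct O X w⁻¹ t))
    rw [mul_inv_rev, torusAct_mul]
  smul_zero _ := rfl
  smul_add _ _ _ := rfl
  smul_one _ := rfl
  smul_mul _ _ _ := rfl

/-- The field of rational functions `ℂ(T)`. -/
def RationalFunctions : Type _ := FractionRing (coordinateRing O X)

instance : CommRing (RationalFunctions O X) :=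
  inferInstanceAs (CommRing (FractionRing (coordinateRing O X)))

instance : Algebra (coordinateRing O X) (RationalFunctions O X) :=
  inferInstanceAs (Algebra (coordinateRing O X) (FractionRing (coordinateRing O X)))

instance : IsFractionRing (coordinateRing O X) (RationalFunctions O X) :=
  inferInstanceAs (IsFractionRing (coordinateRing O X) (FractionRing (coordinateRing O X)))

instance : Algebra ℂ (RationalFunctions O X) :=
  inferInstanceAs (Algebra ℂ (FractionRing (coordinateRing O X)))

instance : IsScalarTower ℂ (coordinateRing O X) (RationalFunctions O X) :=
  IsScalarTower.of_algebraMap_eq fun _ => rfl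

/-- The induced action on rational functions. -/
instance : MulSemiringAction (X ≃ₗ[ℤ] X) (RationalFunctions O X) :=
  MulSemiringAction.compHom (RationalFunctions O X)
    ((IsFractionRing.ringEquivOfRingEquivHom (coordinateRing O X) (RationalFunctions O X)).comp
      (MulSemiringAction.toRingEquiv (X ≃ₗ[ℤ] X) (coordinateRing O X)))

theorem smul_algebraMap_coordinateRing (w : X ≃ₗ[ℤ] X) (f : coordinateRing O X) :
    w • algebraMap (coordinateRing O X) (RationalFunctions O X) f =
      algebraMap (coordinateRing O X) (RationalFunctions O X) (w • f) :=
  IsFractionRing.ringEquivOfRingEquiv_algebraMap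
    (MulSemiringAction.toRingEquiv (X ≃ₗ[ℤ] X) (coordinateRing O X) w) f

instance : SMulCommClass (X ≃ₗ[ℤ] X) ℂ (RationalFunctions O X) where
  smul_comm w c f := by
    have h : w • algebraMap ℂ (RationalFunctions O X) c = algebraMap ℂ (RationalFunctions O X) c := by
      rw [IsScalarTower.algebraMap_apply ℂ (coordinateRing O X) (RationalFunctions O X),
        smul_algebraMap_coordinateRing]
      rfl
    rw [Algebra.smul_def, Algebra.smul_def, smul_mul', h]

variable {O X}

/-- The rational function `f` is defined at the point `t` and has value `c` there. -/
def HasValueAt (f : RationalFunctions O X) (t : Torus O X) (c : ℂ) : Prop :=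
  ∃ a b : coordinateRing O X, b.1 t ≠ 0 ∧
    f * algebraMap (coordinateRing O X) (RationalFunctions O X) b =
      algebraMap (coordinateRing O X) (RationalFunctions O X) a ∧
    c = a.1 t / b.1 t

/-- The rational function `f` is regular at the point `t`. -/
def IsRegularAt (f : RationalFunctions O X) (t : Torus O X) : Prop := ∃ c, HasValueAt f t c

/-- The divisor `T_{α,x} ⊆ T` of the points `t` with `α(t) = x`. -/
def divisor (α : X) (x : Points O) : Set (Torus O X) :=
  {t | character O α t = Additive.ofMul x}

/-- The product of `f` with the equation `u ∘ α` of `T_{α,1}` given by a local parameter `u` of `𝒞`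
at the identity. -/
def mulEquation (u : O) (α : X) (f : RationalFunctions O X) : RationalFunctions O X :=
  algebraMap (coordinateRing O X) (RationalFunctions O X) (pullback α u) * f

/-- `f` is regular outside the divisors `T_{α,1}`, `α ∈ S`, and has at most a first order pole along
each of them (tested at the points that lie on no other of these divisors). -/
def HasAtMostSimplePolesAlong (S : Finset X) (f : RationalFunctions O X) : Prop :=
  (∀ t : Torus O X, (∀ β ∈ S, t ∉ divisor β 1) → IsRegularAt f t) ∧
    ∀ α ∈ S, ∀ u : O, IsLocalParameter u →
      ∀ t ∈ divisor α (1 : Points O), (∀ β ∈ S, β ≠ α → t ∉ divisor β 1) →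
        IsRegularAt (mulEquation u α f) t

/-- The residue of `f` along `T_{α,1}`, a rational function on `T_{α,1}`, is defined at the point `t`
of `T_{α,1}` and has the value `c` there; residues are taken with respect to a local parameter `u`
of `𝒞` at the identity. -/
def HasResidueAt (u : O) (α : X) (f : RationalFunctions O X) (t : Torus O X) (c : ℂ) : Prop :=
  HasValueAt (mulEquation u α f) t c

end Torus

/-! ### The algebra -/

section Hecke

variable {O : Type*} [CommRing O] [HopfAlgebra ℂ O] [Coalgebra.IsCocomm ℂ O]
  {X : Type*} [AddCommGroup X] {n : ℕ} {A : Matrix (Fin n) (Fin n) ℤ}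

variable (O) in
/-- The skew group ring `ℂ(T) * W`, with `(f w)(g y) = f w(g) w y`. -/
abbrev SkewRing (D : Realization A X) : Type _ :=
  SkewMonoidAlgebra (RationalFunctions O X) D.weyl

/-- The residue conditions on an element `∑ f_w w` of `ℂ(T) * W`. -/
structure IsHeckeElement (D : Realization A X) (q : Points O) (P : SkewRing O D) : Prop where
  /-- `f_w` has at most first order poles along finitely many divisors `T_{α,1}`, `α` a positive
  real root, and no other singularities. -/
  poles : ∀ w : D.weyl, ∃ S : Finset X, (∀ β ∈ S, D.IsPosRealRoot β) ∧
    HasAtMostSimplePolesAlong S (P.coeff w)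
  /-- `Res f_w + Res f_{s_α w} = 0` along `T_{α,1}`, for all positive real roots `α`. The equality
  of rational functions on `T_{α,1}` is stated at the points where both residues are defined. -/
  residues : ∀ (w σ : D.weyl) (α : X), D.IsPosRealRoot α → D.IsReflectionOf σ α →
    ∀ u : O, IsLocalParameter u → ∀ t ∈ divisor α (1 : Points O), ∀ c c' : ℂ,
      HasResidueAt u α (P.coeff w) t c → HasResidueAt u α (P.coeff (σ * w)) t c' → c + c' = 0
  /-- `f_w` vanishes on `T_{α,q⁻²}` for all positive real roots `α` with `w⁻¹ α` negative. -/
  vanishing : ∀ (w : D.weyl) (α : X), D.IsPosRealRoot α →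
    D.IsPosRealRoot (-((w⁻¹ : D.weyl).1 α)) →
      ∀ t ∈ divisor α ((q ^ 2)⁻¹ : Points O), ∀ c : ℂ, HasValueAt (P.coeff w) t c → c = 0

/-- The algebra `H_q(𝒞, A)`: the subalgebra of `ℂ(T) * W` given by the elements that satisfy the
residue conditions. -/
def heckeAlgebra (D : Realization A X) (q : Points O) : Subalgebra ℂ (SkewRing O D) :=
  Algebra.adjoin ℂ {P | IsHeckeElement D q P}

/-- The copy of `ℂ[T]^W` in `ℂ(T) * W`. -/
def invariants (O : Type*) [CommRing O] [HopfAlgebra ℂ O] [Coalgebra.IsCocomm ℂ O]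
    (D : Realization A X) : Set (SkewRing O D) :=
  (fun f : coordinateRing O X => SkewMonoidAlgebra.single (1 : D.weyl)
    (algebraMap (coordinateRing O X) (RationalFunctions O X) f)) ''
      {f | ∀ w : D.weyl, w • f = f}

end Hecke

/-! ### Prime and Goldie rings -/

/-- Prime rings: nonzero rings in which `a R b = 0` implies `a = 0` or `b = 0`. -/
def IsPrimeRing (R : Type*) [Ring R] : Prop :=
  Nontrivial R ∧ ∀ a b : R, (∀ r : R, a * r * b = 0) → a = 0 ∨ b = 0

/-- The left annihilator of a subset of a ring, a left ideal. -/
def leftAnnihilator {R : Type*} [Ring R] (S : Set R) : Ideal R where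
  carrier := {r | ∀ s ∈ S, r * s = 0}
  add_mem' ha hb s hs := by rw [add_mul, ha s hs, hb s hs, add_zero]
  zero_mem' s _ := zero_mul s
  smul_mem' c r hr s hs := by rw [smul_eq_mul, mul_assoc, hr s hs, mul_zero]

/-- Left Goldie rings: no infinite direct sums of nonzero left ideals, and the ascending chain
condition on left annihilators. -/
def IsLeftGoldie (R : Type*) [Ring R] : Prop :=
  (∀ I : ℕ → Ideal R, iSupIndep I → ∃ k, I k = ⊥) ∧
    ∀ S : ℕ → Set R, Monotone (fun k => leftAnnihilator (S k)) →
      ∃ N, ∀ k, N ≤ k → leftAnnihilator (S k) = leftAnnihilator (S N)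

/-- Goldie rings: left Goldie and right Goldie. -/
def IsGoldie (R : Type*) [Ring R] : Prop := IsLeftGoldie R ∧ IsLeftGoldie Rᵐᵒᵖ

end

end ResidueHecke

open scoped TensorProduct
namespace ResidueHecke
noncomputable section

set_option linter.unusedSectionVars false

/-! ### Points of a commutative affine algebraic group -/

section Curve

variable {O : Type*} [CommRing O] [HopfAlgebra ℂ O] [Coalgebra.IsCocomm ℂ O]

namespace Points

/-! The classification of one-dimensional groups is never used. What matters is that translations
act on everything and that all point derivations at the identity are proportional.

Geometry. Translations and derivations show that `ℂ[T]` is a normal Noetherian domain of finite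
type. If a rational function is not regular at a point, `exists_prime_principal` yields a prime `P`
through that point at which it is still not regular and whose local maximal ideal is principal; such
primes play the role of prime divisors. If `P` lies in `T_{α,x}`, derivations show that the equation
`u ∘ α` (translated by `x⁻¹`) generates `P` locally, and that `P` lies in no `T_{β,y}` with `β`
independent of `α`. Two tools follow: a function vanishing on `T_{α,1}` is divisible by its equation
(`div_equation_mem_regularAt`), and a function regular outside the intersections of two independent
divisors is regular (`exists_algebraMap_eq_of_regularAt`). For finite type there are finitely many
real roots, each positive or negative, and two that are not equal or opposite are independent. Hence
the defining conditions need testing only at points lying on no `T_{β,1}`, or on one only up to sign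
(`isHeckeElement_iff`).

Closure under products (`IsLocallyHecke.mul`). In the coefficient of `P * Q` at `z`, pair the terms
of `w` and `s_α w`. Since `s_α` fixes `T_{α,1}` pointwise and reverses the sign of its equation, `f
+ s_α f` loses a simple pole and `f - s_α f` is divisible by the equation when `f` is regular. Two
algebraic identities then give the pole and residue conditions. The vanishing condition holds term
by term, the zero coming from `P` or from `Q` according to the sign of `w⁻¹ α`.

Ring structure. The product of the equations of the `T_{α,1}` is a common denominator, so the
algebra embeds as a `ℂ[T]`-module in functions `W → ℂ[T]` on the finite group `W`; it is therefore
Noetherian on both sides, hence Goldie. Dedekind's independence of characters gives primeness. A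
central element is supported at `1` because `W` acts faithfully on `ℂ[T]`; the residue conditions
make its coefficient regular, and commutation with elements supported at each `w` makes it
invariant. -/

/-- Evaluation at a point as an algebra homomorphism. -/
def evalHom (c : Points O) : O →ₐ[ℂ] ℂ := WithConv.ofConv c

/-- The point given by an algebra homomorphism. -/
def ofHom (φ : O →ₐ[ℂ] ℂ) : Points O := WithConv.toConv φ

theorem ext_eval {c d : Points O} (h : ∀ v, c.eval v = d.eval v) : c = d :=
  WithConv.ext (AlgHom.ext h)

@[simp] theorem eval_add (c : Points O) (v w : O) : c.eval (v + w) = c.eval v + c.eval w :=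
  map_add c.evalHom v w
@[simp] theorem eval_sub (c : Points O) (v w : O) : c.eval (v - w) = c.eval v - c.eval w :=
  map_sub c.evalHom v w
@[simp] theorem eval_mul_right (c : Points O) (v w : O) : c.eval (v * w) = c.eval v * c.eval w :=
  map_mul c.evalHom v w
@[simp] theorem eval_zero (c : Points O) : c.eval (0 : O) = 0 := map_zero c.evalHom
@[simp] theorem eval_one (c : Points O) : c.eval (1 : O) = 1 := map_one c.evalHom
@[simp] theorem eval_algebraMap (c : Points O) (r : ℂ) : c.eval (algebraMap ℂ O r) = r :=
  c.evalHom.commutes r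

/-- Evaluation at `c` as a homomorphism from the group of self-maps of the curve to the curve. -/
def compEval (c : Points O) : WithConv (O →ₐ[ℂ] O) →* Points O where
  toFun φ := ofHom (c.evalHom.comp φ.ofConv)
  map_one' := ext_eval fun _ => c.evalHom.commutes _
  map_mul' φ ψ := congrArg WithConv.toConv (AlgHom.comp_convMul_distrib c.evalHom φ ψ)


theorem eval_compEval (c : Points O) (φ : WithConv (O →ₐ[ℂ] O)) (v : O) :
    (c.compEval φ).eval v = c.eval (φ v) := rfl

/-- The constant self-map of the curve with value `d`. -/
def const (d : Points O) : WithConv (O →ₐ[ℂ] O) :=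
  WithConv.toConv ((Algebra.ofId ℂ O).comp d.evalHom)

theorem compEval_const (c d : Points O) : c.compEval d.const = d :=
  ext_eval fun _ => c.eval_algebraMap _

/-- The identity self-map of the curve. -/
def idMap : WithConv (O →ₐ[ℂ] O) := WithConv.toConv (AlgHom.id ℂ O)

theorem compEval_idMap (c : Points O) : c.compEval idMap = c := rfl

/-- The homomorphism of coordinate rings given by `c ↦ c ^ m`. -/
def powHom (m : ℤ) : O →ₐ[ℂ] O := (idMap ^ m : WithConv (O →ₐ[ℂ] O)).ofConv

theorem eval_powHom (m : ℤ) (c : Points O) (v : O) : c.eval (powHom m v) = (c ^ m).eval v := by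
  change (c.compEval (idMap ^ m)).eval v = _
  rw [map_zpow, compEval_idMap]

/-- The homomorphism of coordinate rings given by `c ↦ d * c`. -/
def translate (d : Points O) : O →ₐ[ℂ] O := (d.const * idMap).ofConv

theorem eval_translate (d c : Points O) (v : O) : c.eval (translate d v) = (d * c).eval v := by
  change (c.compEval (d.const * idMap)).eval v = _
  rw [map_mul, compEval_idMap, compEval_const]

theorem translate_one (v : O) : (1 : Points O).translate v = v := by
  have : (const 1 * idMap : WithConv (O →ₐ[ℂ] O)) = idMap := one_mul _
  exact congrArg (fun φ : WithConv (O →ₐ[ℂ] O) => φ v) this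

theorem conv_apply {B : Type*} [CommRing B] [Algebra ℂ B] (φ ψ : WithConv (O →ₐ[ℂ] B)) (v : O) :
    (φ * ψ) v = LinearMap.mul' ℂ B (TensorProduct.map φ.ofConv.toLinearMap ψ.ofConv.toLinearMap
      (Coalgebra.comul (R := ℂ) v)) :=
  (congrArg (fun L : WithConv (O →ₗ[ℂ] B) => L v) (AlgHom.toLinearMap_convMul φ ψ)).trans
    (LinearMap.convMul_apply _ _ _)

/-- Comultiplication in terms of values; it turns `v ∘ (x + y)` into a polynomial in functions
pulled back along `x` and along `y`. -/
theorem exists_comul (v : O) : ∃ (ι : Type) (_ : Fintype ι) (a b : ι → O),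
    ∀ c d : Points O, (c * d).eval v = ∑ i, c.eval (a i) * d.eval (b i) := by
  obtain ⟨s, hs⟩ := TensorProduct.exists_finset (R := ℂ) (Coalgebra.comul (R := ℂ) v)
  classical
  refine ⟨Fin s.card, inferInstance, fun i => (s.equivFin.symm i).1.1,
    fun i => (s.equivFin.symm i).1.2, fun c d => ?_⟩
  have h : (c * d).eval v = LinearMap.mul' ℂ ℂ
      (TensorProduct.map c.evalHom.toLinearMap d.evalHom.toLinearMap
        (Coalgebra.comul (R := ℂ) v)) := by
    exact conv_apply _ _ _
  rw [h, hs, map_sum, map_sum, ← Finset.sum_coe_sort s, ← Equiv.sum_comp s.equivFin.symm]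
  rfl

end Points

/-! ### Point derivations at the identity -/

section PointDerivation

/-- Point derivations of `O` at the identity. -/
structure IsPointDerivation (δ : O →ₗ[ℂ] ℂ) : Prop where
  leibniz : ∀ v w : O, δ (v * w) = δ v * (1 : Points O).eval w + (1 : Points O).eval v * δ w

namespace IsPointDerivation

variable {δ : O →ₗ[ℂ] ℂ} (hδ : IsPointDerivation δ)
include hδ

theorem map_one : δ 1 = 0 := by
  have h := hδ.leibniz 1 1
  simpa using h

theorem map_algebraMap (r : ℂ) : δ (algebraMap ℂ O r) = 0 := by
  rw [Algebra.algebraMap_eq_smul_one, map_smul, hδ.map_one, smul_zero]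

/-- The differential of the group law at the identity is addition: in the Leibniz rule each factor
is paired with the counit of the other one. -/
theorem map_conv (φ ψ : WithConv (O →ₐ[ℂ] O)) (hφ : (1 : Points O).compEval φ = 1)
    (hψ : (1 : Points O).compEval ψ = 1) (v : O) : δ ((φ * ψ) v) = δ (φ v) + δ (ψ v) := by
  have hφ' : ∀ v, (1 : Points O).eval (φ v) = Coalgebra.counit (R := ℂ) v := fun v => by
    rw [← Points.eval_compEval, hφ]; rfl
  have hψ' : ∀ v, (1 : Points O).eval (ψ v) = Coalgebra.counit (R := ℂ) v := fun v => by
    rw [← Points.eval_compEval, hψ]; rfl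
  have key : ∀ x : O ⊗[ℂ] O, δ (LinearMap.mul' ℂ O
      (TensorProduct.map φ.ofConv.toLinearMap ψ.ofConv.toLinearMap x)) =
      δ (φ (TensorProduct.rid ℂ O (LinearMap.lTensor O (Coalgebra.counit (R := ℂ)) x))) +
      δ (ψ (TensorProduct.lid ℂ O (LinearMap.rTensor O (Coalgebra.counit (R := ℂ)) x))) := by
    intro x
    induction x using TensorProduct.induction_on with
    | zero => simp
    | tmul a b =>
      simp only [TensorProduct.map_tmul, AlgHom.toLinearMap_apply, LinearMap.mul'_apply,
        LinearMap.lTensor_tmul, LinearMap.rTensor_tmul, TensorProduct.rid_tmul,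
        TensorProduct.lid_tmul, map_smul, smul_eq_mul]
      rw [hδ.leibniz, hφ', hψ', mul_comm (δ _)]
    | add x y hx hy =>
      simp only [map_add, hx, hy]
      ring
  have h := key (Coalgebra.comul (R := ℂ) v)
  rw [Coalgebra.lTensor_counit_comul, Coalgebra.rTensor_counit_comul] at h
  simp only [TensorProduct.rid_tmul, TensorProduct.lid_tmul, one_smul] at h
  rw [← h]
  exact congrArg δ (Points.conv_apply _ _ _)

theorem map_powHom (m : ℤ) (v : O) : δ (Points.powHom m v) = m * δ v := by
  have h1 : ∀ k : ℤ, (1 : Points O).compEval (Points.idMap ^ k) = 1 := fun k => by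
    rw [map_zpow, Points.compEval_idMap, one_zpow]
  change δ ((Points.idMap ^ m : WithConv (O →ₐ[ℂ] O)) v) = _
  have hid : δ ((Points.idMap : WithConv (O →ₐ[ℂ] O)) v) = δ v := rfl
  induction m using Int.induction_on with
  | zero =>
    rw [zpow_zero]
    change δ (algebraMap ℂ O _) = _
    rw [hδ.map_algebraMap]; simp
  | succ k ih =>
    rw [zpow_add_one, hδ.map_conv _ _ (h1 _) (Points.compEval_idMap _), ih, hid]
    push_cast; ring
  | pred k ih =>
    have h := hδ.map_conv (Points.idMap ^ (-(k : ℤ) - 1)) Points.idMap (h1 _)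
      (Points.compEval_idMap _) v
    rw [← zpow_add_one, sub_add_cancel, ih, hid] at h
    push_cast at h ⊢
    linear_combination -h

end IsPointDerivation

end PointDerivation

/-! ### Nullstellensatz, invariant derivations and local parameters on the curve -/

section Reduced

variable [IsDomain O] [Algebra.FiniteType ℂ O]

/-- Over `ℂ`, residue fields of finitely generated algebras are `ℂ`. -/
theorem exists_algHom_ker_eq {B : Type*} [CommRing B] [Algebra ℂ B] [Algebra.FiniteType ℂ B]
    (M : Ideal B) [hM : M.IsMaximal] : ∃ φ : B →ₐ[ℂ] ℂ, ∀ b, φ b = 0 ↔ b ∈ M := by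
  let _ : Field (B ⧸ M) := Ideal.Quotient.field M
  have : Algebra.FiniteType ℂ (B ⧸ M) :=
    Algebra.FiniteType.of_surjective (Ideal.Quotient.mkₐ ℂ M) (Ideal.Quotient.mkₐ_surjective ℂ M)
  have : Module.Finite ℂ (B ⧸ M) := finite_of_finite_type_of_isJacobsonRing ℂ (B ⧸ M)
  have hb : Function.Bijective (algebraMap ℂ (B ⧸ M)) :=
    IsAlgClosed.algebraMap_bijective_of_isIntegral
  let e : ℂ ≃ₐ[ℂ] (B ⧸ M) := AlgEquiv.ofBijective (Algebra.ofId ℂ (B ⧸ M)) hb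
  refine ⟨e.symm.toAlgHom.comp (Ideal.Quotient.mkₐ ℂ M), fun b => ?_⟩
  simp [Ideal.Quotient.eq_zero_iff_mem]

/-- Hilbert's Nullstellensatz for a prime ideal. -/
theorem exists_algHom_of_notMem_prime {B : Type*} [CommRing B] [Algebra ℂ B]
    [Algebra.FiniteType ℂ B] (P : Ideal B) [hP : P.IsPrime] {f : B} (hf : f ∉ P) :
    ∃ φ : B →ₐ[ℂ] ℂ, (∀ b ∈ P, φ b = 0) ∧ φ f ≠ 0 := by
  have : IsJacobsonRing B := isJacobsonRing_of_finiteType (A := ℂ)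
  have h : P.jacobson = P := IsJacobsonRing.out ‹_› hP.isRadical
  rw [← h, Ideal.jacobson, Ideal.mem_sInf] at hf
  push Not at hf
  obtain ⟨M, ⟨hPM, hM⟩, hfM⟩ := hf
  obtain ⟨φ, hφ⟩ := exists_algHom_ker_eq M
  exact ⟨φ, fun b hb => (hφ b).2 (hPM hb), fun h => hfM ((hφ f).1 h)⟩

theorem exists_eval_ne_zero {v : O} (hv : v ≠ 0) : ∃ c : Points O, c.eval v ≠ 0 := by
  obtain ⟨φ, -, h⟩ := exists_algHom_of_notMem_prime (⊥ : Ideal O) (f := v) hv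
  exact ⟨Points.ofHom φ, h⟩

theorem eq_of_eval_eq {v w : O} (h : ∀ c : Points O, c.eval v = c.eval w) : v = w := by
  by_contra hne
  obtain ⟨c, hc⟩ := exists_eval_ne_zero (sub_ne_zero.2 hne)
  exact hc (by rw [Points.eval_sub, h, sub_self])

theorem Points.translate_translate (c d : Points O) (v : O) :
    c.translate (d.translate v) = (c * d).translate v :=
  eq_of_eval_eq fun x => by simp only [Points.eval_translate]; rw [← mul_assoc, mul_comm d c]

/-- The invariant derivation attached to a point derivation at the identity. -/
theorem exists_invariant_derivation {δ : O →ₗ[ℂ] ℂ} (hδ : IsPointDerivation δ) :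
    ∃ E : Derivation ℂ O O, ∀ (c : Points O) (v : O), c.eval (E v) = δ (c.translate v) := by
  let L : O →ₗ[ℂ] O := (TensorProduct.rid ℂ O).toLinearMap ∘ₗ LinearMap.lTensor O δ ∘ₗ
    Coalgebra.comul (R := ℂ)
  have hL : ∀ (c : Points O) (v : O), c.eval (L v) = δ (c.translate v) := by
    intro c v
    have key : ∀ x : O ⊗[ℂ] O, c.eval (TensorProduct.rid ℂ O (LinearMap.lTensor O δ x)) =
        δ (LinearMap.mul' ℂ O (TensorProduct.map c.const.ofConv.toLinearMap
          (Points.idMap (O := O)).ofConv.toLinearMap x)) := by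
      intro x
      induction x using TensorProduct.induction_on with
      | zero => simp
      | tmul a b =>
        simp only [LinearMap.lTensor_tmul, TensorProduct.rid_tmul, TensorProduct.map_tmul,
          AlgHom.toLinearMap_apply, LinearMap.mul'_apply]
        change c.evalHom _ = δ (algebraMap ℂ O (c.eval a) * b)
        rw [map_smul, ← Algebra.smul_def, map_smul, smul_eq_mul, smul_eq_mul, mul_comm]
        rfl
      | add x y hx hy => simp only [map_add, Points.eval_add, hx, hy]
    rw [show c.translate v = LinearMap.mul' ℂ O (TensorProduct.map c.const.ofConv.toLinearMap
          (Points.idMap (O := O)).ofConv.toLinearMap (Coalgebra.comul (R := ℂ) v)) from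
        Points.conv_apply _ _ _, ← key]
    rfl
  refine ⟨Derivation.mk' L fun a b => eq_of_eval_eq fun c => ?_, hL⟩
  simp only [smul_eq_mul, Points.eval_add, Points.eval_mul_right, hL]
  rw [map_mul, hδ.leibniz, Points.eval_translate, Points.eval_translate, mul_one]
  ring

/-- A derivation of a domain of transcendence degree one that kills a transcendental element is
zero. -/
theorem derivation_eq_zero {B : Type*} [CommRing B] [IsDomain B] [Algebra ℂ B]
    (hdim : Algebra.trdeg ℂ B = 1) {x : B} (hx : Transcendental ℂ x) (E : Derivation ℂ B B)
    (hE : E x = 0) (y : B) : E y = 0 := by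
  have hb : IsTranscendenceBasis ℂ (fun _ : Unit => x) := by
    have : AlgebraicIndependent ℂ (fun _ : Unit => x) :=
      algebraicIndependent_unique_type_iff.2 hx
    refine this.isTranscendenceBasis_of_lift_trdeg_le_of_finite ?_
    simp [hdim]
  let S := Algebra.adjoin ℂ (Set.range fun _ : Unit => x)
  have : CharZero S := charZero_of_injective_algebraMap (algebraMap ℂ S).injective
  have halg : Algebra.IsAlgebraic S B := hb.isAlgebraic
  have hS : ∀ s : S, E s = 0 := fun s => by
    have := Derivation.eqOn_adjoin (D1 := E) (D2 := 0) (s := Set.range fun _ : Unit => x)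
      (by rintro _ ⟨_, rfl⟩; simpa using hE)
    simpa using this s.2
  let E' : Derivation S B B :=
    { toLinearMap := { toFun := E, map_add' := map_add E
                       map_smul' := fun s b => by
                        simp [Algebra.smul_def, hS] }
      map_one_eq_zero' := E.map_one_eq_zero
      leibniz' := E.leibniz }
  -- Take an equation `p(y) = 0` of least degree. Deriving it gives `p'(y) * E y = 0`, and `p'(y) ≠
  -- 0` by minimality.
  obtain ⟨p, ⟨hp0, hpy⟩, hmin⟩ := WellFounded.has_min
    (measure (fun p : Polynomial S => p.natDegree)).wf
    {p | p ≠ 0 ∧ Polynomial.aeval y p = 0} (halg.isAlgebraic y)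
  have h := E'.map_aeval p y
  rw [hpy, map_zero, smul_eq_mul] at h
  refine (mul_eq_zero.1 h.symm).resolve_left fun h0 => ?_
  have hdeg : p.natDegree ≠ 0 := fun hd => by
    obtain ⟨a, rfl⟩ := Polynomial.natDegree_eq_zero.1 hd
    refine hp0 ?_
    rw [Polynomial.aeval_C] at hpy
    rw [show a = 0 from Subtype.ext hpy, Polynomial.C_0]
  refine hmin p.derivative ⟨fun hd => hdeg (Polynomial.derivative_eq_zero.1 hd),
    h0⟩ (Polynomial.natDegree_derivative_lt hdeg)

/-- Two point derivations at the identity of a one-dimensional group are proportional. -/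
theorem pointDerivation_proportional (hdim : Algebra.trdeg ℂ O = 1) {δ δ' : O →ₗ[ℂ] ℂ}
    (hδ : IsPointDerivation δ) (hδ' : IsPointDerivation δ') (h : δ ≠ 0) :
    ∃ k : ℂ, ∀ v, δ' v = k * δ v := by
  obtain ⟨E, hE⟩ := exists_invariant_derivation hδ
  obtain ⟨E', hE'⟩ := exists_invariant_derivation hδ'
  have : Algebra.Transcendental ℂ O := by
    rw [← trdeg_ne_zero_iff, hdim]; exact one_ne_zero
  obtain ⟨x, hx⟩ := this.transcendental
  have hx0 : E x ≠ 0 := fun hx0 => h <| LinearMap.ext fun v => by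
    rw [← Points.translate_one v, ← hE 1, derivation_eq_zero hdim hx E hx0, Points.eval_zero]
    rfl
  -- The combination `E x • E' - E' x • E` kills the transcendental element `x`, hence is zero.
  -- Evaluating at a point `c` with `(E x)(c) ≠ 0` and translating back by `c⁻¹` compares the values
  -- at the identity.
  have hEE : ∀ v, E x * E' v = E' x * E v := fun v => by
    have := derivation_eq_zero hdim hx (E x • E' - E' x • E) (by simp [mul_comm]) v
    simpa [sub_eq_zero] using this
  obtain ⟨c, hc⟩ := exists_eval_ne_zero hx0
  refine ⟨c.eval (E' x) / c.eval (E x), fun v => ?_⟩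
  have h1 := congrArg c.eval (hEE (c⁻¹.translate v))
  simp only [Points.eval_mul_right] at h1
  rw [hE c (c⁻¹.translate v), hE' c (c⁻¹.translate v), Points.translate_translate, mul_inv_cancel, Points.translate_one] at h1
  field_simp
  linear_combination h1

/-- A linear functional on `O / 𝔪²` that detects `u` becomes a point derivation once a multiple of
the counit is subtracted so that it kills constants. -/
theorem exists_pointDerivation_ne_zero {u : O} (hu : IsLocalParameter u) :
    ∃ δ : O →ₗ[ℂ] ℂ, IsPointDerivation δ ∧ δ u ≠ 0 := by
  set I : Ideal O := RingHom.ker (Bialgebra.counitAlgHom ℂ O) with hI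
  have hu2 : Ideal.Quotient.mk (I ^ 2) u ≠ 0 := fun h => hu.2 (Ideal.Quotient.eq_zero_iff_mem.1 h)
  obtain ⟨f, hf⟩ : ∃ f : Module.Dual ℂ (O ⧸ I ^ 2), f (Ideal.Quotient.mk (I ^ 2) u) ≠ 0 := by
    by_contra! h
    exact hu2 ((Module.forall_dual_apply_eq_zero_iff ℂ _).1 h)
  let g : O →ₗ[ℂ] ℂ := f ∘ₗ (Ideal.Quotient.mkₐ ℂ (I ^ 2)).toLinearMap
  have hg : ∀ v ∈ I ^ 2, g v = 0 := fun v hv =>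
    (congrArg f (Ideal.Quotient.eq_zero_iff_mem.2 hv)).trans (map_zero f)
  have hmem : ∀ v, v - algebraMap ℂ O ((1 : Points O).eval v) ∈ I := fun v => by
    rw [hI, RingHom.mem_ker]
    change (1 : Points O).eval _ = 0
    rw [Points.eval_sub, Points.eval_algebraMap, sub_self]
  let ε : O →ₗ[ℂ] ℂ := (1 : Points O).evalHom.toLinearMap
  refine ⟨g - (g 1) • ε, ⟨fun v w => ?_⟩, ?_⟩
  · have h := hg _ (pow_two I ▸ Ideal.mul_mem_mul (hmem v) (hmem w))
    rw [sub_mul, mul_sub, mul_sub, ← map_mul, mul_comm v (algebraMap _ _ _), ← Algebra.smul_def,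
      ← Algebra.smul_def, Algebra.algebraMap_eq_smul_one] at h
    simp only [map_sub, map_smul, smul_eq_mul] at h
    change g (v * w) - g 1 * (1 : Points O).eval (v * w) =
      (g v - g 1 * (1 : Points O).eval v) * _ + _ * (g w - g 1 * (1 : Points O).eval w)
    rw [Points.eval_mul_right]
    linear_combination h
  · have h1 : (1 : Points O).eval u = 0 := hu.1
    change g u - g 1 * (1 : Points O).eval u ≠ 0
    rw [h1, mul_zero, sub_zero]
    exact hf

/-- Local parameters have nonzero derivative. -/
theorem IsLocalParameter.derivation_ne_zero (hdim : Algebra.trdeg ℂ O = 1) {u : O}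
    (hu : IsLocalParameter u) {δ : O →ₗ[ℂ] ℂ} (hδ : IsPointDerivation δ) (h : δ ≠ 0) :
    δ u ≠ 0 := fun h0 => by
  obtain ⟨δ', hδ', hu'⟩ := exists_pointDerivation_ne_zero hu
  obtain ⟨k, hk⟩ := pointDerivation_proportional hdim hδ hδ' h
  exact hu' (by rw [hk, h0, mul_zero])

/-- If `𝔪 = 𝔪²`, this finitely generated idempotent ideal of a domain is `0` or the whole ring. The
former makes `O` algebraic over `ℂ`, against the dimension; the latter is impossible for a kernel of
this kind. -/
theorem exists_isLocalParameter (hdim : Algebra.trdeg ℂ O = 1) : ∃ u : O, IsLocalParameter u := by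
  set I : Ideal O := RingHom.ker (Bialgebra.counitAlgHom ℂ O) with hI
  by_contra! hno
  have : IsNoetherianRing O := Algebra.FiniteType.isNoetherianRing ℂ O
  have hsq : I * I = I := le_antisymm Ideal.mul_le_left fun v hv => by
    by_contra hv2
    exact hno v ⟨hv, by rwa [pow_two]⟩
  rcases (I.isIdempotentElem_iff_eq_bot_or_top (IsNoetherian.noetherian I)).1 hsq with h | h
  · have hinj : Function.Injective (Bialgebra.counitAlgHom ℂ O) :=
      (RingHom.injective_iff_ker_eq_bot _).2 h
    have : Algebra.IsAlgebraic ℂ O := ⟨fun v => by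
      have : v = algebraMap ℂ O (Bialgebra.counitAlgHom ℂ O v) := hinj (by simp)
      rw [this]
      exact isAlgebraic_algebraMap _⟩
    exact one_ne_zero (hdim.symm.trans (trdeg_eq_zero (R := ℂ) (A := O)))
  · exact RingHom.ker_ne_top _ h

theorem isLocalParameter_of_derivation_ne_zero {u : O} (hu : (1 : Points O).eval u = 0)
    {δ : O →ₗ[ℂ] ℂ} (hδ : IsPointDerivation δ) (h : δ u ≠ 0) : IsLocalParameter u := by
  refine ⟨hu, fun hu2 => h ?_⟩
  have key : ∀ v ∈ RingHom.ker (Bialgebra.counitAlgHom ℂ O) ^ 2, δ v = 0 := fun v hv => by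
    rw [pow_two] at hv
    refine Submodule.mul_induction_on hv (fun a ha b hb => ?_) fun a b ha hb => by
      rw [map_add, ha, hb, add_zero]
    have ha' : (1 : Points O).eval a = 0 := ha
    have hb' : (1 : Points O).eval b = 0 := hb
    rw [hδ.leibniz, ha', hb', mul_zero, zero_mul, add_zero]
  exact key u hu2

/-- Near the identity, the ideal of the identity is generated by any local parameter. -/
theorem IsLocalParameter.exists_mul_mem (hdim : Algebra.trdeg ℂ O = 1) {u : O}
    (hu : IsLocalParameter u) : ∃ e : O, (1 : Points O).eval e = 1 ∧
      ∀ v : O, (1 : Points O).eval v = 0 → ∃ y, e * v = u * y := by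
  set I : Ideal O := RingHom.ker (Bialgebra.counitAlgHom ℂ O) with hI
  have : IsNoetherianRing O := Algebra.FiniteType.isNoetherianRing ℂ O
  obtain ⟨δ, hδ, hδu⟩ := exists_pointDerivation_ne_zero hu
  -- Subtracting the multiple `δ v / δ u` of `u` leaves an element of `𝔪` with zero derivative. It
  -- lies in `𝔪²`, since a local parameter has nonzero derivative. Nakayama's lemma then yields `e`,
  -- congruent to `1` modulo `𝔪`.
  have hle : I ≤ Ideal.span {u} ⊔ I • I := fun v hv => by
    have hmem : v - (δ v / δ u) • u ∈ I := by
      refine sub_mem hv ?_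
      rw [Algebra.smul_def]
      exact I.mul_mem_left _ hu.1
    have h2 : v - (δ v / δ u) • u ∈ I ^ 2 := by
      by_contra h2
      refine IsLocalParameter.derivation_ne_zero hdim ⟨hmem, h2⟩ hδ (fun h => hδu (by simp [h])) ?_
      rw [map_sub, map_smul, smul_eq_mul, div_mul_cancel₀ _ hδu, sub_self]
    rw [← sub_add_cancel v ((δ v / δ u) • u), add_comm]
    refine Submodule.add_mem_sup ?_ (by rwa [smul_eq_mul, ← pow_two])
    rw [Algebra.smul_def]
    exact Ideal.mul_mem_left _ _ (Ideal.mem_span_singleton_self u)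
  obtain ⟨e, he, heI⟩ := Submodule.exists_sub_one_mem_and_smul_le_of_fg_of_le_sup
    (IsNoetherian.noetherian I) le_rfl hle
  refine ⟨e, ?_, fun v hv => ?_⟩
  · have h : (1 : Points O).eval (e - 1) = 0 := he
    rwa [Points.eval_sub, Points.eval_one, sub_eq_zero] at h
  · obtain ⟨y, hy⟩ := Ideal.mem_span_singleton'.1 (heI (Submodule.smul_mem_pointwise_smul v e I hv))
    exact ⟨y, by rw [mul_comm u, hy]; rfl⟩

end Reduced

end Curve

/-! ### Conductors and primes with principal maximal ideal -/

section Normal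

variable {B K : Type*} [CommRing B] [IsDomain B] [Field K] [Algebra B K] [IsFractionRing B K]

/-- The integral closure of a finitely generated domain over a field of characteristic zero has a
nonzero conductor. -/
theorem exists_conductor_ne_zero (k : Type*) [Field k] [CharZero k] [Algebra k B]
    [Algebra.FiniteType k B] :
    ∃ d : B, d ≠ 0 ∧ ∀ g : K, IsIntegral B g → ∃ b, algebraMap B K b = algebraMap B K d * g := by
  -- By Noether normalization `K` is a finite separable extension of the fraction field of a
  -- polynomial ring, so the integral closure is a finite module; a common denominator of its
  -- generators lies in the conductor.
  obtain ⟨s, φ, hinj, hfin⟩ := exists_finite_inj_algHom_of_fg k B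
  let A := MvPolynomial (Fin s) k
  algebraize [φ.toRingHom]
  let _ : Algebra A K := ((algebraMap B K).comp φ.toRingHom).toAlgebra
  have : IsScalarTower A B K := IsScalarTower.of_algebraMap_eq fun _ => rfl
  have : Module.Finite A B := hfin
  have hAB : Function.Injective (algebraMap A B) := hinj
  have : FaithfulSMul A B := (faithfulSMul_iff_algebraMap_injective A B).2 hAB
  have hAK : Function.Injective (algebraMap A K) := (IsFractionRing.injective B K).comp hinj
  have : FaithfulSMul A K := (faithfulSMul_iff_algebraMap_injective A K).2 hAK
  let F := FractionRing A
  let _ : Algebra F K := FractionRing.liftAlgebra A K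
  have : IsScalarTower A F K := inferInstance
  have : FiniteDimensional F K := .of_isLocalization A B (nonZeroDivisors A)
  have : CharZero A := charZero_of_injective_algebraMap (MvPolynomial.C_injective (Fin s) k)
  have : CharZero F := charZero_of_injective_algebraMap (IsFractionRing.injective A F)
  have hC : Module.Finite A (integralClosure A K) := IsIntegralClosure.finite A F K _
  obtain ⟨t, ht⟩ := (Module.Finite.iff_fg (N := Subalgebra.toSubmodule (integralClosure A K))).1 hC
  obtain ⟨d, hd⟩ := IsLocalization.exist_integer_multiples_of_finset (nonZeroDivisors B) t
  refine ⟨d, nonZeroDivisors.ne_zero d.2, fun g hg => ?_⟩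
  have hgA : g ∈ integralClosure A K := by
    have : Algebra.IsIntegral A B := Algebra.IsIntegral.of_finite A B
    exact isIntegral_trans g hg
  rw [← Subalgebra.mem_toSubmodule, ← ht] at hgA
  clear hg
  induction hgA using Submodule.span_induction with
  | mem x hx =>
    obtain ⟨b, hb⟩ := hd x hx
    exact ⟨b, by rw [hb, Algebra.smul_def]⟩
  | zero => exact ⟨0, by simp⟩
  | add x y _ _ hx hy =>
    obtain ⟨b, hb⟩ := hx
    obtain ⟨b', hb'⟩ := hy
    exact ⟨b + b', by rw [map_add, hb, hb', mul_add]⟩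
  | smul a x _ hx =>
    obtain ⟨b, hb⟩ := hx
    refine ⟨algebraMap A B a * b, ?_⟩
    rw [map_mul, hb, Algebra.smul_def, IsScalarTower.algebraMap_apply A B K]
    ring

/-- In a Noetherian normal domain, an element of the fraction field which is not in the localization
at a prime `M` is not in the localization at some prime contained in `M` at which the maximal ideal
is principal. -/
theorem exists_prime_principal [IsNoetherianRing B] [IsIntegrallyClosed B] (f : K) (M : Ideal B)
    [M.IsPrime] (hf : ∀ a b, algebraMap B K b * f = algebraMap B K a → b ∈ M) :
    ∃ P : Ideal B, P.IsPrime ∧ P ≤ M ∧ (∀ a b, algebraMap B K b * f = algebraMap B K a → b ∈ P) ∧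
      ∃ p ∈ P, ∀ x ∈ P, ∃ s, s ∉ P ∧ ∃ y, s * x = y * p := by
  have hinj := IsFractionRing.injective B K
  -- `Q r` consists of the `b` such that `b * r * f` lies in the localization at `M`. A maximal
  -- proper ideal of this form is prime, by the usual argument for associated primes.
  let Q : B → Ideal B := fun r =>
    { carrier := {b | ∃ s, s ∉ M ∧ ∃ a, algebraMap B K (s * b * r) * f = algebraMap B K a}
      zero_mem' := ⟨1, fun h => ‹M.IsPrime›.ne_top ((Ideal.eq_top_iff_one M).2 h), 0, by simp⟩
      add_mem' := by
        rintro b b' ⟨s, hs, a, h⟩ ⟨s', hs', a', h'⟩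
        refine ⟨s * s', fun hss => (‹M.IsPrime›.mem_or_mem hss).elim hs hs', s' * a + s * a', ?_⟩
        simp only [map_mul, map_add] at h h' ⊢
        linear_combination algebraMap B K s' * h + algebraMap B K s * h'
      smul_mem' := by
        rintro c b ⟨s, hs, a, h⟩
        refine ⟨s, hs, c * a, ?_⟩
        simp only [map_mul, smul_eq_mul] at h ⊢
        linear_combination algebraMap B K c * h }
  have hQ : ∀ r, 1 ∉ Q r ↔ Q r ≤ M := fun r => by
    refine ⟨fun h b hb => ?_, fun h h1 => ‹M.IsPrime›.ne_top ((Ideal.eq_top_iff_one M).2 (h h1))⟩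
    by_contra hbM
    obtain ⟨s, hs, a, h'⟩ := hb
    refine h ⟨s * b, fun hss => (‹M.IsPrime›.mem_or_mem hss).elim hs hbM, a, by rwa [mul_one]⟩
  have hne : {I | ∃ r, I = Q r ∧ 1 ∉ Q r}.Nonempty := by
    refine ⟨Q 1, 1, rfl, ?_⟩
    rintro ⟨s, hs, a, h⟩
    exact hs (hf a s (by simpa using h))
  obtain ⟨_, ⟨r, rfl, h1⟩, hmax⟩ := set_has_maximal_iff_noetherian.2 ‹IsNoetherianRing B› _ hne
  set P := Q r with hP
  have hPprime : P.IsPrime := by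
    refine ⟨(Ideal.ne_top_iff_one _).2 h1, fun {a b} hab => or_iff_not_imp_left.2 fun ha => ?_⟩
    have h1' : 1 ∉ Q (a * r) := fun ⟨s, hs, c, h⟩ => ha ⟨s, hs, c, by rwa [mul_one, ← mul_assoc] at h⟩
    have hle : P ≤ Q (a * r) := fun x ⟨s, hs, c, h⟩ => ⟨s, hs, a * c, by
      simp only [map_mul] at h ⊢
      linear_combination algebraMap B K a * h⟩
    have heq : P = Q (a * r) := by
      by_contra hne
      exact hmax _ ⟨_, rfl, h1'⟩ (lt_of_le_of_ne hle hne)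
    rw [heq]
    obtain ⟨s, hs, c, h⟩ := hab
    exact ⟨s, hs, c, by rw [← h]; ring_nf⟩
  -- a single denominator works for all of `P`
  obtain ⟨s, hs, hsP⟩ : ∃ s, s ∉ M ∧ ∀ b ∈ P, ∃ a, algebraMap B K (s * b * r) * f =
      algebraMap B K a := by
    obtain ⟨T, hT⟩ := IsNoetherian.noetherian P
    choose! σ hσ a ha using fun b (hb : b ∈ P) => (hb : ∃ s, s ∉ M ∧ ∃ a,
      algebraMap B K (s * b * r) * f = algebraMap B K a)
    have hTP : ∀ b ∈ T, b ∈ P := fun b hb => hT ▸ Submodule.subset_span hb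
    refine ⟨∏ b ∈ T, σ b, fun h => ?_, fun b hb => ?_⟩
    · obtain ⟨b, hb, hbM⟩ := (Ideal.IsPrime.prod_mem_iff (p := M)).1 h
      exact hσ b (hTP b hb) hbM
    · rw [← hT] at hb
      induction hb using Submodule.span_induction with
      | mem x hx =>
        obtain ⟨c, hc⟩ := Finset.dvd_prod_of_mem σ hx
        refine ⟨c * a x, ?_⟩
        have := ha x (hTP x hx)
        rw [hc]
        simp only [map_mul] at this ⊢
        linear_combination algebraMap B K c * this
      | zero => exact ⟨0, by simp⟩
      | add x y _ _ hx hy =>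
        obtain ⟨a, ha⟩ := hx
        obtain ⟨a', ha'⟩ := hy
        exact ⟨a + a', by rw [map_add, ← ha, ← ha', ← add_mul, ← map_add]; ring_nf⟩
      | smul c x _ hx =>
        obtain ⟨a, ha⟩ := hx
        refine ⟨c * a, ?_⟩
        rw [map_mul _ c a, ← ha, smul_eq_mul]
        simp only [map_mul]
        ring
  set g : K := algebraMap B K (s * r) * f with hg
  have hgP : ∀ b, b ∈ P ↔ ∃ a, algebraMap B K b * g = algebraMap B K a := fun b => by
    have : algebraMap B K b * g = algebraMap B K (s * b * r) * f := by
      rw [hg]; simp only [map_mul]; ring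
    rw [this]
    exact ⟨hsP b, fun ⟨a, ha⟩ => ⟨s, hs, a, ha⟩⟩
  refine ⟨P, hPprime, (hQ r).1 h1, fun a b hab => (hgP b).2 ⟨s * r * a, ?_⟩, ?_⟩
  · rw [hg]
    simp only [map_mul] at hab ⊢
    linear_combination (algebraMap B K s * algebraMap B K r) * hab
  by_contra! hno
  -- otherwise `g * P ⊆ P` and `g` is integral
  have hstab : ∀ b ∈ P, ∃ a ∈ P, algebraMap B K b * g = algebraMap B K a := fun b hb => by
    obtain ⟨a, ha⟩ := (hgP b).1 hb
    refine ⟨a, ?_, ha⟩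
    by_contra haP
    -- If `b * g = a` with `a ∉ P`, then `a * x = (x * g) * b` for every `x ∈ P`, so `b` would
    -- generate `P` locally.
    obtain ⟨x, hx, hxs⟩ := hno b hb
    obtain ⟨y, hy⟩ := (hgP x).1 hx
    refine hxs a haP y (hinj ?_)
    rw [map_mul, map_mul, ← ha, ← hy]; ring
  obtain ⟨p, hp, hp0⟩ : ∃ p ∈ P, p ≠ 0 := by
    obtain ⟨a, b, hb, hab⟩ := IsFractionRing.div_surjective (A := B) g
    have hb0 : b ≠ 0 := nonZeroDivisors.ne_zero hb
    refine ⟨b, (hgP b).2 ⟨a, ?_⟩, hb0⟩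
    rw [← hab, mul_div_cancel₀]
    exact (map_ne_zero_iff _ hinj).2 hb0
  have hint : IsIntegral B g := by
    refine isIntegral_of_smul_mem_submodule (R := B)
      (Submodule.map (Algebra.linearMap B K) P) ?_ ((IsNoetherian.noetherian P).map _) g ?_
    · refine (Submodule.ne_bot_iff _).2 ⟨_, Submodule.mem_map_of_mem hp, ?_⟩
      exact (map_ne_zero_iff _ hinj).2 hp0
    · rintro _ ⟨b, hb, rfl⟩
      obtain ⟨a, ha, h⟩ := hstab b hb
      exact ⟨a, ha, by rw [smul_eq_mul, mul_comm]; exact h.symm⟩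
  obtain ⟨a, ha⟩ := IsIntegrallyClosed.isIntegral_iff.1 hint
  exact h1 ((hgP 1).2 ⟨a, by rw [map_one, one_mul, ha]⟩)

end Normal

/-! ### The variety `T` -/

section TorusBasics

variable {O : Type*} [CommRing O] [HopfAlgebra ℂ O] [Coalgebra.IsCocomm ℂ O]
  {X : Type*} [AddCommGroup X]

/-- The value at `t` of the homomorphism `T → 𝒞` given by `x`. -/
def charVal (x : X) (t : Torus O X) : Points O := (character O x t).toMul

theorem charVal_add_right (x : X) (s t : Torus O X) :
    charVal x (s + t) = charVal x s * charVal x t :=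
  congrArg Additive.toMul (map_add (character O x) s t)

theorem charVal_tmul (x : X) (c : Points O) (ν : Module.Dual ℤ X) :
    charVal x (Additive.ofMul c ⊗ₜ[ℤ] ν) = c ^ (ν x) :=
  congrArg Additive.toMul (character_tmul O X x c ν)

theorem charVal_add_left (x y : X) (t : Torus O X) :
    charVal (x + y) t = charVal x t * charVal y t := by
  induction t using TensorProduct.induction_on with
  | zero => simp [charVal]
  | tmul c ν =>
    have h := fun z : X => charVal_tmul z c.toMul ν
    rw [ofMul_toMul] at h
    rw [h, h, h, map_add, zpow_add]
  | add a b ha hb =>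
    rw [charVal_add_right, charVal_add_right, charVal_add_right, ha, hb, mul_mul_mul_comm]

/-- `x ↦ x(t)` as a homomorphism. -/
def charHom (t : Torus O X) : X →+ Additive (Points O) where
  toFun x := Additive.ofMul (charVal x t)
  map_zero' := by
    have h := charVal_add_left 0 0 t
    rw [add_zero, left_eq_mul] at h
    rw [h, ofMul_one]
  map_add' x y := by rw [charVal_add_left, ofMul_mul]

theorem charVal_zero_left (t : Torus O X) : charVal (0 : X) t = 1 := map_zero (charHom t)

theorem charVal_zero_right (x : X) : charVal x (0 : Torus O X) = 1 :=
  map_zero (character O x)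

theorem charVal_neg_left (x : X) (t : Torus O X) : charVal (-x) t = (charVal x t)⁻¹ :=
  map_neg (charHom t) x

theorem charVal_sub_left (x y : X) (t : Torus O X) :
    charVal (x - y) t = charVal x t / charVal y t := map_sub (charHom t) x y

theorem charVal_zsmul_left (m : ℤ) (x : X) (t : Torus O X) : charVal (m • x) t = charVal x t ^ m :=
  map_zsmul (charHom t) m x

theorem charVal_torusAct_inv (w : X ≃ₗ[ℤ] X) (x : X) (t : Torus O X) :
    charVal x (torusAct O X w⁻¹ t) = charVal (w x) t :=
  congrArg Additive.toMul (character_torusAct O X w x t)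

theorem mem_divisor {α : X} {x : Points O} {t : Torus O X} :
    t ∈ divisor α x ↔ charVal α t = x := Iff.rfl

/-- Evaluation of regular functions at a point of `T`. -/
def evalAt (t : Torus O X) : coordinateRing O X →ₐ[ℂ] ℂ :=
  (Pi.evalAlgHom ℂ (fun _ : Torus O X => ℂ) t).comp (coordinateRing O X).val

@[simp] theorem evalAt_pullback (t : Torus O X) (x : X) (v : O) :
    evalAt t (pullback x v) = (charVal x t).eval v := rfl

theorem coordinateRing_ext {f g : coordinateRing O X} (h : ∀ t, evalAt t f = evalAt t g) : f = g :=
  Subtype.ext (funext h)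

theorem evalAt_smul (w : X ≃ₗ[ℤ] X) (t : Torus O X) (f : coordinateRing O X) :
    evalAt t (w • f) = evalAt (torusAct O X w⁻¹ t) f := rfl

theorem pullback_add (x : X) (v w : O) : pullback x (v + w) = pullback x v + pullback x w :=
  coordinateRing_ext fun t => by simp

theorem pullback_mul (x : X) (v w : O) : pullback x (v * w) = pullback x v * pullback x w :=
  coordinateRing_ext fun t => by simp

theorem smul_pullback (w : X ≃ₗ[ℤ] X) (x : X) (v : O) :
    w • pullback x v = pullback (w x) v :=
  coordinateRing_ext fun t => by simp [evalAt_smul, charVal_torusAct_inv]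

theorem coordinateRing_induction {p : coordinateRing O X → Prop}
    (pullback : ∀ x v, p (pullback x v)) (const : ∀ r : ℂ, p (algebraMap ℂ _ r))
    (add : ∀ f g, p f → p g → p (f + g)) (mul : ∀ f g, p f → p g → p (f * g))
    (f : coordinateRing O X) : p f := by
  obtain ⟨f, hf⟩ := f
  induction hf using Algebra.adjoin_induction with
  | mem f hf =>
    obtain ⟨x, v, rfl⟩ := hf
    exact pullback x v
  | algebraMap r => exact const r
  | add f g hf hg h1 h2 => exact add ⟨f, hf⟩ ⟨g, hg⟩ h1 h2
  | mul f g hf hg h1 h2 => exact mul ⟨f, hf⟩ ⟨g, hg⟩ h1 h2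

section Translation

/-- Translations of `T` act on regular functions. -/
theorem exists_translate (s : Torus O X) (f : coordinateRing O X) :
    ∃ g : coordinateRing O X, ∀ t, evalAt t g = evalAt (t + s) f := by
  induction f using coordinateRing_induction with
  | pullback x v =>
    refine ⟨pullback x ((charVal x s).translate v), fun t => ?_⟩
    rw [evalAt_pullback, evalAt_pullback, Points.eval_translate, charVal_add_right, mul_comm]
  | const r => exact ⟨algebraMap ℂ _ r, fun t => by simp⟩
  | add f g hf hg =>
    obtain ⟨f', hf⟩ := hf
    obtain ⟨g', hg⟩ := hg
    exact ⟨f' + g', fun t => by simp [hf, hg]⟩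
  | mul f g hf hg =>
    obtain ⟨f', hf⟩ := hf
    obtain ⟨g', hg⟩ := hg
    exact ⟨f' * g', fun t => by simp [hf, hg]⟩

/-- The automorphism `f ↦ f(· + s)` of the coordinate ring. -/
def translateEquiv (s : Torus O X) : coordinateRing O X ≃+* coordinateRing O X where
  toFun f := (exists_translate s f).choose
  invFun f := (exists_translate (-s) f).choose
  left_inv f := coordinateRing_ext fun t => by
    rw [(exists_translate (-s) _).choose_spec, (exists_translate s _).choose_spec,
      neg_add_cancel_right]
  right_inv f := coordinateRing_ext fun t => by
    rw [(exists_translate s _).choose_spec, (exists_translate (-s) _).choose_spec,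
      add_neg_cancel_right]
  map_mul' f g := coordinateRing_ext fun t => by
    rw [map_mul, (exists_translate s _).choose_spec, (exists_translate s _).choose_spec,
      (exists_translate s _).choose_spec, map_mul]
  map_add' f g := coordinateRing_ext fun t => by
    rw [map_add, (exists_translate s _).choose_spec, (exists_translate s _).choose_spec,
      (exists_translate s _).choose_spec, map_add]

theorem evalAt_translateEquiv (s t : Torus O X) (f : coordinateRing O X) :
    evalAt t (translateEquiv s f) = evalAt (t + s) f := (exists_translate s f).choose_spec t

end Translation

variable [IsDomain O] [Algebra.FiniteType ℂ O]

/-- The restriction of a regular function on `T` to the curve `c ↦ t + c ⊗ ν`. -/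
theorem exists_restrict (t : Torus O X) (ν : Module.Dual ℤ X) (f : coordinateRing O X) :
    ∃ v : O, ∀ c : Points O, c.eval v = evalAt (t + Additive.ofMul c ⊗ₜ[ℤ] ν) f := by
  induction f using coordinateRing_induction with
  | pullback x v =>
    refine ⟨Points.powHom (ν x) ((charVal x t).translate v), fun c => ?_⟩
    rw [Points.eval_powHom, Points.eval_translate, evalAt_pullback, charVal_add_right, charVal_tmul]
  | const r => exact ⟨algebraMap ℂ O r, fun c => by simp⟩
  | add f g hf hg =>
    obtain ⟨f', hf⟩ := hf
    obtain ⟨g', hg⟩ := hg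
    exact ⟨f' + g', fun t => by simp [hf, hg]⟩
  | mul f g hf hg =>
    obtain ⟨f', hf⟩ := hf
    obtain ⟨g', hg⟩ := hg
    exact ⟨f' * g', fun t => by simp [hf, hg]⟩

/-- The restriction of a regular function on `T` to the curve `c ↦ t + c ⊗ ν`. -/
def restrict (t : Torus O X) (ν : Module.Dual ℤ X) (f : coordinateRing O X) : O :=
  (exists_restrict t ν f).choose

theorem eval_restrict (t : Torus O X) (ν : Module.Dual ℤ X) (f : coordinateRing O X)
    (c : Points O) : c.eval (restrict t ν f) = evalAt (t + Additive.ofMul c ⊗ₜ[ℤ] ν) f :=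
  (exists_restrict t ν f).choose_spec c

theorem eval_one_restrict (t : Torus O X) (ν : Module.Dual ℤ X) (f : coordinateRing O X) :
    (1 : Points O).eval (restrict t ν f) = evalAt t f := by
  rw [eval_restrict, ofMul_one, TensorProduct.zero_tmul, add_zero]

/-- The curves `c ↦ t + c ⊗ ν` connect any two points, and restriction to such a curve lands in the
domain `O`. Given `f` and `g` nonzero at two points, the difference of the points is removed one
elementary tensor at a time until a common point remains. -/
instance : IsDomain (coordinateRing O X) := by
  have key : ∀ d : Torus O X, ∀ (s : Torus O X) (f g : coordinateRing O X),
      (∃ t, evalAt t f ≠ 0 ∧ evalAt (t + s + d) g ≠ 0) →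
        ∃ t, evalAt t f ≠ 0 ∧ evalAt (t + s) g ≠ 0 := by
    intro d
    induction d using TensorProduct.induction_on with
    | zero => intro s f g h; simpa using h
    | tmul c ν =>
      rintro s f g ⟨t, hf, hg⟩
      have h1 : restrict t ν f ≠ 0 := fun h => hf (by
        rw [← eval_one_restrict t ν, h, Points.eval_zero])
      have h2 : restrict (t + s) ν g ≠ 0 := fun h => hg (by
        have := eval_restrict (t + s) ν g c.toMul
        rw [h, Points.eval_zero] at this
        exact this.symm)
      obtain ⟨a, ha⟩ := exists_eval_ne_zero (mul_ne_zero h1 h2)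
      rw [Points.eval_mul_right, eval_restrict, eval_restrict] at ha
      exact ⟨_, left_ne_zero_of_mul ha, by
        have := right_ne_zero_of_mul ha
        rwa [add_right_comm] at this⟩
    | add d e hd he =>
      rintro s f g ⟨t, hf, hg⟩
      refine hd s f g (?_)
      obtain ⟨t', h1, h2⟩ := he (s + d) f g ⟨t, hf, by
        rwa [show t + (s + d) + e = t + s + (d + e) by abel]⟩
      exact ⟨t', h1, by rwa [← add_assoc] at h2⟩
  have : Nontrivial (coordinateRing O X) := ⟨0, 1, fun h => by
    have := congrArg (evalAt (0 : Torus O X)) h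
    simp at this⟩
  have : NoZeroDivisors (coordinateRing O X) := ⟨fun {f g} h => by
    by_contra! hfg
    have hne : ∀ f : coordinateRing O X, f ≠ 0 → ∃ t, evalAt t f ≠ 0 := fun f hf => by
      by_contra! h0
      exact hf (coordinateRing_ext fun t => by rw [h0, map_zero])
    obtain ⟨t, ht⟩ := hne f hfg.1
    obtain ⟨t', ht'⟩ := hne g hfg.2
    obtain ⟨t₀, h1, h2⟩ := key (t' - t) 0 f g ⟨t, ht, by rwa [add_zero, add_sub_cancel]⟩
    rw [add_zero] at h2
    have := congrArg (evalAt t₀) h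
    rw [map_mul, map_zero] at this
    exact (mul_ne_zero h1 h2) this⟩
  exact NoZeroDivisors.to_isDomain _

scoped instance : Field (RationalFunctions O X) :=
  inferInstanceAs (Field (FractionRing (coordinateRing O X)))

/-- The derivation of `ℂ[T]` in the direction `ν`. -/
theorem exists_derivation {δ : O →ₗ[ℂ] ℂ} (hδ : IsPointDerivation δ) (ν : Module.Dual ℤ X) :
    ∃ E : Derivation ℂ (coordinateRing O X) (coordinateRing O X), ∀ t x v,
      evalAt t (E (pullback x v)) = (ν x : ℂ) * δ ((charVal x t).translate v) := by
  obtain ⟨E₀, hE₀⟩ := exists_invariant_derivation hδ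
  have hadd : ∀ t (f g : coordinateRing O X),
      restrict t ν (f + g) = restrict t ν f + restrict t ν g := fun t f g =>
    eq_of_eval_eq fun c => by simp [eval_restrict]
  have hmul : ∀ t (f g : coordinateRing O X),
      restrict t ν (f * g) = restrict t ν f * restrict t ν g := fun t f g =>
    eq_of_eval_eq fun c => by simp [eval_restrict]
  have hconst : ∀ t (r : ℂ), restrict t ν (algebraMap ℂ (coordinateRing O X) r) =
      algebraMap ℂ O r := fun t r => eq_of_eval_eq fun c => by simp [eval_restrict]
  have hpull : ∀ (t : Torus O X) (x : X) (v : O), δ (restrict t ν (pullback x v)) =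
      (ν x : ℂ) * δ ((charVal x t).translate v) := fun t x v => by
    rw [← hδ.map_powHom]
    congr 1
    refine eq_of_eval_eq fun c => ?_
    rw [eval_restrict, Points.eval_powHom, Points.eval_translate, evalAt_pullback,
      charVal_add_right, charVal_tmul]
  -- The derivative of `f` at `t` is `δ` of its restriction to the curve `c ↦ t + c ⊗ ν`. It is a
  -- regular function of `t` on generators, by the invariant derivation `E₀`, and then everywhere by
  -- the Leibniz rule.
  have hmem : ∀ f : coordinateRing O X, ∃ g : coordinateRing O X, ∀ t,
      evalAt t g = δ (restrict t ν f) := fun f => by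
    induction f using coordinateRing_induction with
    | pullback x v =>
      refine ⟨algebraMap ℂ _ (ν x : ℂ) * pullback x (E₀ v), fun t => ?_⟩
      rw [hpull, map_mul, evalAt_pullback, hE₀, AlgHom.commutes]; rfl
    | const r => exact ⟨0, fun t => by rw [hconst, hδ.map_algebraMap, map_zero]⟩
    | add f g hf hg =>
      obtain ⟨f', hf⟩ := hf
      obtain ⟨g', hg⟩ := hg
      exact ⟨f' + g', fun t => by rw [map_add, hadd, map_add, hf, hg]⟩
    | mul f g hf hg =>
      obtain ⟨f', hf⟩ := hf
      obtain ⟨g', hg⟩ := hg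
      refine ⟨f' * g + f * g', fun t => ?_⟩
      rw [hmul, hδ.leibniz, eval_one_restrict, eval_one_restrict, map_add, map_mul, map_mul, hf, hg]
  choose L hL using hmem
  have hL_mul : ∀ f g, L (f * g) = f * L g + g * L f := fun f g => coordinateRing_ext fun t => by
    rw [hL, hmul, hδ.leibniz, eval_one_restrict, eval_one_restrict, map_add, map_mul, map_mul,
      hL, hL]
    ring
  refine ⟨Derivation.mk' ({ toFun := L, map_add' := fun f g => ?_, map_smul' := fun r f => ?_ })
    hL_mul, fun t x v => (hL _ t).trans (hpull t x v)⟩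
  · exact coordinateRing_ext fun t => by rw [hL, hadd, map_add, map_add, hL, hL]
  · refine coordinateRing_ext fun t => ?_
    rw [Algebra.smul_def, hL_mul]
    simp [hL, hconst, hδ.map_algebraMap, Algebra.smul_def]

variable [Module.Free ℤ X] [Module.Finite ℤ X]

/-- `ℂ`-algebra homomorphisms `ℂ[T] → ℂ` are evaluations at points of `T`. -/
theorem exists_eq_evalAt (φ : coordinateRing O X →ₐ[ℂ] ℂ) : ∃ t : Torus O X, φ = evalAt t := by
  let ψ : X → Points O := fun x => Points.ofHom
    { toFun := fun v => φ (pullback x v)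
      map_one' := by
        rw [show pullback x (1 : O) = 1 from coordinateRing_ext fun t => by simp, map_one]
      map_mul' := fun v w => by rw [pullback_mul, map_mul]
      map_zero' := by
        rw [show pullback x (0 : O) = 0 from coordinateRing_ext fun t => by simp, map_zero]
      map_add' := fun v w => by rw [pullback_add, map_add]
      commutes' := fun r => by
        rw [show pullback x (algebraMap ℂ O r) = algebraMap ℂ _ r from
          coordinateRing_ext fun t => by simp, AlgHom.commutes] }
  have hψ : ∀ x v, (ψ x).eval v = φ (pullback x v) := fun x v => rfl
  have hadd : ∀ x y, ψ (x + y) = ψ x * ψ y := fun x y => Points.ext_eval fun v => by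
    obtain ⟨ι, _, a, b, hab⟩ := Points.exists_comul v
    rw [hab, hψ, show pullback (x + y) v = ∑ i, pullback x (a i) * pullback y (b i) from
      coordinateRing_ext fun t => by simp [charVal_add_left, hab], map_sum]
    simp [hψ]
  let Ψ : X →+ Additive (Points O) := AddMonoidHom.mk' (fun x => Additive.ofMul (ψ x)) fun x y => by
    rw [hadd, ofMul_mul]
  let b := Module.Free.chooseBasis ℤ X
  -- The comultiplication makes `ψ` additive, so it is determined by its values on a basis of `X`;
  -- the dual basis assembles them into a point of `T`.
  let t : Torus O X := ∑ i, Ψ (b i) ⊗ₜ[ℤ] b.coord i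
  have ht : charHom t = Ψ := by
    have hlin : (charHom t).toIntLinearMap = Ψ.toIntLinearMap := b.ext fun j => by
      change character O (b j) t = Ψ (b j)
      have h : ∀ i, character O (b j) (Ψ (b i) ⊗ₜ[ℤ] b.coord i) = (b.coord i (b j)) • Ψ (b i) :=
        fun i => character_tmul O X (b j) (ψ (b i)) (b.coord i)
      rw [map_sum, Finset.sum_congr rfl fun i _ => h i, Finset.sum_eq_single j]
      · simp
      · intro i _ hij
        simp [Finsupp.single_eq_of_ne hij]
      · simp
    exact AddMonoidHom.ext fun x => LinearMap.congr_fun hlin x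
  refine ⟨t, AlgHom.ext fun f => ?_⟩
  induction f using coordinateRing_induction with
  | pullback x v =>
    rw [evalAt_pullback, ← hψ]
    exact congrArg (fun c : Additive (Points O) => c.toMul.eval v) (DFunLike.congr_fun ht x).symm
  | const r => simp
  | add f g hf hg => rw [map_add, map_add, hf, hg]
  | mul f g hf hg => rw [map_mul, map_mul, hf, hg]

instance : Algebra.FiniteType ℂ (coordinateRing O X) := by
  obtain ⟨s, hs⟩ := (Algebra.FiniteType.out : (⊤ : Subalgebra ℂ O).FG)
  let b := Module.Free.chooseBasis ℤ X
  let G : Set (coordinateRing O X) := Set.range fun p : _ × s => pullback (b p.1) p.2.1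
  have hpull : ∀ x v, pullback x v ∈ Algebra.adjoin ℂ G := fun x => by
    have hx : x ∈ Submodule.span ℤ (Set.range b) := b.mem_span x
    induction hx using Submodule.span_induction with
    | mem x hx =>
      obtain ⟨i, rfl⟩ := hx
      intro v
      have hv : v ∈ Algebra.adjoin ℂ (s : Set O) := hs ▸ Algebra.mem_top
      induction hv using Algebra.adjoin_induction with
      | mem v hv => exact Algebra.subset_adjoin ⟨(i, ⟨v, hv⟩), rfl⟩
      | algebraMap r =>
        rw [show pullback (b i) (algebraMap ℂ O r) = algebraMap ℂ _ r from
          coordinateRing_ext fun t => by simp]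
        exact Subalgebra.algebraMap_mem _ r
      | add v w _ _ hv hw => rw [pullback_add]; exact add_mem hv hw
      | mul v w _ _ hv hw => rw [pullback_mul]; exact mul_mem hv hw
    | zero =>
      intro v
      rw [show pullback (0 : X) v = algebraMap ℂ _ ((1 : Points O).eval v) from
        coordinateRing_ext fun t => by simp [charVal_zero_left]]
      exact Subalgebra.algebraMap_mem _ _
    | add x y _ _ hx hy =>
      intro v
      obtain ⟨ι, _, a, b, hab⟩ := Points.exists_comul v
      rw [show pullback (x + y) v = ∑ i, pullback x (a i) * pullback y (b i) from
        coordinateRing_ext fun t => by simp [charVal_add_left, hab]]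
      exact sum_mem fun i _ => mul_mem (hx _) (hy _)
    | smul m x _ hx =>
      intro v
      rw [show pullback (m • x) v = pullback x (Points.powHom m v) from
        coordinateRing_ext fun t => by simp [charVal_zsmul_left, Points.eval_powHom]]
      exact hx _
  have hG : Algebra.adjoin ℂ G = ⊤ := by
    refine eq_top_iff.2 fun f _ => ?_
    induction f using coordinateRing_induction with
    | pullback x v => exact hpull x v
    | const r => exact Subalgebra.algebraMap_mem _ r
    | add f g hf hg => exact add_mem (hf trivial) (hg trivial)
    | mul f g hf hg => exact mul_mem (hf trivial) (hg trivial)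
  exact ⟨hG ▸ Subalgebra.fg_def.2 ⟨G, Set.finite_range _, rfl⟩⟩

instance : IsNoetherianRing (coordinateRing O X) := Algebra.FiniteType.isNoetherianRing ℂ _

/-- Hilbert's Nullstellensatz on `T`. -/
theorem exists_evalAt_ne_zero (P : Ideal (coordinateRing O X)) [P.IsPrime] {f : coordinateRing O X}
    (hf : f ∉ P) : ∃ t : Torus O X, (∀ b ∈ P, evalAt t b = 0) ∧ evalAt t f ≠ 0 := by
  obtain ⟨φ, h1, h2⟩ := exists_algHom_of_notMem_prime P hf
  obtain ⟨t, rfl⟩ := exists_eq_evalAt φ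
  exact ⟨t, h1, h2⟩

/-- The conductor `C` of the integral closure is nonzero and stable under translations. If it were
proper, all its elements would vanish at some point, yet a translate of the nonzero element `d` does
not vanish there. -/
instance : IsIntegrallyClosed (coordinateRing O X) := by
  let K := RationalFunctions O X
  obtain ⟨d, hd0, hd⟩ := exists_conductor_ne_zero (B := coordinateRing O X) (K := K) ℂ
  let C : Ideal (coordinateRing O X) :=
    { carrier := {b | ∀ g : K, IsIntegral (coordinateRing O X) g →
        ∃ a : coordinateRing O X, algebraMap _ K a = algebraMap _ K b * g}
      zero_mem' := fun g _ => ⟨0, by simp⟩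
      add_mem' := fun {b b'} h h' g hg => by
        obtain ⟨a, ha⟩ := h g hg
        obtain ⟨a', ha'⟩ := h' g hg
        exact ⟨a + a', by rw [map_add, ha, ha', map_add, add_mul]⟩
      smul_mem' := fun c b h g hg => by
        obtain ⟨a, ha⟩ := h g hg
        exact ⟨c * a, by rw [map_mul, ha, smul_eq_mul, map_mul, mul_assoc]⟩ }
  have htrans : ∀ (s : Torus O X), ∀ b ∈ C, translateEquiv s b ∈ C := fun s b hb g hg => by
    let e : K ≃+* K := IsFractionRing.ringEquivOfRingEquiv (translateEquiv s)
    have he : ∀ a, e (algebraMap _ K a) = algebraMap _ K (translateEquiv s a) :=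
      IsFractionRing.ringEquivOfRingEquiv_algebraMap _
    obtain ⟨p, hp, hpg⟩ := hg
    have hg' : IsIntegral (coordinateRing O X) (e.symm g) := by
      refine ⟨p.map (translateEquiv s).symm.toRingHom, hp.map _, e.injective ?_⟩
      rw [Polynomial.eval₂_map, map_zero, ← RingEquiv.coe_toRingHom, Polynomial.hom_eval₂]
      rw [← hpg]
      congr 1
      · ext a
        simp [he]
      · simp
    obtain ⟨a, ha⟩ := hb _ hg'
    refine ⟨translateEquiv s a, ?_⟩
    rw [← he, ha, map_mul, he, RingEquiv.apply_symm_apply]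
  have hC : C = ⊤ := by
    by_contra hC
    obtain ⟨M, hM, hCM⟩ := Ideal.exists_le_maximal C hC
    obtain ⟨t, ht, -⟩ := exists_evalAt_ne_zero M ((Ideal.ne_top_iff_one M).1 hM.ne_top)
    obtain ⟨t₀, ht₀⟩ : ∃ t₀, evalAt t₀ d ≠ 0 := by
      by_contra! h0
      exact hd0 (coordinateRing_ext fun t => by rw [h0, map_zero])
    refine ht₀ ?_
    have := ht _ (hCM (htrans (t₀ - t) d hd))
    rwa [evalAt_translateEquiv, add_sub_cancel] at this
  refine (isIntegrallyClosed_iff K).2 fun {g} hg => ?_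
  obtain ⟨a, ha⟩ := (hC ▸ Submodule.mem_top : (1 : coordinateRing O X) ∈ C) g hg
  exact ⟨a, by rw [ha, map_one, one_mul]⟩

end TorusBasics

/-! ### Regular functions and divisors -/

section Values

variable {O : Type*} [CommRing O] [HopfAlgebra ℂ O] [Coalgebra.IsCocomm ℂ O]
  {X : Type*} [AddCommGroup X]

theorem hasValueAt_iff {f : RationalFunctions O X} {t : Torus O X} {c : ℂ} :
    HasValueAt f t c ↔ ∃ a b : coordinateRing O X, evalAt t b ≠ 0 ∧
      f * algebraMap _ (RationalFunctions O X) b = algebraMap _ (RationalFunctions O X) a ∧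
      c = evalAt t a / evalAt t b := Iff.rfl

theorem hasValueAt_algebraMap (a : coordinateRing O X) (t : Torus O X) :
    HasValueAt (algebraMap _ (RationalFunctions O X) a) t (evalAt t a) :=
  hasValueAt_iff.2 ⟨a, 1, by simp, by simp, by simp⟩

theorem HasValueAt.add {f g : RationalFunctions O X} {t : Torus O X} {c d : ℂ}
    (hf : HasValueAt f t c) (hg : HasValueAt g t d) : HasValueAt (f + g) t (c + d) := by
  obtain ⟨a, b, hb, h, rfl⟩ := hasValueAt_iff.1 hf
  obtain ⟨a', b', hb', h', rfl⟩ := hasValueAt_iff.1 hg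
  refine hasValueAt_iff.2 ⟨a * b' + a' * b, b * b', by simp [hb, hb'], ?_, ?_⟩
  · simp only [map_mul, map_add]
    linear_combination (algebraMap _ (RationalFunctions O X) b') * h +
      (algebraMap _ (RationalFunctions O X) b) * h'
  · simp only [map_mul, map_add]
    field_simp

theorem HasValueAt.mul {f g : RationalFunctions O X} {t : Torus O X} {c d : ℂ}
    (hf : HasValueAt f t c) (hg : HasValueAt g t d) : HasValueAt (f * g) t (c * d) := by
  obtain ⟨a, b, hb, h, rfl⟩ := hasValueAt_iff.1 hf
  obtain ⟨a', b', hb', h', rfl⟩ := hasValueAt_iff.1 hg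
  refine hasValueAt_iff.2 ⟨a * a', b * b', by simp [hb, hb'], ?_, ?_⟩
  · simp only [map_mul]
    rw [← h, ← h']
    ring
  · simp only [map_mul]
    field_simp

theorem hasValueAt_zero (t : Torus O X) : HasValueAt (0 : RationalFunctions O X) t 0 := by
  simpa using hasValueAt_algebraMap (O := O) (X := X) 0 t

theorem hasValueAt_one (t : Torus O X) : HasValueAt (1 : RationalFunctions O X) t 1 := by
  simpa using hasValueAt_algebraMap (O := O) (X := X) 1 t

theorem HasValueAt.neg {f : RationalFunctions O X} {t : Torus O X} {c : ℂ}
    (hf : HasValueAt f t c) : HasValueAt (-f) t (-c) := by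
  simpa using (hasValueAt_algebraMap (O := O) (X := X) (-1) t).mul hf

theorem HasValueAt.sub {f g : RationalFunctions O X} {t : Torus O X} {c d : ℂ}
    (hf : HasValueAt f t c) (hg : HasValueAt g t d) : HasValueAt (f - g) t (c - d) := by
  simpa [sub_eq_add_neg] using hf.add hg.neg

theorem HasValueAt.sum {ι : Type*} {s : Finset ι} {f : ι → RationalFunctions O X} {t : Torus O X}
    {c : ι → ℂ} (h : ∀ i ∈ s, HasValueAt (f i) t (c i)) :
    HasValueAt (∑ i ∈ s, f i) t (∑ i ∈ s, c i) := by
  classical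
  induction s using Finset.induction_on with
  | empty => simpa using hasValueAt_zero t
  | insert i s hi ih =>
    rw [Finset.sum_insert hi, Finset.sum_insert hi]
    exact (h i (Finset.mem_insert_self i s)).add
      (ih fun j hj => h j (Finset.mem_insert_of_mem hj))

theorem HasValueAt.smul {f : RationalFunctions O X} {w : X ≃ₗ[ℤ] X} {t : Torus O X} {c : ℂ}
    (hf : HasValueAt f (torusAct O X w⁻¹ t) c) : HasValueAt (w • f) t c := by
  obtain ⟨a, b, hb, h, rfl⟩ := hasValueAt_iff.1 hf
  refine hasValueAt_iff.2 ⟨w • a, w • b, hb, ?_, rfl⟩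
  rw [← smul_algebraMap_coordinateRing, ← smul_algebraMap_coordinateRing, ← smul_mul', h]

/-- The local ring at a point of `T`. -/
def regularAt (t : Torus O X) : Subring (RationalFunctions O X) where
  carrier := {f | IsRegularAt f t}
  mul_mem' := fun ⟨_, h⟩ ⟨_, h'⟩ => ⟨_, h.mul h'⟩
  one_mem' := ⟨_, hasValueAt_one t⟩
  add_mem' := fun ⟨_, h⟩ ⟨_, h'⟩ => ⟨_, h.add h'⟩
  zero_mem' := ⟨_, hasValueAt_zero t⟩
  neg_mem' := fun ⟨_, h⟩ => ⟨_, h.neg⟩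

theorem algebraMap_mem_regularAt (a : coordinateRing O X) (t : Torus O X) :
    algebraMap _ (RationalFunctions O X) a ∈ regularAt t := ⟨_, hasValueAt_algebraMap a t⟩

theorem smul_mem_regularAt {f : RationalFunctions O X} {w : X ≃ₗ[ℤ] X} {t : Torus O X}
    (hf : f ∈ regularAt (torusAct O X w⁻¹ t)) : w • f ∈ regularAt t := by
  obtain ⟨c, hc⟩ := hf
  exact ⟨c, hc.smul⟩

variable [IsDomain O] [Algebra.FiniteType ℂ O]

theorem HasValueAt.unique {f : RationalFunctions O X} {t : Torus O X} {c d : ℂ}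
    (hf : HasValueAt f t c) (hf' : HasValueAt f t d) : c = d := by
  obtain ⟨a, b, hb, h, rfl⟩ := hasValueAt_iff.1 hf
  obtain ⟨a', b', hb', h', rfl⟩ := hasValueAt_iff.1 hf'
  have : a * b' = a' * b := IsFractionRing.injective _ (RationalFunctions O X) (by
    rw [map_mul, map_mul, ← h, ← h']; ring)
  have := congrArg (evalAt t) this
  rw [map_mul, map_mul] at this
  rwa [div_eq_div_iff hb hb']

theorem HasValueAt.inv {f : RationalFunctions O X} {t : Torus O X} {c : ℂ}
    (hf : HasValueAt f t c) (hc : c ≠ 0) : HasValueAt f⁻¹ t c⁻¹ := by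
  obtain ⟨a, b, hb, h, rfl⟩ := hasValueAt_iff.1 hf
  have ha : evalAt t a ≠ 0 := fun h0 => hc (by rw [h0, zero_div])
  have ha0 : algebraMap _ (RationalFunctions O X) a ≠ 0 := fun h0 => ha (by
    rw [(IsFractionRing.injective _ (RationalFunctions O X)) (h0.trans (map_zero _).symm),
      map_zero])
  have hf0 : f ≠ 0 := fun h0 => ha0 (by rw [← h, h0, zero_mul])
  refine hasValueAt_iff.2 ⟨b, a, ha, ?_, by rw [inv_div]⟩
  rw [← h, inv_mul_cancel_left₀ hf0]

end Values

/-! ### Equations of the divisors and regularity in codimension one -/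

section Divisors

variable {O : Type*} [CommRing O] [HopfAlgebra ℂ O] [Coalgebra.IsCocomm ℂ O]
  [IsDomain O] [Algebra.FiniteType ℂ O]
  {X : Type*} [AddCommGroup X] [Module.Free ℤ X] [Module.Finite ℤ X]

/-- Points of `T` at which all elements of an ideal vanish. -/
def zeroLocus (P : Ideal (coordinateRing O X)) : Set (Torus O X) := {t | ∀ b ∈ P, evalAt t b = 0}

theorem exists_mem_zeroLocus {P : Ideal (coordinateRing O X)} [P.IsPrime] {f : coordinateRing O X}
    (hf : f ∉ P) : ∃ t ∈ zeroLocus P, evalAt t f ≠ 0 := exists_evalAt_ne_zero P hf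

theorem mem_of_zeroLocus {P : Ideal (coordinateRing O X)} [P.IsPrime] {f : coordinateRing O X}
    (hf : ∀ t ∈ zeroLocus P, evalAt t f = 0) : f ∈ P := by
  by_contra h
  obtain ⟨t, ht, h0⟩ := exists_mem_zeroLocus h
  exact h0 (hf t ht)

/-- The maximal ideal of a point. -/
def pointIdeal (t : Torus O X) : Ideal (coordinateRing O X) := RingHom.ker (evalAt t)

theorem mem_pointIdeal {t : Torus O X} {f : coordinateRing O X} :
    f ∈ pointIdeal t ↔ evalAt t f = 0 := Iff.rfl

instance (t : Torus O X) : (pointIdeal t).IsPrime := RingHom.ker_isPrime _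

/-- The equation of the divisor `T_{α,x}` given by the local parameter `u` at `1`. -/
def equation (u : O) (α : X) (x : Points O) : coordinateRing O X :=
  pullback α (x⁻¹.translate u)

theorem equation_one (u : O) (α : X) : equation u α (1 : Points O) = pullback α u := by
  rw [equation, inv_one, Points.translate_one]

theorem evalAt_equation (t : Torus O X) (u : O) (α : X) (x : Points O) :
    evalAt t (equation u α x) = (x⁻¹ * charVal α t).eval u := by
  rw [equation, evalAt_pullback, Points.eval_translate]

variable {u : O} (hu : IsLocalParameter u) {δ : O →ₗ[ℂ] ℂ} (hδ : IsPointDerivation δ)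
  (hδu : δ u ≠ 0)

include hu in
theorem IsLocalParameter.eval_one : (1 : Points O).eval u = 0 := hu.1

include hu in
theorem evalAt_equation_eq_zero {t : Torus O X} {α : X} {x : Points O} (ht : charVal α t = x) :
    evalAt t (equation u α x) = 0 := by
  rw [evalAt_equation, ht, inv_mul_cancel, hu.eval_one]

theorem exists_eval_ne_zero_of_ne_one {c : Points O} (hc : c ≠ 1) :
    ∃ v : O, (1 : Points O).eval v = 0 ∧ c.eval v ≠ 0 := by
  by_contra! h
  refine hc (Points.ext_eval fun v => ?_)
  have := h (v - algebraMap ℂ O ((1 : Points O).eval v)) (by simp)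
  simpa [sub_eq_zero] using this

include hu in
/-- A prime that contains an equation of `T_{α,x}` and passes through a point of `T_{α,x}` has its
zero locus in `T_{α,x}`. -/
theorem zeroLocus_subset_divisor (hdim : Algebra.trdeg ℂ O = 1) {P : Ideal (coordinateRing O X)}
    [P.IsPrime] {t : Torus O X} (hPt : P ≤ pointIdeal t) {α : X} {x : Points O}
    (ht : charVal α t = x) (hP : equation u α x ∈ P) : ∀ t' ∈ zeroLocus P, charVal α t' = x := by
  intro t' ht'
  -- The parameter `u` may have zeros besides the identity. As `P` passes through `t`, the equation
  -- of `e` is not in `P`, and `e * v ∈ (u)` puts in `P` the equation of every `v` vanishing at the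
  -- identity.
  obtain ⟨e, he, heu⟩ := hu.exists_mul_mem hdim
  have heP : equation e α x ∉ P := fun h => by
    have := hPt h
    rw [mem_pointIdeal, evalAt_equation, ht, inv_mul_cancel, he] at this
    exact one_ne_zero this
  by_contra hne
  have hc : x⁻¹ * charVal α t' ≠ 1 := fun h => hne (inv_mul_eq_one.1 h).symm
  obtain ⟨v, hv1, hv⟩ := exists_eval_ne_zero_of_ne_one hc
  obtain ⟨y, hy⟩ := heu v hv1
  have h : equation e α x * equation v α x = equation u α x * equation y α x := by
    simp only [equation, ← pullback_mul, ← map_mul, hy]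
  have hvP : equation v α x ∈ P := by
    refine (‹P.IsPrime›.mem_or_mem ?_).resolve_left heP
    rw [h]
    exact P.mul_mem_right _ hP
  exact hv (by rw [← evalAt_equation]; exact ht' _ hvP)

-- The divisor is smooth: every `ν` with `ν α ≠ 0` gives a direction transversal to it, in which its
-- equation has nonzero derivative when `δ u ≠ 0`.
include hδ in
theorem evalAt_derivation_equation {ν : Module.Dual ℤ X}
    {E : Derivation ℂ (coordinateRing O X) (coordinateRing O X)}
    (hE : ∀ t x v, evalAt t (E (pullback x v)) = (ν x : ℂ) * δ ((charVal x t).translate v))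
    {t : Torus O X} {α : X} {x : Points O} (ht : charVal α t = x) :
    evalAt t (E (equation u α x)) = ν α * δ u := by
  rw [equation, hE, Points.translate_translate, ht, mul_inv_cancel, Points.translate_one]

include hδ hδu hu in
theorem equation_ne_zero {α : X} {x : Points O} (hα : ∃ ν : Module.Dual ℤ X, ν α ≠ 0)
    {t : Torus O X} (ht : charVal α t = x) : equation u α x ≠ 0 := fun h => by
  obtain ⟨ν, hν⟩ := hα
  obtain ⟨E, hE⟩ := exists_derivation (X := X) hδ ν
  have := evalAt_derivation_equation (u := u) hδ hE ht
  rw [h, map_zero, map_zero] at this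
  exact mul_ne_zero (Int.cast_ne_zero.2 hν) hδu this.symm

include hδ hδu hu in
/-- If the maximal ideal of the local ring at `P` is principal and `P` defines a subset of
`T_{α,x}`, then it is generated by the equation of `T_{α,x}`. -/
theorem exists_mul_eq_equation {P : Ideal (coordinateRing O X)} [P.IsPrime]
    (hp : ∃ p ∈ P, ∀ x ∈ P, ∃ s, s ∉ P ∧ ∃ y, s * x = y * p) {α : X} {x : Points O}
    (hα : ∃ ν : Module.Dual ℤ X, ν α ≠ 0) (hP : ∀ t ∈ zeroLocus P, charVal α t = x)
    {z : coordinateRing O X} (hz : z ∈ P) :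
    ∃ s, s ∉ P ∧ ∃ y, s * z = y * equation u α x := by
  obtain ⟨p, hpP, hp⟩ := hp
  obtain ⟨ν, hν⟩ := hα
  obtain ⟨E, hE⟩ := exists_derivation (X := X) hδ ν
  have hπ : equation u α x ∈ P := mem_of_zeroLocus fun t ht => evalAt_equation_eq_zero hu (hP t ht)
  obtain ⟨s, hs, a, ha⟩ := hp _ hπ
  -- Derive `s * π = a * p`, where `π` is the equation. At a zero of `P` the right side gives `0` if
  -- `a ∈ P`, while the left side gives `s` times the nonzero number `ν α * δ u`.
  have haP : a ∉ P := fun haP => by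
    obtain ⟨t, ht, hst⟩ := exists_mem_zeroLocus hs
    have h := congrArg (fun f => evalAt t (E f)) ha
    simp only [Derivation.leibniz, smul_eq_mul, map_add, map_mul] at h
    rw [ht _ hπ, ht _ haP, ht _ hpP, evalAt_derivation_equation (u := u) hδ hE (hP t ht), zero_mul,
      zero_mul, zero_mul, add_zero, add_zero] at h
    exact mul_ne_zero hst (mul_ne_zero (Int.cast_ne_zero.2 hν) hδu) h
  obtain ⟨s', hs', b, hb⟩ := hp z hz
  refine ⟨a * s', fun h => (‹P.IsPrime›.mem_or_mem h).elim haP hs', b * s, ?_⟩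
  linear_combination a * hb - b * ha

-- Otherwise the equation of `T_{β,y}` would be locally a multiple of that of `T_{α,x}`. Deriving in
-- a direction `ν` with `ν α = 0` and `ν β ≠ 0` is then a contradiction at a zero of `P`.
include hδ hδu hu in
theorem not_zeroLocus_subset {P : Ideal (coordinateRing O X)} [P.IsPrime]
    (hp : ∃ p ∈ P, ∀ x ∈ P, ∃ s, s ∉ P ∧ ∃ y, s * x = y * p) {α β : X} {x y : Points O}
    (hα : ∃ ν : Module.Dual ℤ X, ν α ≠ 0) (hαβ : ∃ ν : Module.Dual ℤ X, ν α = 0 ∧ ν β ≠ 0)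
    (hPα : ∀ t ∈ zeroLocus P, charVal α t = x) :
    ∃ t ∈ zeroLocus P, charVal β t ≠ y := by
  by_contra! hPβ
  obtain ⟨ν, hνα, hνβ⟩ := hαβ
  obtain ⟨E, hE⟩ := exists_derivation (X := X) hδ ν
  have hπ : equation u α x ∈ P := mem_of_zeroLocus fun t ht => evalAt_equation_eq_zero hu (hPα t ht)
  have hπ' : equation u β y ∈ P := mem_of_zeroLocus fun t ht => evalAt_equation_eq_zero hu (hPβ t ht)
  obtain ⟨s, hs, b, hb⟩ := exists_mul_eq_equation hu hδ hδu hp hα hPα hπ'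
  obtain ⟨t, ht, hst⟩ := exists_mem_zeroLocus hs
  have h := congrArg (fun f => evalAt t (E f)) hb
  simp only [Derivation.leibniz, smul_eq_mul, map_add, map_mul] at h
  rw [ht _ hπ, ht _ hπ', evalAt_derivation_equation (u := u) hδ hE (hPα t ht),
    evalAt_derivation_equation (u := u) hδ hE (hPβ t ht), hνα] at h
  simp only [Int.cast_zero, zero_mul, mul_zero, add_zero] at h
  exact mul_ne_zero hst (mul_ne_zero (Int.cast_ne_zero.2 hνβ) hδu) h

theorem mem_of_forall_mul_eq {f : RationalFunctions O X} {t : Torus O X} (hf : f ∉ regularAt t)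
    (a b : coordinateRing O X) (h : algebraMap _ (RationalFunctions O X) b * f =
      algebraMap _ (RationalFunctions O X) a) : b ∈ pointIdeal t := by
  by_contra hb
  exact hf ⟨_, hasValueAt_iff.2 ⟨a, b, hb, by rw [mul_comm, h], rfl⟩⟩

include hδ hδu hu in
/-- A function that is regular at a point `t` of `T_{α,1}` and vanishes on `T_{α,1}` near `t` is
divisible by the equation of `T_{α,1}`. -/
theorem div_equation_mem_regularAt (hdim : Algebra.trdeg ℂ O = 1) {α : X}
    (hα : ∃ ν : Module.Dual ℤ X, ν α ≠ 0) {t : Torus O X} (ht : charVal α t = 1)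
    {g : RationalFunctions O X} (hg : g ∈ regularAt t) {h : coordinateRing O X}
    (hh : evalAt t h ≠ 0)
    (hvan : ∀ t', charVal α t' = 1 → evalAt t' h ≠ 0 → ∀ c, HasValueAt g t' c → c = 0) :
    g / algebraMap _ (RationalFunctions O X) (pullback α u) ∈ regularAt t := by
  have hinj := IsFractionRing.injective (coordinateRing O X) (RationalFunctions O X)
  rw [← equation_one]
  set π := equation u α (1 : Points O) with hπdef
  have hπ0 : algebraMap _ (RationalFunctions O X) π ≠ 0 :=
    (map_ne_zero_iff _ hinj).2 (equation_ne_zero hu hδ hδu hα ht)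
  by_contra hreg
  -- Suppose the quotient is not regular and let `P` contain all its denominators. A denominator of
  -- `g` times `π` is one of them, so `π ∈ P`. The numerator `a` of `g` vanishes on the zeros of
  -- `P`, so it is locally a multiple of `π`, which gives a denominator outside `P`.
  obtain ⟨P, hP, hPt, hPf, hp⟩ := exists_prime_principal
    (g / algebraMap _ (RationalFunctions O X) π) (pointIdeal t) (mem_of_forall_mul_eq hreg)
  obtain ⟨-, a, c, hc, hac, -⟩ := hg
  have hc' : c ∉ P := fun h => hc (hPt h)
  have hh' : h ∉ P := fun h => hh (hPt h)
  have hπP : π ∈ P := by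
    refine (hP.mem_or_mem (hPf a (c * π) ?_)).resolve_left hc'
    rw [map_mul, ← hac]
    field_simp
  have hPα := zeroLocus_subset_divisor hu hdim hPt ht hπP
  have haP : a ∈ P := by
    have : a * (h * c) ∈ P := mem_of_zeroLocus fun t' ht' => by
      rw [map_mul, map_mul]
      by_cases hht : evalAt t' h = 0
      · rw [hht, zero_mul, mul_zero]
      by_cases hct : evalAt t' c = 0
      · rw [hct, mul_zero, mul_zero]
      have := hvan t' (hPα t' ht') hht _ (hasValueAt_iff.2 ⟨a, c, hct, hac, rfl⟩)
      rw [(div_eq_zero_iff.1 this).resolve_right hct, zero_mul]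
    exact (hP.mem_or_mem this).resolve_right fun h => (hP.mem_or_mem h).elim hh' hc'
  obtain ⟨s, hs, y, hy⟩ := exists_mul_eq_equation hu hδ hδu hp hα hPα haP
  refine (hP.mem_or_mem (hPf y (s * c) ?_)).elim hs hc'
  have hy' := congrArg (algebraMap _ (RationalFunctions O X)) hy
  rw [map_mul, map_mul, ← hac, ← hπdef] at hy'
  rw [map_mul, ← mul_div_assoc, div_eq_iff hπ0, ← hy']
  ring

include hδ hδu hu in
/-- `T_{α,x}` has no component in a divisor `T_{β,1}` with `α`, `β` independent. -/
theorem exists_generic_point (hdim : Algebra.trdeg ℂ O = 1) {α : X} {x : Points O}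
    (hα : ∃ ν : Module.Dual ℤ X, ν α ≠ 0) {t : Torus O X} (ht : charVal α t = x)
    {h : coordinateRing O X} (hh : evalAt t h ≠ 0) (S : Finset X)
    (hS : ∀ β ∈ S, ∃ ν : Module.Dual ℤ X, ν α = 0 ∧ ν β ≠ 0) :
    ∃ t', charVal α t' = x ∧ evalAt t' h ≠ 0 ∧ ∀ β ∈ S, charVal β t' ≠ 1 := by
  have hinj := IsFractionRing.injective (coordinateRing O X) (RationalFunctions O X)
  set π := equation u α x with hπdef
  have hπ0 : algebraMap _ (RationalFunctions O X) π ≠ 0 :=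
    (map_ne_zero_iff _ hinj).2 (equation_ne_zero hu hδ hδu hα ht)
  -- Applied to `π⁻¹`, which is not regular at `t`; the prime contains `π` because `π * π⁻¹ = 1`, so
  -- it is a component of `T_{α,x}` through `t`.
  obtain ⟨P, hP, hPt, hPf, hp⟩ := exists_prime_principal
    (algebraMap _ (RationalFunctions O X) π)⁻¹ (pointIdeal t) fun a b hab => by
      rw [mul_inv_eq_iff_eq_mul₀ hπ0, ← map_mul] at hab
      rw [mem_pointIdeal, hinj hab, map_mul, evalAt_equation_eq_zero hu ht, mul_zero]
  have hπP : π ∈ P := hPf 1 π (by rw [mul_inv_cancel₀ hπ0, map_one])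
  have hPα := zeroLocus_subset_divisor hu hdim hPt ht hπP
  have hv : ∀ β ∈ S, ∃ v : O, (1 : Points O).eval v = 0 ∧ pullback β v ∉ P := fun β hβ => by
    obtain ⟨t', ht', hne⟩ := not_zeroLocus_subset (y := 1) hu hδ hδu hp hα (hS β hβ) hPα
    obtain ⟨v, hv1, hv⟩ := exists_eval_ne_zero_of_ne_one hne
    exact ⟨v, hv1, fun h => hv (ht' _ h)⟩
  choose! v hv1 hv using hv
  have hprod : h * ∏ β ∈ S, pullback β (v β) ∉ P := fun hmem => by
    rcases hP.mem_or_mem hmem with h | h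
    · exact hh (hPt h)
    · obtain ⟨β, hβ, hβP⟩ := (Ideal.IsPrime.prod_mem_iff (p := P)).1 h
      exact hv β hβ hβP
  obtain ⟨t', ht', hne⟩ := exists_mem_zeroLocus hprod
  rw [map_mul, map_prod] at hne
  refine ⟨t', hPα t' ht', left_ne_zero_of_mul hne, fun β hβ hβ1 => ?_⟩
  refine Finset.prod_ne_zero_iff.1 (right_ne_zero_of_mul hne) β hβ ?_
  rw [evalAt_pullback, hβ1, hv1 β hβ]

include hδ hδu hu in
/-- Functions that are regular outside a subset of codimension two are regular. -/
theorem exists_algebraMap_eq_of_regularAt (S : Finset (X × X))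
    (hS : ∀ p ∈ S, (∃ ν : Module.Dual ℤ X, ν p.1 ≠ 0) ∧
      ∃ ν : Module.Dual ℤ X, ν p.1 = 0 ∧ ν p.2 ≠ 0) {f : RationalFunctions O X}
    (hf : ∀ t, (∀ p ∈ S, charVal p.1 t = 1 → charVal p.2 t ≠ 1) → f ∈ regularAt t) :
    ∃ a, algebraMap (coordinateRing O X) (RationalFunctions O X) a = f := by
  by_contra! hno
  let C : Ideal (coordinateRing O X) :=
    { carrier := {b | ∃ a : coordinateRing O X, algebraMap _ (RationalFunctions O X) b * f =
        algebraMap _ (RationalFunctions O X) a}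
      zero_mem' := ⟨0, by simp⟩
      add_mem' := by
        rintro b b' ⟨a, ha⟩ ⟨a', ha'⟩
        exact ⟨a + a', by rw [map_add, map_add, add_mul, ha, ha']⟩
      smul_mem' := by
        rintro c b ⟨a, ha⟩
        exact ⟨c * a, by rw [smul_eq_mul, map_mul, map_mul, mul_assoc, ha]⟩ }
  have hC : C ≠ ⊤ := (Ideal.ne_top_iff_one C).2 fun ⟨a, ha⟩ => hno a (by
    rw [← ha, map_one, one_mul])
  obtain ⟨M, hM, hCM⟩ := Ideal.exists_le_maximal C hC
  have := hM.isPrime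
  obtain ⟨P, hP, -, hPf, hp⟩ := exists_prime_principal f M fun a b h => hCM ⟨a, h⟩
  -- `P` is not contained in the intersection of two independent divisors, so some function outside
  -- `P` vanishes on that intersection. A zero of `P` at which all these functions are nonzero is a
  -- point where `f` is regular, giving a denominator outside `P`.
  have hq : ∀ p ∈ S, ∃ q : coordinateRing O X, q ∉ P ∧
      ∀ t, charVal p.1 t = 1 → charVal p.2 t = 1 → evalAt t q = 0 := by
    rintro ⟨α, β⟩ hαβ
    obtain ⟨h1, h2⟩ := hS _ hαβ
    by_cases hPα : ∀ t ∈ zeroLocus P, charVal α t = 1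
    · obtain ⟨t, ht, hne⟩ := not_zeroLocus_subset (y := 1) hu hδ hδu hp h1 h2 hPα
      obtain ⟨v, hv1, hv⟩ := exists_eval_ne_zero_of_ne_one hne
      exact ⟨pullback β v, fun h => hv (ht _ h), fun t _ h => by rw [evalAt_pullback, h, hv1]⟩
    · push Not at hPα
      obtain ⟨t, ht, hne⟩ := hPα
      obtain ⟨v, hv1, hv⟩ := exists_eval_ne_zero_of_ne_one hne
      exact ⟨pullback α v, fun h => hv (ht _ h), fun t h _ => by rw [evalAt_pullback, h, hv1]⟩
  choose! q hqP hq using hq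
  have hprod : ∏ p ∈ S, q p ∉ P := fun h => by
    obtain ⟨p, hp, hpP⟩ := (Ideal.IsPrime.prod_mem_iff (p := P)).1 h
    exact hqP p hp hpP
  obtain ⟨t, ht, hne⟩ := exists_mem_zeroLocus hprod
  rw [map_prod] at hne
  obtain ⟨c, a, b, hb, hab, -⟩ := hf t fun p hp h1 h2 =>
    Finset.prod_ne_zero_iff.1 hne p hp (hq p hp t h1 h2)
  exact hb (ht b (hPf a b (by rw [mul_comm, hab])))

end Divisors

/-! ### Real roots and Weyl groups of finite type -/

section Roots

variable {n : ℕ} {A : Matrix (Fin n) (Fin n) ℤ} {X : Type*} [AddCommGroup X]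

/-- Modulo two the off-diagonal terms cancel under transposition. -/
theorem even_sum_of_symm {ι : Type*} [Fintype ι] (T : ι → ι → ℤ) (hsymm : ∀ i j, T i j = T j i)
    (hdiag : ∀ i, Even (T i i)) : Even (∑ i, ∑ j, T i j) := by
  classical
  rw [← ZMod.intCast_eq_zero_iff_even, ← Finset.sum_product', Int.cast_sum]
  refine Finset.sum_involution (fun p _ => (p.2, p.1)) ?_ ?_ ?_ ?_
  · rintro ⟨i, j⟩ -
    simp only [hsymm j i]
    rw [← two_mul, show (2 : ZMod 2) = 0 from rfl, zero_mul]
  · rintro ⟨i, j⟩ - h heq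
    obtain rfl : j = i := congrArg Prod.fst heq
    exact h (ZMod.intCast_eq_zero_iff_even.2 (hdiag _))
  · simp
  · simp

/-- The quadratic form on the root lattice given by a symmetrizer. -/
def rootForm (A : Matrix (Fin n) (Fin n) ℤ) (d : Fin n → ℝ) (c : Fin n → ℤ) : ℝ :=
  ∑ j, ∑ k, c j * (d j * A j k) * c k

theorem rootForm_eq (d : Fin n → ℝ) (c : Fin n → ℤ) : rootForm A d c =
    (fun j => (c j : ℝ)) ⬝ᵥ ((Matrix.diagonal d * A.map (fun a : ℤ => (a : ℝ))).mulVec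
      fun j => (c j : ℝ)) := by
  simp only [rootForm, dotProduct, Matrix.mulVec, Matrix.diagonal_mul, Matrix.map_apply,
    Finset.mul_sum, mul_assoc]

/-- A symmetrizer of a Cartan matrix of finite type. -/
structure IsSymmetrizer (A : Matrix (Fin n) (Fin n) ℤ) (d : Fin n → ℝ) : Prop where
  pos : ∀ i, 0 < d i
  posDef : (Matrix.diagonal d * A.map (fun a : ℤ => (a : ℝ))).PosDef

namespace IsSymmetrizer

variable {d : Fin n → ℝ} (hd : IsSymmetrizer A d)
include hd

theorem symm (j k : Fin n) : d j * A j k = d k * A k j := by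
  have h := congrFun (congrFun hd.posDef.isHermitian k) j
  simpa [Matrix.conjTranspose_apply, Matrix.diagonal_mul] using h

theorem rootForm_pos {c : Fin n → ℤ} (hc : c ≠ 0) : 0 < rootForm A d c := by
  rw [rootForm_eq]
  have : (fun j => (c j : ℝ)) ≠ 0 := fun h => hc (funext fun j => by
    simpa using congrFun h j)
  simpa using hd.posDef.dotProduct_mulVec_pos this

theorem det_ne_zero : A.det ≠ 0 := by
  have h := hd.posDef.det_pos.ne'
  rw [Matrix.det_mul] at h
  intro h0
  refine right_ne_zero_of_mul h ?_
  have := RingHom.map_det (Int.castRingHom ℝ) A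
  rw [h0, map_zero] at this
  exact this.symm

/-- A positive definite form is bounded below by its minimum on the unit sphere times the squared
norm, so these integral vectors lie in a bounded box. -/
theorem finite_rootForm_le (C : ℝ) : {c : Fin n → ℤ | rootForm A d c ≤ C}.Finite := by
  rcases isEmpty_or_nonempty (Fin n) with hn | hn
  · exact Set.toFinite _
  let N : (Fin n → ℝ) → ℝ := fun x =>
    x ⬝ᵥ ((Matrix.diagonal d * A.map (fun a : ℤ => (a : ℝ))).mulVec x)
  have hN : Continuous N := by
    simp only [N, dotProduct, Matrix.mulVec]
    fun_prop
  have hne : (Metric.sphere (0 : Fin n → ℝ) 1).Nonempty := NormedSpace.sphere_nonempty.2 zero_le_one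
  obtain ⟨x₀, hx₀, hmin⟩ := (isCompact_sphere (0 : Fin n → ℝ) 1).exists_isMinOn hne hN.continuousOn
  have hx₀0 : x₀ ≠ 0 := fun h => by simp [h] at hx₀
  have hpos : 0 < N x₀ := by simpa using hd.posDef.dotProduct_mulVec_pos hx₀0
  have hbound : ∀ x, N x₀ * ‖x‖ ^ 2 ≤ N x := fun x => by
    rcases eq_or_ne x 0 with rfl | hx
    · simp [N]
    have hx' : ‖x‖ ≠ 0 := norm_ne_zero_iff.2 hx
    have h := hmin (show ‖x‖⁻¹ • x ∈ Metric.sphere (0 : Fin n → ℝ) 1 by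
      simp [norm_smul, hx'])
    have h2 : N (‖x‖⁻¹ • x) = (‖x‖ ^ 2)⁻¹ * N x := by
      simp only [N, Matrix.mulVec_smul, dotProduct_smul, smul_dotProduct, smul_eq_mul]
      rw [← mul_assoc, ← mul_inv, pow_two]
    have h3 : N x₀ ≤ (‖x‖ ^ 2)⁻¹ * N x := h2 ▸ h
    rwa [inv_mul_eq_div, le_div_iff₀ (by positivity)] at h3
  let b : ℤ := ⌈Real.sqrt (C / N x₀)⌉
  refine (Set.Finite.pi (fun _ : Fin n => Set.finite_Icc (-b) b)).subset fun c hc j _ => ?_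
  have h1 : N (fun j => (c j : ℝ)) ≤ C := by
    have := rootForm_eq (A := A) d c
    exact this.symm.le.trans hc
  have h2 : ‖(fun j => (c j : ℝ))‖ ≤ Real.sqrt (C / N x₀) := by
    apply Real.le_sqrt_of_sq_le
    rw [le_div_iff₀ hpos, mul_comm]
    exact (hbound _).trans h1
  have h3 : |(c j : ℝ)| ≤ b := ((norm_le_pi_norm (fun j => (c j : ℝ)) j).trans h2).trans
    (Int.le_ceil _)
  have h4 : |c j| ≤ b := by exact_mod_cast h3
  exact abs_le.1 h4

end IsSymmetrizer

namespace Realization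

variable (D : Realization A X)

/-- Real roots. -/
def IsRealRoot (α : X) : Prop := ∃ (v : D.weyl) (i : Fin n), α = v.1 (D.root i)

theorem simpleReflection_apply (i : Fin n) (x : X) :
    D.simpleReflection i x = x - D.coroot i x • D.root i := Module.reflection_apply _ _

theorem simpleReflection_involutive (i : Fin n) (x : X) :
    D.simpleReflection i (D.simpleReflection i x) = x := Module.involutive_reflection _ x

theorem s_mul_s (i : Fin n) : D.s i * D.s i = 1 :=
  Subtype.ext (LinearEquiv.ext fun x => D.simpleReflection_involutive i x)

theorem s_root (i : Fin n) : (D.s i).1 (D.root i) = -D.root i := by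
  change D.simpleReflection i _ = _
  rw [simpleReflection_apply, D.pairing, D.cartan.diag, two_smul]
  abel

variable {D}

theorem IsPosRealRoot.isRealRoot {α : X} (h : D.IsPosRealRoot α) : D.IsRealRoot α := h.1

theorem IsRealRoot.smul {α : X} (h : D.IsRealRoot α) (w : D.weyl) : D.IsRealRoot (w.1 α) := by
  obtain ⟨v, i, rfl⟩ := h
  exact ⟨w * v, i, rfl⟩

theorem IsRealRoot.neg {α : X} (h : D.IsRealRoot α) : D.IsRealRoot (-α) := by
  obtain ⟨v, i, rfl⟩ := h
  refine ⟨v * D.s i, i, ?_⟩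
  rw [← map_neg, ← s_root]
  rfl

theorem IsRealRoot.exists_reflection {α : X} (h : D.IsRealRoot α) :
    ∃ σ, D.IsReflectionOf σ α := by
  obtain ⟨v, i, rfl⟩ := h
  exact ⟨_, v, i, rfl, rfl⟩

theorem IsReflectionOf.conj {α : X} {σ : D.weyl} (h : D.IsReflectionOf σ α) (w : D.weyl) :
    D.IsReflectionOf (w * σ * w⁻¹) (w.1 α) := by
  obtain ⟨v, i, rfl, rfl⟩ := h
  exact ⟨w * v, i, rfl, by group⟩

theorem IsReflectionOf.neg {α : X} {σ : D.weyl} (h : D.IsReflectionOf σ α) :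
    D.IsReflectionOf σ (-α) := by
  obtain ⟨v, i, rfl, rfl⟩ := h
  refine ⟨v * D.s i, i, ?_, ?_⟩
  · rw [← map_neg, ← s_root]
    rfl
  · rw [mul_inv_rev, inv_eq_of_mul_eq_one_left (D.s_mul_s i), ← mul_assoc,
      mul_assoc v (D.s i) (D.s i), s_mul_s, mul_one]

theorem IsReflectionOf.mul_self {α : X} {σ : D.weyl} (h : D.IsReflectionOf σ α) : σ * σ = 1 := by
  obtain ⟨v, i, rfl, rfl⟩ := h
  rw [show v * D.s i * v⁻¹ * (v * D.s i * v⁻¹) = v * (D.s i * D.s i) * v⁻¹ by group, s_mul_s]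
  group

theorem IsReflectionOf.inv_eq {α : X} {σ : D.weyl} (h : D.IsReflectionOf σ α) : σ⁻¹ = σ :=
  inv_eq_of_mul_eq_one_left h.mul_self

theorem IsReflectionOf.exists_apply {α : X} {σ : D.weyl} (h : D.IsReflectionOf σ α) :
    ∃ ν : Module.Dual ℤ X, ν α = 2 ∧ ∀ x, σ.1 x = x - ν x • α := by
  obtain ⟨v, i, rfl, rfl⟩ := h
  have hv : ∀ x, (v⁻¹ : D.weyl).1 (v.1 x) = x := fun x => v.1.symm_apply_apply x
  have hv' : ∀ x, v.1 ((v⁻¹ : D.weyl).1 x) = x := fun x => v.1.apply_symm_apply x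
  refine ⟨D.coroot i ∘ₗ (v⁻¹ : D.weyl).1.toLinearMap, ?_, fun x => ?_⟩
  · change D.coroot i ((v⁻¹ : D.weyl).1 (v.1 (D.root i))) = 2
    rw [hv, D.pairing, D.cartan.diag]
  · change v.1 (D.simpleReflection i ((v⁻¹ : D.weyl).1 x)) =
      x - (D.coroot i ((v⁻¹ : D.weyl).1 x)) • _
    rw [simpleReflection_apply, map_sub, map_smul, hv']

theorem IsReflectionOf.apply_self {α : X} {σ : D.weyl} (h : D.IsReflectionOf σ α) :
    σ.1 α = -α := by
  obtain ⟨ν, h2, hν⟩ := h.exists_apply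
  rw [hν, h2, two_smul]
  abel

theorem IsRealRoot.exists_dual_ne_zero {α : X} (h : D.IsRealRoot α) :
    ∃ ν : Module.Dual ℤ X, ν α ≠ 0 := by
  obtain ⟨σ, hσ⟩ := h.exists_reflection
  obtain ⟨ν, h2, -⟩ := hσ.exists_apply
  exact ⟨ν, by rw [h2]; exact two_ne_zero⟩

theorem IsRealRoot.ne_zero {α : X} (h : D.IsRealRoot α) : α ≠ 0 := by
  rintro rfl
  obtain ⟨ν, h⟩ := h.exists_dual_ne_zero
  exact h (map_zero ν)

theorem IsPosRealRoot.not_neg {α : X} (h : D.IsPosRealRoot α) : ¬D.IsPosRealRoot (-α) := by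
  intro h'
  have key : ∀ x ∈ AddSubmonoid.closure (Set.range D.root), ∃ c : Fin n → ℕ,
      x = ∑ j, (c j : ℤ) • D.root j := fun x hx => by
    induction hx using AddSubmonoid.closure_induction with
    | mem x hx =>
      obtain ⟨i, rfl⟩ := hx
      exact ⟨Pi.single i 1, by simp [Pi.single_apply, ite_smul]⟩
    | zero => exact ⟨0, by simp⟩
    | add x y _ _ hx hy =>
      obtain ⟨c, rfl⟩ := hx
      obtain ⟨c', rfl⟩ := hy
      exact ⟨c + c', by simp [add_smul, Finset.sum_add_distrib]⟩
  obtain ⟨c, hc⟩ := key _ h.2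
  obtain ⟨c', hc'⟩ := key _ h'.2
  have h0 : ∑ j, ((c j : ℤ) + c' j) • D.root j = 0 := by
    simp only [add_smul, Finset.sum_add_distrib]
    rw [← hc, ← hc', add_neg_cancel]
  have := Fintype.linearIndependent_iff.1 D.root_indep _ h0
  refine h.isRealRoot.ne_zero ?_
  rw [hc]
  refine Finset.sum_eq_zero fun j _ => ?_
  have hj := this j
  rw [show (c j : ℤ) = 0 by omega, zero_smul]

variable (D) in
/-- Coordinates of a root in the orbit of the `i`-th simple root: integral coordinates of the root
and of the coroot, and the length of the root. -/
def HasRootCoords (d : Fin n → ℝ) (i : Fin n) (x : X) : Prop :=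
  ∃ c e : Fin n → ℤ, x = ∑ j, c j • D.root j ∧ (∀ j, d j * c j = d i * e j) ∧
    rootForm A d c = 2 * d i

/-- A reflection changes only the `k`-th coordinate, by `m` for the root and by `m'` for the coroot.
The symmetrizer gives `d k * m = d i * m'` and the invariance of the form. -/
theorem HasRootCoords.simpleReflection {d : Fin n → ℝ} (hd : IsSymmetrizer A d) {i : Fin n} {x : X}
    (h : D.HasRootCoords d i x) (k : Fin n) : D.HasRootCoords d i (D.simpleReflection k x) := by
  obtain ⟨c, e, rfl, hce, hc⟩ := h
  set m : ℤ := ∑ j, A k j * c j with hm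
  set m' : ℤ := ∑ j, A j k * e j with hm'
  have hmm : d k * m = d i * m' := by
    rw [hm, hm']
    push_cast
    rw [Finset.mul_sum, Finset.mul_sum]
    refine Finset.sum_congr rfl fun j _ => ?_
    linear_combination (c j : ℝ) * hd.symm k j + (A j k : ℝ) * hce j
  refine ⟨c - Pi.single k m, e - Pi.single k m', ?_, fun j => ?_, ?_⟩
  · rw [simpleReflection_apply, map_sum]
    simp only [map_smul, D.pairing, smul_eq_mul, Pi.sub_apply, sub_smul, Finset.sum_sub_distrib]
    simp [Pi.single_apply, ite_smul, hm, mul_comm]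
  · simp only [Pi.sub_apply, Int.cast_sub, mul_sub, hce]
    rcases eq_or_ne j k with rfl | hjk
    · simp [hmm]
    · simp [Pi.single_eq_of_ne hjk]
  · rw [← hc]
    have h1 : ∑ j, d k * A k j * c j = d k * m := by
      rw [hm]; push_cast; rw [Finset.mul_sum]
      exact Finset.sum_congr rfl fun j _ => by ring
    have h2 : ∑ j, (c j : ℝ) * (d j * A j k) = d k * m := by
      rw [← h1]
      exact Finset.sum_congr rfl fun j _ => by rw [hd.symm j k]; ring
    have h3 : (A k k : ℝ) = 2 := by rw [D.cartan.diag]; norm_num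
    have hs : ∀ j, ((Pi.single k m : Fin n → ℤ) j : ℝ) = if j = k then (m : ℝ) else 0 := fun j => by
      rw [Pi.single_apply]; split_ifs <;> simp
    simp only [rootForm, Pi.sub_apply, Int.cast_sub, hs, sub_mul, mul_sub, Finset.sum_sub_distrib,
      mul_ite, ite_mul, mul_zero, zero_mul, Finset.sum_ite_eq', Finset.mem_univ,
      if_true, Finset.sum_ite_irrel, Finset.sum_const_zero]
    rw [← Finset.sum_mul, h2]
    simp only [mul_assoc (m : ℝ), ← Finset.mul_sum]
    rw [h1, h3]
    ring

theorem hasRootCoords_smul_root {d : Fin n → ℝ} (hd : IsSymmetrizer A d) (v : D.weyl) (i : Fin n) :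
    D.HasRootCoords d i (v.1 (D.root i)) := by
  have key : ∀ v ∈ D.weyl, ∀ x, D.HasRootCoords d i x ↔ D.HasRootCoords d i (v x) := fun v hv => by
    induction hv using Subgroup.closure_induction with
    | mem v hv =>
      obtain ⟨k, rfl⟩ := hv
      refine fun x => ⟨fun h => h.simpleReflection hd k, fun h => ?_⟩
      have := h.simpleReflection hd k
      rwa [simpleReflection_involutive] at this
    | one => exact fun x => Iff.rfl
    | mul v w _ _ hv hw => exact fun x => (hw x).trans (hv (w x))
    | inv v _ hv =>
      intro x
      rw [hv (v⁻¹ x)]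
      exact (congrArg (D.HasRootCoords d i) (v.apply_symm_apply x)).to_iff.symm
  refine (key v.1 v.2 _).1 ⟨Pi.single i 1, Pi.single i 1, ?_, fun j => ?_, ?_⟩
  · simp [Pi.single_apply, ite_smul]
  · rcases eq_or_ne j i with rfl | hji
    · rfl
    · simp [Pi.single_eq_of_ne hji]
  · have hs : ∀ j, ((Pi.single i 1 : Fin n → ℤ) j : ℝ) = if j = i then (1 : ℝ) else 0 := fun j => by
      rw [Pi.single_apply]; split_ifs <;> simp
    simp [rootForm, hs, D.cartan.diag, mul_comm]

theorem IsRealRoot.finite {d : Fin n → ℝ} (hd : IsSymmetrizer A d) : {α | D.IsRealRoot α}.Finite := by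
  have h : ∀ i, ((fun c : Fin n → ℤ => ∑ j, c j • D.root j) ''
      {c | rootForm A d c ≤ 2 * d i}).Finite := fun i => (hd.finite_rootForm_le _).image _
  refine (Set.finite_iUnion h).subset ?_
  rintro _ ⟨v, i, rfl⟩
  obtain ⟨c, e, hx, -, hc⟩ := hasRootCoords_smul_root hd v i
  exact Set.mem_iUnion.2 ⟨i, c, hc.le, hx.symm⟩

/-- Real roots are positive or negative. -/
theorem IsRealRoot.pos_or_neg {d : Fin n → ℝ} (hd : IsSymmetrizer A d) {α : X}
    (h : D.IsRealRoot α) : D.IsPosRealRoot α ∨ D.IsPosRealRoot (-α) := by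
  have h' := h
  obtain ⟨v, i, rfl⟩ := h
  obtain ⟨c, e, hx, hce, hc⟩ := hasRootCoords_smul_root hd v i
  have hdi := hd.pos i
  have hmem : ∀ c : Fin n → ℤ, (∀ j, 0 ≤ c j) →
      ∑ j, c j • D.root j ∈ AddSubmonoid.closure (Set.range D.root) := fun c hc =>
    sum_mem fun j _ => by
      obtain ⟨k, hk⟩ := Int.eq_ofNat_of_zero_le (hc j)
      rw [hk, natCast_zsmul]
      exact AddSubmonoid.nsmul_mem _ (AddSubmonoid.subset_closure (Set.mem_range_self j)) k
  -- a nonzero vector that is integral for roots and coroots has at least the length of the root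
  have key : ∀ p e : Fin n → ℤ, (∀ j, d j * p j = d i * e j) → p ≠ 0 →
      2 * d i ≤ rootForm A d p := fun p e hpe hp => by
    have hT : Even (∑ j, ∑ k, e j * A j k * p k) := by
      refine even_sum_of_symm _ (fun j k => ?_) fun j => ?_
      · have : d i * (e j * A j k * p k) = d i * (e k * A k j * p j) := by
          linear_combination (-(A j k * p k : ℝ)) * hpe j + (A k j * p j : ℝ) * hpe k +
            (p j * p k : ℝ) * hd.symm j k
        exact_mod_cast mul_left_cancel₀ hdi.ne' this
      · rw [D.cartan.diag]
        exact ⟨e j * p j, by ring⟩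
    obtain ⟨K, hK⟩ := hT
    have hform : rootForm A d p = d i * (2 * K) := by
      have : ((∑ j, ∑ k, e j * A j k * p k : ℤ) : ℝ) = 2 * K := by rw [hK]; push_cast; ring
      rw [← this, rootForm]
      push_cast
      rw [Finset.mul_sum]
      refine Finset.sum_congr rfl fun j _ => ?_
      rw [Finset.mul_sum]
      exact Finset.sum_congr rfl fun k _ => by
        linear_combination (A j k * p k : ℝ) * hpe j
    have hpos := hd.rootForm_pos hp
    rw [hform] at hpos ⊢
    have hK0 : (0 : ℝ) < K := by
      by_contra! hK0
      nlinarith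
    have : (1 : ℝ) ≤ K := by
      have : 0 < K := by exact_mod_cast hK0
      exact_mod_cast this
    nlinarith
  by_cases hneg : ∀ j, c j ≤ 0
  · refine Or.inr ⟨h'.neg, ?_⟩
    rw [hx, ← Finset.sum_neg_distrib]
    simp only [← neg_smul]
    exact hmem (fun j => -c j) fun j => neg_nonneg.2 (hneg j)
  by_cases hpos : ∀ j, 0 ≤ c j
  · exact Or.inl ⟨h', hx ▸ hmem c hpos⟩
  exfalso
  push Not at hneg hpos
  obtain ⟨j₁, hj₁⟩ := hneg
  obtain ⟨j₂, hj₂⟩ := hpos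
  -- Let `c = p - m` be the splitting into positive and negative parts; `e` has the same signs as
  -- `c` and splits along with it. Off-diagonal entries of `A` are nonpositive, so the cross terms
  -- only increase the form: its value on `c` is at least `2 * d i + 2 * d i`, whereas it equals `2
  -- * d i`.
  let p : Fin n → ℤ := fun j => max (c j) 0
  let m : Fin n → ℤ := fun j => max (-c j) 0
  have hsign : ∀ j, (0 ≤ c j ↔ 0 ≤ e j) := fun j => by
    have hdj := hd.pos j
    have := hce j
    constructor <;> intro h
    · have h' : (0 : ℝ) ≤ c j := by exact_mod_cast h
      have : (0 : ℝ) ≤ e j := by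
        by_contra! h0
        nlinarith [mul_nonneg hdj.le h']
      exact_mod_cast this
    · have h' : (0 : ℝ) ≤ e j := by exact_mod_cast h
      have : (0 : ℝ) ≤ c j := by
        by_contra! h0
        nlinarith [mul_nonneg hdi.le h']
      exact_mod_cast this
  have hsign' : ∀ j, 0 ≤ c j → 0 ≤ e j := fun j => (hsign j).1
  have hp := key p (fun j => if 0 ≤ c j then e j else 0) (fun j => by
    by_cases h : 0 ≤ c j
    · simp [p, h, hce]
    · simp [p, h, (not_le.1 h).le]) fun h0 => by
      have := congrFun h0 j₁
      simp only [p, Pi.zero_apply] at this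
      omega
  have hm := key m (fun j => if 0 ≤ c j then 0 else -e j) (fun j => by
    by_cases h : 0 ≤ c j
    · simp [m, h]
    · have h1 : max (-c j) 0 = -c j := by omega
      simp only [m, h1, h, if_false]
      push_cast
      linear_combination -hce j) fun h0 => by
      have := congrFun h0 j₂
      simp only [m, Pi.zero_apply] at this
      omega
  have hcross : ∀ j k, (p j : ℝ) * (d j * A j k) * m k ≤ 0 := fun j k => by
    have hp0 : (0 : ℝ) ≤ p j := by exact_mod_cast le_max_right _ _
    have hm0 : (0 : ℝ) ≤ m k := by exact_mod_cast le_max_right _ _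
    rcases eq_or_ne j k with rfl | hjk
    · have : p j * m j = 0 := by
        rcases le_total 0 (c j) with h | h
        · rw [show m j = 0 from max_eq_right (by omega), mul_zero]
        · rw [show p j = 0 from max_eq_right h, zero_mul]
      have : (p j : ℝ) * m j = 0 := by exact_mod_cast this
      exact le_of_eq (by linear_combination (d j * A j j) * this)
    · have ha : (A j k : ℝ) ≤ 0 := by exact_mod_cast D.cartan.nonpos j k hjk
      exact mul_nonpos_of_nonpos_of_nonneg (mul_nonpos_of_nonneg_of_nonpos hp0
        (mul_nonpos_of_nonneg_of_nonpos (hd.pos j).le ha)) hm0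
  have hsum : rootForm A d c = rootForm A d p + rootForm A d m -
      2 * ∑ j, ∑ k, (p j : ℝ) * (d j * A j k) * m k := by
    have hcpm : ∀ j, (c j : ℝ) = p j - m j := fun j => by
      have : c j = p j - m j := by simp only [p, m]; omega
      exact_mod_cast this
    have hswap : ∑ j, ∑ k, (m j : ℝ) * (d j * A j k) * p k =
        ∑ j, ∑ k, (p j : ℝ) * (d j * A j k) * m k := by
      rw [Finset.sum_comm]
      refine Finset.sum_congr rfl fun j _ => Finset.sum_congr rfl fun k _ => ?_
      rw [hd.symm k j]; ring
    simp only [rootForm, hcpm, sub_mul, mul_sub, Finset.sum_sub_distrib]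
    linear_combination -hswap
  have hle : ∑ j, ∑ k, (p j : ℝ) * (d j * A j k) * m k ≤ 0 :=
    Finset.sum_nonpos fun j _ => Finset.sum_nonpos fun k _ => hcross j k
  linarith

variable [Module.Free ℤ X] [Module.Finite ℤ X]

/-- Two real roots that are not opposite or equal are independent. -/
theorem IsRealRoot.exists_dual {d : Fin n → ℝ} (hd : IsSymmetrizer A d) {α β : X}
    (hα : D.IsRealRoot α) (hβ : D.IsRealRoot β) (h1 : β ≠ α) (h2 : β ≠ -α) :
    ∃ ν : Module.Dual ℤ X, ν α = 0 ∧ ν β ≠ 0 := by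
  by_contra! hno
  let b := Module.Free.chooseBasis ℤ X
  obtain ⟨k, hk⟩ : ∃ k, b.coord k α ≠ 0 := by
    by_contra! h
    exact hα.ne_zero (b.ext_elem fun k => by simpa using h k)
  -- The functional built from the coordinates `k` and `l` kills `α`, hence `β`: the two vectors
  -- have vanishing minors.
  have hprop : (b.coord k α) • β = (b.coord k β) • α := b.ext_elem fun l => by
    have := hno (b.coord k α • b.coord l - b.coord l α • b.coord k) (by simp; ring)
    simp only [LinearMap.sub_apply, LinearMap.smul_apply, smul_eq_mul, sub_eq_zero] at this
    simp only [map_smul, Finsupp.smul_apply, smul_eq_mul, ← Module.Basis.coord_apply]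
    rw [this, mul_comm]
  have hb : b.coord k β ≠ 0 := fun h => by
    rw [h, zero_smul] at hprop
    exact (smul_ne_zero hk hβ.ne_zero) hprop
  -- a real root that is proportional to another one is an integral multiple of it
  have key : ∀ {α β : X} (_ : D.IsRealRoot α) (_ : D.IsRealRoot β) {a b : ℤ}, a ≠ 0 →
      a • β = b • α → ∃ m : ℤ, β = m • α := by
    intro α β hα hβ a b ha h
    obtain ⟨v, i, rfl⟩ := hα
    obtain ⟨v', j, hv'⟩ := hβ.smul v⁻¹
    -- Once `α` is moved to a simple root, the coordinate of `β` along it is the integral factor.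
    -- Applied in both directions, this gives two integers with product `1`.
    obtain ⟨c, -, hc, -⟩ := hasRootCoords_smul_root hd v' j
    rw [← hv'] at hc
    have hv : (v⁻¹ : D.weyl).1 (v.1 (D.root i)) = D.root i := v.1.symm_apply_apply _
    have hv2 : v.1 ((v⁻¹ : D.weyl).1 β) = β := v.1.apply_symm_apply _
    have h2 := congrArg (v⁻¹ : D.weyl).1 h
    rw [map_smul, map_smul, hv, hc] at h2
    have h3 : ∑ l, (a * c l - (Pi.single i b : Fin n → ℤ) l) • D.root l = 0 := by
      simp only [sub_smul, Finset.sum_sub_distrib, mul_smul, ← Finset.smul_sum, h2]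
      simp [Pi.single_apply, ite_smul]
    have h4 := Fintype.linearIndependent_iff.1 D.root_indep _ h3 i
    rw [Pi.single_eq_same, sub_eq_zero] at h4
    refine ⟨c i, smul_right_injective X ha ?_⟩
    simp only
    rw [h, ← mul_smul, h4]
  obtain ⟨m, hm⟩ := key hα hβ hk hprop
  obtain ⟨m', hm'⟩ := key hβ hα hb hprop.symm
  have hmm : (m' * m - 1) • α = 0 := by
    rw [sub_smul, mul_smul, ← hm, ← hm', one_smul, sub_self]
  have : m' * m = 1 := sub_eq_zero.1 ((smul_eq_zero.1 hmm).resolve_right hα.ne_zero)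
  rcases Int.isUnit_iff.1 (IsUnit.of_mul_eq_one_right _ this) with h | h
  · exact h1 (by rw [hm, h, one_smul])
  · exact h2 (by rw [hm, h, neg_one_smul])

/-- An element of `W` is determined by the images of the simple roots, which lie in a finite set:
since `det A ≠ 0`, the multiple `det A • x` is a combination of simple roots plus a vector killed by
all coroots, hence fixed by `W`. -/
theorem finite_weyl {d : Fin n → ℝ} (hd : IsSymmetrizer A d) : Finite D.weyl := by
  have hfin : Finite {α | D.IsRealRoot α} := IsRealRoot.finite hd
  let F : D.weyl → Fin n → {α | D.IsRealRoot α} := fun w i => ⟨w.1 (D.root i), w, i, rfl⟩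
  refine Finite.of_injective F fun w w' h => Subtype.ext (LinearEquiv.ext fun x => ?_)
  have hroot : ∀ i, w.1 (D.root i) = w'.1 (D.root i) := fun i =>
    congrArg Subtype.val (congrFun h i)
  let y := A.adjugate.mulVec fun i => D.coroot i x
  have hy : A.mulVec y = A.det • fun i => D.coroot i x := by
    simp only [y, Matrix.mulVec_mulVec, Matrix.mul_adjugate, Matrix.smul_mulVec, Matrix.one_mulVec]
  let z := A.det • x - ∑ j, y j • D.root j
  have hz : ∀ i, D.coroot i z = 0 := fun i => by
    have := congrFun hy i
    simp only [Matrix.mulVec, dotProduct, Pi.smul_apply, smul_eq_mul] at this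
    simp only [z, map_sub, map_smul, map_sum, D.pairing, smul_eq_mul]
    rw [← this, sub_eq_zero]
    exact Finset.sum_congr rfl fun j _ => mul_comm _ _
  have hfix : ∀ v ∈ D.weyl, v z = z := fun v hv => by
    induction hv using Subgroup.closure_induction with
    | mem v hv =>
      obtain ⟨k, rfl⟩ := hv
      rw [simpleReflection_apply, hz, zero_smul, sub_zero]
    | one => rfl
    | mul v w _ _ hv hw => rw [LinearEquiv.mul_apply, hw, hv]
    | inv v _ hv =>
      conv_lhs => rw [← hv]
      exact v.symm_apply_apply z
  have hx : A.det • x = z + ∑ j, y j • D.root j := by simp [z]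
  refine smul_right_injective X hd.det_ne_zero ?_
  simp only
  rw [← map_smul, ← map_smul, hx, map_add, map_add, hfix _ w.2, hfix _ w'.2, map_sum, map_sum]
  simp only [map_smul, hroot]

end Realization

end Roots

/-! ### Generic points of the divisors -/

section Generic

variable {O : Type*} [CommRing O] [HopfAlgebra ℂ O] [Coalgebra.IsCocomm ℂ O]
  {X : Type*} [AddCommGroup X] {n : ℕ} {A : Matrix (Fin n) (Fin n) ℤ}

namespace Realization

/-- Points on no divisor `T_{β,1}`. -/
def OffDivisors (D : Realization A X) (t : Torus O X) : Prop :=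
  ∀ β, D.IsRealRoot β → charVal β t ≠ 1

/-- Points of `T_{α,1}` on no other divisor `T_{β,1}`. -/
def GenericOn (D : Realization A X) (α : X) (t : Torus O X) : Prop :=
  charVal α t = 1 ∧ ∀ β, D.IsRealRoot β → β ≠ α → β ≠ -α → charVal β t ≠ 1

variable {D : Realization A X}

theorem charVal_smul_torusAct (w : D.weyl) (x : X) (t : Torus O X) :
    charVal ((w⁻¹ : D.weyl).1 x) (torusAct O X w.1⁻¹ t) = charVal x t := by
  rw [charVal_torusAct_inv]
  exact congrArg (charVal · t) (w.1.apply_symm_apply x)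

theorem OffDivisors.torusAct {t : Torus O X} (h : D.OffDivisors t) (w : D.weyl) :
    D.OffDivisors (torusAct O X w.1⁻¹ t) := fun β hβ => by
  rw [charVal_torusAct_inv]
  exact h _ (hβ.smul w)

theorem GenericOn.neg {α : X} {t : Torus O X} (h : D.GenericOn α t) : D.GenericOn (-α) t := by
  refine ⟨by rw [charVal_neg_left, h.1, inv_one], fun β hβ h1 h2 => h.2 β hβ ?_ h1⟩
  rwa [neg_neg] at h2

theorem GenericOn.torusAct {α : X} {t : Torus O X} (h : D.GenericOn α t) (w : D.weyl) :
    D.GenericOn ((w⁻¹ : D.weyl).1 α) (torusAct O X w.1⁻¹ t) := by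
  have hw : w.1 ((w⁻¹ : D.weyl).1 α) = α := w.1.apply_symm_apply α
  refine ⟨by rw [charVal_smul_torusAct, h.1], fun β hβ h1 h2 => ?_⟩
  rw [charVal_torusAct_inv]
  have hβ' : (w⁻¹ : D.weyl).1 (w.1 β) = β := w.1.symm_apply_apply β
  refine h.2 _ (hβ.smul w) (fun h => h1 ?_) fun h => h2 ?_
  · rw [← hβ', h]
  · rw [← hβ', h, map_neg]

/-- A reflection fixes `T_{α,1}` pointwise: it changes `x` by a multiple of `α`, and `α(t) = 1`. -/
theorem IsReflectionOf.evalAt_torusAct {α : X} {σ : D.weyl} (hσ : D.IsReflectionOf σ α)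
    {t : Torus O X} (ht : charVal α t = 1) (f : coordinateRing O X) :
    evalAt (torusAct O X σ.1⁻¹ t) f = evalAt t f := by
  obtain ⟨ν, -, hν⟩ := hσ.exists_apply
  induction f using coordinateRing_induction with
  | pullback x v =>
    rw [evalAt_pullback, evalAt_pullback, charVal_torusAct_inv, hν, charVal_sub_left,
      charVal_zsmul_left, ht, one_zpow, div_one]
  | const r => simp
  | add f g hf hg => rw [map_add, map_add, hf, hg]
  | mul f g hf hg => rw [map_mul, map_mul, hf, hg]

theorem IsReflectionOf.hasValueAt_smul {α : X} {σ : D.weyl} (hσ : D.IsReflectionOf σ α)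
    {t : Torus O X} (ht : charVal α t = 1) {f : RationalFunctions O X} {c : ℂ}
    (hf : HasValueAt f t c) : HasValueAt (σ.1 • f) t c := by
  refine HasValueAt.smul ?_
  obtain ⟨a, b, hb, h, rfl⟩ := hasValueAt_iff.1 hf
  refine hasValueAt_iff.2 ⟨a, b, ?_, h, ?_⟩ <;> simp only [hσ.evalAt_torusAct ht]
  exact hb

end Realization

theorem smul_pullback_coe (w : X ≃ₗ[ℤ] X) (x : X) (v : O) :
    w • algebraMap _ (RationalFunctions O X) (pullback x v) =
      algebraMap _ (RationalFunctions O X) (pullback (w x) v) := by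
  rw [smul_algebraMap_coordinateRing, smul_pullback]

variable [IsDomain O] [Algebra.FiniteType ℂ O] [Module.Free ℤ X] [Module.Finite ℤ X]
  {D : Realization A X} {d : Fin n → ℝ}

open Realization

/-- The finite set of real roots. -/
def Realization.realRoots (D : Realization A X) (hd : IsSymmetrizer A d) : Finset X :=
  (IsRealRoot.finite (D := D) hd).toFinset

theorem mem_realRoots {hd : IsSymmetrizer A d} {β : X} :
    β ∈ D.realRoots hd ↔ D.IsRealRoot β := Set.Finite.mem_toFinset _

/-- The points of `T_{α,1}` that are not generic are cut out by an equation. -/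
theorem exists_generic_function (hd : IsSymmetrizer A d) {α : X} {t : Torus O X}
    (ht : D.GenericOn α t) : ∃ h : coordinateRing O X, evalAt t h ≠ 0 ∧
      ∀ t', charVal α t' = 1 → evalAt t' h ≠ 0 → D.GenericOn α t' := by
  classical
  let S := (D.realRoots hd).filter fun β => β ≠ α ∧ β ≠ -α
  have hv : ∀ β ∈ S, ∃ v : O, (1 : Points O).eval v = 0 ∧ (charVal β t).eval v ≠ 0 := by
    intro β hβ
    obtain ⟨hβ, h1, h2⟩ := Finset.mem_filter.1 hβ
    exact exists_eval_ne_zero_of_ne_one (ht.2 β (mem_realRoots.1 hβ) h1 h2)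
  choose! v hv1 hv using hv
  refine ⟨∏ β ∈ S, pullback β (v β), ?_, fun t' h1 hne => ⟨h1, fun β hβ hβ1 hβ2 hβt => ?_⟩⟩
  · rw [map_prod]
    exact Finset.prod_ne_zero_iff.2 hv
  · have hβS : β ∈ S := Finset.mem_filter.2 ⟨mem_realRoots.2 hβ, hβ1, hβ2⟩
    rw [map_prod] at hne
    refine Finset.prod_ne_zero_iff.1 hne β hβS ?_
    rw [evalAt_pullback, hβt, hv1 β hβS]

/-- Used for `x = 1` and for `x = q⁻²`: a function nonzero somewhere on `T_{α,x}` is nonzero at a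
point of it that avoids the other divisors. -/
theorem exists_genericOn (hdim : Algebra.trdeg ℂ O = 1) (hd : IsSymmetrizer A d) {α : X}
    (hα : D.IsRealRoot α) {x : Points O} {t : Torus O X} (ht : charVal α t = x)
    {h : coordinateRing O X} (hh : evalAt t h ≠ 0) :
    ∃ t', charVal α t' = x ∧ evalAt t' h ≠ 0 ∧
      ∀ β, D.IsRealRoot β → β ≠ α → β ≠ -α → charVal β t' ≠ 1 := by
  classical
  obtain ⟨u, hu⟩ := exists_isLocalParameter (O := O) hdim
  obtain ⟨δ, hδ, hδu⟩ := exists_pointDerivation_ne_zero hu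
  let S := (D.realRoots hd).filter fun β => β ≠ α ∧ β ≠ -α
  obtain ⟨t', h1, h2, h3⟩ := exists_generic_point hu hδ hδu hdim hα.exists_dual_ne_zero ht hh S
    fun β hβ => by
      obtain ⟨hβ, h1, h2⟩ := Finset.mem_filter.1 hβ
      exact hα.exists_dual hd (mem_realRoots.1 hβ) h1 h2
  exact ⟨t', h1, h2, fun β hβ hβ1 hβ2 =>
    h3 β (Finset.mem_filter.2 ⟨mem_realRoots.2 hβ, hβ1, hβ2⟩)⟩

/-- The composition of a local parameter with the inversion is a local parameter. -/
theorem IsLocalParameter.inv {u : O} (hu : IsLocalParameter u) :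
    IsLocalParameter (Points.powHom (-1) u) := by
  obtain ⟨δ, hδ, hδu⟩ := exists_pointDerivation_ne_zero hu
  refine isLocalParameter_of_derivation_ne_zero ?_ hδ ?_
  · rw [Points.eval_powHom, one_zpow, hu.eval_one]
  · rw [hδ.map_powHom]
    simpa using hδu

theorem pullback_neg (x : X) (v : O) : pullback (-x) v = pullback x (Points.powHom (-1) v) :=
  coordinateRing_ext fun t => by
    rw [evalAt_pullback, evalAt_pullback, charVal_neg_left, Points.eval_powHom, zpow_neg_one]

/-! ### A reflection acting on the local ring at a point of its divisor -/

section LocalRing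

variable (hdim : Algebra.trdeg ℂ O = 1) {u : O} (hu : IsLocalParameter u) {α : X}
  (hα : D.IsRealRoot α) {σ : D.weyl} (hσ : D.IsReflectionOf σ α) {t : Torus O X}
  (ht : charVal α t = 1)
include hdim hu hα hσ ht

theorem algebraMap_pullback_ne_zero :
    algebraMap _ (RationalFunctions O X) (pullback α u) ≠ 0 := by
  obtain ⟨δ, hδ, hδu⟩ := exists_pointDerivation_ne_zero hu
  rw [← equation_one]
  exact (map_ne_zero_iff _ (IsFractionRing.injective _ _)).2
    (equation_ne_zero hu hδ hδu hα.exists_dual_ne_zero ht)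

theorem smul_mem_regularAt_of_isReflectionOf {f : RationalFunctions O X} (hf : f ∈ regularAt t) :
    σ.1 • f ∈ regularAt t := by
  obtain ⟨c, hc⟩ := hf
  exact ⟨c, hσ.hasValueAt_smul ht hc⟩

/-- As `σ` fixes `T_{α,1}` pointwise, `f - σ f` vanishes there and is divisible by the equation;
this is the divided difference. -/
theorem sub_smul_div_mem_regularAt {f : RationalFunctions O X} (hf : f ∈ regularAt t) :
    (f - σ.1 • f) / algebraMap _ (RationalFunctions O X) (pullback α u) ∈ regularAt t := by
  obtain ⟨δ, hδ, hδu⟩ := exists_pointDerivation_ne_zero hu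
  have hf' := hf
  obtain ⟨-, a, b, hb, hab, -⟩ := hf'
  refine div_equation_mem_regularAt hu hδ hδu hdim hα.exists_dual_ne_zero ht
    (sub_mem hf (smul_mem_regularAt_of_isReflectionOf hdim hu hα hσ ht hf)) hb
    fun t' ht' hbt' c hc => ?_
  have hv : HasValueAt f t' _ := hasValueAt_iff.2 ⟨a, b, hbt', hab, rfl⟩
  rw [hc.unique (hv.sub (hσ.hasValueAt_smul ht' hv)), sub_self]

/-- The ratio of an equation of `T_{α,1}` and of its reflection has the value `-1` on `T_{α,1}`. -/
theorem exists_ratio : ∃ κ a b, evalAt t b ≠ 0 ∧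
    κ * algebraMap _ (RationalFunctions O X) (pullback α u) =
      σ.1 • algebraMap _ (RationalFunctions O X) (pullback α u) ∧
    κ * algebraMap _ (RationalFunctions O X) b = algebraMap _ (RationalFunctions O X) a ∧
    ∀ t', charVal α t' = 1 → evalAt t' a = - evalAt t' b := by
  obtain ⟨δ, hδ, hδu⟩ := exists_pointDerivation_ne_zero hu
  have hπ0 := algebraMap_pullback_ne_zero hdim hu hα hσ ht
  set π := algebraMap _ (RationalFunctions O X) (pullback α u) with hπ
  have hσπ : σ.1 • π = algebraMap _ (RationalFunctions O X) (pullback (-α) u) := by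
    rw [hπ, smul_pullback_coe, hσ.apply_self]
  have hreg : σ.1 • π / π ∈ regularAt t := by
    refine div_equation_mem_regularAt hu hδ hδu hdim hα.exists_dual_ne_zero ht (h := 1)
      (hσπ ▸ algebraMap_mem_regularAt _ _) (by simp) fun t' ht' _ c hc => ?_
    rw [hσπ] at hc
    rw [hc.unique (hasValueAt_algebraMap _ _), evalAt_pullback, charVal_neg_left, ht', inv_one,
      hu.eval_one]
  obtain ⟨-, a, b, hb, hab, -⟩ := hreg
  refine ⟨σ.1 • π / π, a, b, hb, div_mul_cancel₀ _ hπ0, hab, fun t' ht' => ?_⟩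
  have hR : pullback (-α) u * b = a * pullback α u := by
    refine IsFractionRing.injective _ (RationalFunctions O X) ?_
    rw [map_mul, map_mul, ← hab, ← hσπ, ← hπ]
    field_simp
  obtain ⟨ν, hν⟩ := hα.exists_dual_ne_zero
  obtain ⟨E, hE⟩ := exists_derivation (X := X) hδ ν
  -- On `T_{α,1}` both equations vanish and the derivative of `u ∘ (-α)` is minus that of `u ∘ α`;
  -- comparing derivatives gives `a = -b` there.
  have h := congrArg (fun f => evalAt t' (E f)) hR
  simp only [Derivation.leibniz, smul_eq_mul, map_add, map_mul, hE, evalAt_pullback,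
    charVal_neg_left, ht', inv_one, hu.eval_one, Points.translate_one, map_neg] at h
  push_cast at h
  have hne : (ν α : ℂ) * δ u ≠ 0 := mul_ne_zero (Int.cast_ne_zero.2 hν) hδu
  refine mul_right_cancel₀ hne ?_
  linear_combination -h

theorem ratio_inv_mem {κ : RationalFunctions O X} {a b : coordinateRing O X} (hb : evalAt t b ≠ 0)
    (hab : κ * algebraMap _ (RationalFunctions O X) b = algebraMap _ (RationalFunctions O X) a)
    (hval : ∀ t', charVal α t' = 1 → evalAt t' a = - evalAt t' b) :
    κ⁻¹ ∈ regularAt t := by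
  have hv : HasValueAt κ t _ := hasValueAt_iff.2 ⟨a, b, hb, hab, rfl⟩
  rw [hval t ht, neg_div, div_self hb] at hv
  exact ⟨_, hv.inv (by simp)⟩

/-- If `f` has at most a simple pole along `T_{α,1}`, then `f + s_α f` has none. -/
theorem add_smul_mem_regularAt {f : RationalFunctions O X}
    (hf : algebraMap _ (RationalFunctions O X) (pullback α u) * f ∈ regularAt t) :
    f + σ.1 • f ∈ regularAt t := by
  obtain ⟨δ, hδ, hδu⟩ := exists_pointDerivation_ne_zero hu
  have hπ0 := algebraMap_pullback_ne_zero hdim hu hα hσ ht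
  obtain ⟨κ, a, b, hb, hκ, hab, hval⟩ := exists_ratio hdim hu hα hσ ht
  have hκi := ratio_inv_mem hdim hu hα hσ ht hb hab hval
  set π := algebraMap _ (RationalFunctions O X) (pullback α u) with hπ
  have hκ0 : κ ≠ 0 := fun h => by
    rw [h, zero_mul] at hκ
    exact hπ0 ((smul_eq_zero_iff_eq _).1 hκ.symm)
  -- Since `σ π = κ π` and `κ = -1` on `T_{α,1}`, the two summands have opposite values on the
  -- divisor.
  have h1 : π * (f + σ.1 • f) = π * f + κ⁻¹ * (σ.1 • (π * f)) := by
    rw [smul_mul', ← hκ]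
    field_simp
  have h2 : f + σ.1 • f = (π * f + κ⁻¹ * (σ.1 • (π * f))) / π := by
    rw [← h1, mul_div_cancel_left₀ _ hπ0]
  rw [h2]
  have hf' := hf
  obtain ⟨-, a', b', hb', hab', -⟩ := hf'
  refine div_equation_mem_regularAt hu hδ hδu hdim hα.exists_dual_ne_zero ht
    (add_mem hf (mul_mem hκi (smul_mem_regularAt_of_isReflectionOf hdim hu hα hσ ht hf)))
    (h := b * b') (by rw [map_mul]; exact mul_ne_zero hb hb') fun t' ht' hbt' c hc => ?_
  rw [map_mul] at hbt'
  have hv : HasValueAt (π * f) t' _ :=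
    hasValueAt_iff.2 ⟨a', b', right_ne_zero_of_mul hbt', hab', rfl⟩
  have hv' : HasValueAt κ t' _ := hasValueAt_iff.2 ⟨a, b, left_ne_zero_of_mul hbt', hab, rfl⟩
  rw [hval t' ht', neg_div, div_self (left_ne_zero_of_mul hbt')] at hv'
  rw [hc.unique (hv.add ((hv'.inv (by simp)).mul (hσ.hasValueAt_smul ht' hv)))]
  ring

end LocalRing

end Generic

/-! ### The residue conditions at generic points -/

section LocallyHecke

variable {O : Type*} [CommRing O] [HopfAlgebra ℂ O] [Coalgebra.IsCocomm ℂ O]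
  {X : Type*} [AddCommGroup X] {n : ℕ} {A : Matrix (Fin n) (Fin n) ℤ}

/-- The residue conditions, stated at generic points and for all real roots. -/
structure IsLocallyHecke (D : Realization A X) (q : Points O) (P : SkewRing O D) : Prop where
  regular : ∀ (w : D.weyl) (t : Torus O X), D.OffDivisors t → P.coeff w ∈ regularAt t
  pole : ∀ (w : D.weyl) (α : X), D.IsRealRoot α → ∀ t : Torus O X, D.GenericOn α t →
    ∀ u : O, IsLocalParameter u →
      algebraMap _ (RationalFunctions O X) (pullback α u) * P.coeff w ∈ regularAt t
  residue : ∀ (w σ : D.weyl) (α : X), D.IsRealRoot α → D.IsReflectionOf σ α →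
    ∀ t : Torus O X, D.GenericOn α t → P.coeff w + P.coeff (σ * w) ∈ regularAt t
  vanishing : ∀ (w : D.weyl) (α : X), D.IsPosRealRoot α →
    D.IsPosRealRoot (-((w⁻¹ : D.weyl).1 α)) → ∀ t : Torus O X, D.OffDivisors t →
      charVal α t = (q ^ 2)⁻¹ → HasValueAt (P.coeff w) t 0

variable [IsDomain O] [Algebra.FiniteType ℂ O] [Module.Free ℤ X] [Module.Finite ℤ X]
  {D : Realization A X} {d : Fin n → ℝ} {q : Points O} {P Q : SkewRing O D}

open Realization

/-- Opposite residues near a generic point mean that `π (f_w + f_{σw})` vanishes on `T_{α,1}`, so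
`π` divides it. Negative roots reduce to positive ones by composing `u` with the inversion of `𝒞`.
-/
theorem IsHeckeElement.isLocallyHecke (hdim : Algebra.trdeg ℂ O = 1) (hd : IsSymmetrizer A d)
    (hP : IsHeckeElement D q P) : IsLocallyHecke D q P := by
  have hreg : ∀ (w : D.weyl) (t : Torus O X), D.OffDivisors t → P.coeff w ∈ regularAt t := by
    intro w t ht
    obtain ⟨S, hS, h, -⟩ := hP.poles w
    exact h t fun β hβ => ht β (hS β hβ).isRealRoot
  have hpole : ∀ (w : D.weyl) (α : X), D.IsPosRealRoot α → ∀ t : Torus O X, D.GenericOn α t →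
      ∀ u : O, IsLocalParameter u →
        algebraMap _ (RationalFunctions O X) (pullback α u) * P.coeff w ∈ regularAt t := by
    intro w α hα t ht u hu
    obtain ⟨S, hS, h1, h2⟩ := hP.poles w
    have hS' : ∀ β ∈ S, β ≠ α → t ∉ divisor β 1 := fun β hβ hne =>
      ht.2 β (hS β hβ).isRealRoot hne fun h => hα.not_neg (h ▸ hS β hβ)
    by_cases hαS : α ∈ S
    · exact h2 α hαS u hu t ht.1 hS'
    · exact mul_mem (algebraMap_mem_regularAt _ _)
        (h1 t fun β hβ => hS' β hβ fun h => hαS (h ▸ hβ))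
  have hres : ∀ (w σ : D.weyl) (α : X), D.IsPosRealRoot α → D.IsReflectionOf σ α →
      ∀ t : Torus O X, D.GenericOn α t → P.coeff w + P.coeff (σ * w) ∈ regularAt t := by
    intro w σ α hα hσ t ht
    obtain ⟨u, hu⟩ := exists_isLocalParameter (O := O) hdim
    obtain ⟨δ, hδ, hδu⟩ := exists_pointDerivation_ne_zero hu
    have hπ0 := algebraMap_pullback_ne_zero hdim hu hα.isRealRoot hσ ht.1
    obtain ⟨h, hht, hh⟩ := exists_generic_function hd ht
    have key := div_equation_mem_regularAt hu hδ hδu hdim hα.isRealRoot.exists_dual_ne_zero ht.1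
      (add_mem (hpole w α hα t ht u hu) (hpole (σ * w) α hα t ht u hu)) hht
      fun t' ht' hht' c hc => by
        obtain ⟨c₁, h₁⟩ := hpole w α hα t' (hh t' ht' hht') u hu
        obtain ⟨c₂, h₂⟩ := hpole (σ * w) α hα t' (hh t' ht' hht') u hu
        rw [hc.unique (h₁.add h₂)]
        exact hP.residues w σ α hα hσ u hu t' ht' c₁ c₂ h₁ h₂
    rwa [← mul_add, mul_div_cancel_left₀ _ hπ0] at key
  refine ⟨hreg, fun w α hα t ht u hu => ?_, fun w σ α hα hσ t ht => ?_,
    fun w α hα hw t ht htα => ?_⟩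
  · rcases hα.pos_or_neg hd with h | h
    · exact hpole w α h t ht u hu
    · have := hpole w (-α) h t ht.neg _ hu.inv
      rwa [← pullback_neg, neg_neg] at this
  · rcases hα.pos_or_neg hd with h | h
    · exact hres w σ α h hσ t ht
    · exact hres w σ (-α) h hσ.neg t ht.neg
  · obtain ⟨c, hc⟩ := hreg w t ht
    exact hP.vanishing w α hα hw t htα c hc ▸ hc

/-- A violation at some point is a nonvanishing numerator, which persists at a generic point of the
same divisor. For the vanishing condition, `q² ≠ 1` ensures that generic points of `T_{α,q⁻²}` also
avoid `T_{±α,1}`. -/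
theorem IsLocallyHecke.isHeckeElement (hdim : Algebra.trdeg ℂ O = 1) (hd : IsSymmetrizer A d)
    (hq : q ^ 2 ≠ 1) (hP : IsLocallyHecke D q P) : IsHeckeElement D q P := by
  classical
  refine ⟨fun w => ⟨(D.realRoots hd).filter D.IsPosRealRoot, fun β hβ => (Finset.mem_filter.1 hβ).2,
    fun t ht => hP.regular w t fun β hβ hβt => ?_, fun α hα u hu t ht h => ?_⟩, ?_, ?_⟩
  · rcases hβ.pos_or_neg hd with h | h
    · exact ht β (Finset.mem_filter.2 ⟨mem_realRoots.2 hβ, h⟩) hβt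
    · refine ht (-β) (Finset.mem_filter.2 ⟨mem_realRoots.2 hβ.neg, h⟩) ?_
      rw [mem_divisor, charVal_neg_left, hβt, inv_one]
  · have hα' := (Finset.mem_filter.1 hα).2
    refine hP.pole w α hα'.isRealRoot t ⟨ht, fun β hβ h1 h2 hβt => ?_⟩ u hu
    rcases hβ.pos_or_neg hd with hp | hp
    · exact h β (Finset.mem_filter.2 ⟨mem_realRoots.2 hβ, hp⟩) h1 hβt
    · refine h (-β) (Finset.mem_filter.2 ⟨mem_realRoots.2 hβ.neg, hp⟩)
        (fun h => h2 (by rw [← h, neg_neg])) ?_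
      rw [mem_divisor, charVal_neg_left, hβt, inv_one]
  · intro w σ α hα hσ u hu t ht c c' hc hc'
    have hv : HasValueAt (mulEquation u α (P.coeff w) + mulEquation u α (P.coeff (σ * w))) t
      (c + c') := hc.add hc'
    obtain ⟨a, b, hb, hab, hcc⟩ := hasValueAt_iff.1 hv
    rw [hcc, div_eq_zero_iff]
    left
    by_contra ha
    obtain ⟨t', ht', hh, hgen⟩ := exists_genericOn hdim hd hα.isRealRoot
      (mem_divisor.1 ht) (h := a * b) (by
      rw [map_mul]; exact mul_ne_zero ha hb)
    rw [map_mul] at hh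
    obtain ⟨e, he⟩ := hP.residue w σ α hα.isRealRoot hσ t' ⟨ht', hgen⟩
    have h1 := (hasValueAt_algebraMap (pullback α u) t').mul he
    rw [mul_add] at h1
    have h2 := h1.unique (hasValueAt_iff.2 ⟨a, b, right_ne_zero_of_mul hh, hab, rfl⟩)
    rw [evalAt_pullback, ht', hu.eval_one, zero_mul] at h2
    exact div_ne_zero (left_ne_zero_of_mul hh) (right_ne_zero_of_mul hh) h2.symm
  · intro w α hα hw t ht c hc
    obtain ⟨a, b, hb, hab, hcc⟩ := hasValueAt_iff.1 hc
    rw [hcc, div_eq_zero_iff]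
    left
    by_contra ha
    obtain ⟨t', ht', hh, hgen⟩ := exists_genericOn hdim hd hα.isRealRoot
      (mem_divisor.1 ht) (h := a * b) (by
      rw [map_mul]; exact mul_ne_zero ha hb)
    rw [map_mul] at hh
    have hoff : D.OffDivisors t' := fun β hβ => by
      by_cases h1 : β = α
      · rw [h1, ht']
        exact inv_ne_one.2 hq
      by_cases h2 : β = -α
      · rw [h2, charVal_neg_left, ht', inv_inv]
        exact hq
      exact hgen β hβ h1 h2
    have h2 := (hP.vanishing w α hα hw t' hoff ht').unique
      (hasValueAt_iff.2 ⟨a, b, right_ne_zero_of_mul hh, hab, rfl⟩)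
    exact div_ne_zero (left_ne_zero_of_mul hh) (right_ne_zero_of_mul hh) h2.symm

theorem isHeckeElement_iff (hdim : Algebra.trdeg ℂ O = 1) (hd : IsSymmetrizer A d)
    (hq : q ^ 2 ≠ 1) : IsHeckeElement D q P ↔ IsLocallyHecke D q P :=
  ⟨fun h => h.isLocallyHecke hdim hd, fun h => h.isHeckeElement hdim hd hq⟩

theorem coeff_mul_eq_sum [Fintype D.weyl] (P Q : SkewRing O D) (z : D.weyl) :
    (P * Q).coeff z = ∑ w : D.weyl, P.coeff w * w.1 • Q.coeff (w⁻¹ * z) := by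
  classical
  rw [SkewMonoidAlgebra.coeff_mul_antidiagonal_of_finset P Q z
    (Finset.univ.image fun w : D.weyl => (w, w⁻¹ * z)) (fun {p} => ?_),
    Finset.sum_image fun w _ w' _ h => congrArg Prod.fst h]
  · rfl
  · simp only [Finset.mem_image, Finset.mem_univ, true_and]
    constructor
    · rintro ⟨w, rfl⟩
      exact mul_inv_cancel_left w z
    · rintro rfl
      exact ⟨p.1, by rw [inv_mul_cancel_left]⟩

theorem IsLocallyHecke.add (hP : IsLocallyHecke D q P) (hQ : IsLocallyHecke D q Q) :
    IsLocallyHecke D q (P + Q) := by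
  have h : ∀ w, (P + Q).coeff w = P.coeff w + Q.coeff w := fun w => by
    rw [SkewMonoidAlgebra.coeff_add]; rfl
  refine ⟨fun w t ht => ?_, fun w α hα t ht u hu => ?_, fun w σ α hα hσ t ht => ?_,
    fun w α hα hw t ht htα => ?_⟩
  · rw [h]
    exact add_mem (hP.regular w t ht) (hQ.regular w t ht)
  · rw [h, mul_add]
    exact add_mem (hP.pole w α hα t ht u hu) (hQ.pole w α hα t ht u hu)
  · rw [h, h, add_add_add_comm]
    exact add_mem (hP.residue w σ α hα hσ t ht) (hQ.residue w σ α hα hσ t ht)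
  · rw [h, ← add_zero (0 : ℂ)]
    exact (hP.vanishing w α hα hw t ht htα).add (hQ.vanishing w α hα hw t ht htα)

/-- With regular coefficients the pole and residue conditions are automatic; only the vanishing
condition remains. -/
theorem isLocallyHecke_single (w : D.weyl) (a : coordinateRing O X)
    (ha : ∀ α, D.IsPosRealRoot α → D.IsPosRealRoot (-((w⁻¹ : D.weyl).1 α)) → ∀ t : Torus O X,
      charVal α t = (q ^ 2)⁻¹ → evalAt t a = 0) :
    IsLocallyHecke D q (SkewMonoidAlgebra.single w (algebraMap _ (RationalFunctions O X) a)) := by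
  classical
  have h : ∀ w', ∃ b : coordinateRing O X,
      (SkewMonoidAlgebra.single w (algebraMap _ (RationalFunctions O X) a)).coeff w' =
        algebraMap _ (RationalFunctions O X) b := fun w' => by
    rw [SkewMonoidAlgebra.coeff_single_apply]
    split_ifs
    · exact ⟨a, rfl⟩
    · exact ⟨0, (map_zero _).symm⟩
  have hreg : ∀ w' t, (SkewMonoidAlgebra.single w
      (algebraMap _ (RationalFunctions O X) a)).coeff w' ∈ regularAt t := fun w' t => by
    obtain ⟨b, hb⟩ := h w'
    rw [hb]
    exact algebraMap_mem_regularAt b t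
  refine ⟨fun w' t _ => hreg w' t, fun w' α _ t _ u _ => mul_mem (algebraMap_mem_regularAt _ _)
    (hreg w' t), fun w' σ α _ _ t _ => add_mem (hreg w' t) (hreg _ t),
    fun w' α hα hw t ht htα => ?_⟩
  rw [SkewMonoidAlgebra.coeff_single_apply]
  split_ifs with hww
  · subst hww
    exact ha α hα hw t htα ▸ hasValueAt_algebraMap a t
  · exact hasValueAt_zero t

theorem isLocallyHecke_single_one (a : coordinateRing O X) :
    IsLocallyHecke D q (SkewMonoidAlgebra.single 1 (algebraMap _ (RationalFunctions O X) a)) :=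
  isLocallyHecke_single 1 a fun α hα hw => hα.not_neg.elim (by
    rw [inv_one] at hw
    exact hw)

theorem IsLocallyHecke.mul (hdim : Algebra.trdeg ℂ O = 1) (hd : IsSymmetrizer A d)
    (hP : IsLocallyHecke D q P) (hQ : IsLocallyHecke D q Q) : IsLocallyHecke D q (P * Q) := by
  have := finite_weyl (D := D) hd
  have := Fintype.ofFinite D.weyl
  -- summing over pairs `w`, `σ w`
  have hpair : ∀ (σ z : D.weyl), 2 * (P * Q).coeff z = ∑ w : D.weyl,
      (P.coeff w * w.1 • Q.coeff (w⁻¹ * z) +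
        P.coeff (σ * w) * (σ * w).1 • Q.coeff ((σ * w)⁻¹ * z)) := fun σ z => by
    rw [Finset.sum_add_distrib, ← coeff_mul_eq_sum,
      show ∑ w : D.weyl, P.coeff (σ * w) * (σ * w).1 • Q.coeff ((σ * w)⁻¹ * z) =
        ∑ w : D.weyl, P.coeff w * w.1 • Q.coeff (w⁻¹ * z) from
          Equiv.sum_comp (Equiv.mulLeft σ) fun w => P.coeff w * w.1 • Q.coeff (w⁻¹ * z),
      ← coeff_mul_eq_sum, two_mul]
  have hhalf : ∀ (t : Torus O X) (f : RationalFunctions O X), 2 * f ∈ regularAt t →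
      f ∈ regularAt t := fun t f hf => by
    have h := mul_mem (algebraMap_mem_regularAt (algebraMap ℂ (coordinateRing O X) 2⁻¹) t) hf
    rwa [← mul_assoc, show (2 : RationalFunctions O X) = algebraMap _ _
      (algebraMap ℂ (coordinateRing O X) 2) by rw [map_ofNat, map_ofNat], ← map_mul, ← map_mul,
      inv_mul_cancel₀ two_ne_zero, map_one, map_one, one_mul] at h
  -- translates of the coefficients of `Q`
  have hQpole : ∀ (w y : D.weyl) (α : X), D.IsRealRoot α → ∀ t : Torus O X, D.GenericOn α t →
      ∀ u : O, IsLocalParameter u → algebraMap _ (RationalFunctions O X) (pullback α u) *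
        w.1 • Q.coeff y ∈ regularAt t := fun w y α hα t ht u hu => by
    have h := smul_mem_regularAt (hQ.pole y _ (hα.smul w⁻¹) _ (ht.torusAct w) u hu)
    rwa [smul_mul', smul_pullback_coe,
      show w.1 ((w⁻¹ : D.weyl).1 α) = α from w.1.apply_symm_apply α] at h
  -- The condition of `Q` along the divisor of `w⁻¹ α`, with reflection `w⁻¹ σ w`, transported by
  -- `w`.
  have hQres : ∀ (w z σ : D.weyl) (α : X), D.IsRealRoot α → D.IsReflectionOf σ α →
      ∀ t : Torus O X, D.GenericOn α t →
        w.1 • Q.coeff (w⁻¹ * z) + w.1 • Q.coeff (w⁻¹ * (σ * z)) ∈ regularAt t :=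
    fun w z σ α hα hσ t ht => by
      have h := smul_mem_regularAt (hQ.residue (w⁻¹ * z) _ _ (hα.smul w⁻¹) (hσ.conj w⁻¹) _
        (ht.torusAct w))
      rwa [smul_add, show w⁻¹ * σ * w⁻¹⁻¹ * (w⁻¹ * z) = w⁻¹ * (σ * z) by group] at h
  have hσmul : ∀ (σ w z : D.weyl) (α : X), D.IsReflectionOf σ α →
      (σ * w).1 • Q.coeff ((σ * w)⁻¹ * z) = σ.1 • w.1 • Q.coeff (w⁻¹ * (σ * z)) :=
    fun σ w z α hσ => by
      rw [mul_inv_rev, hσ.inv_eq, mul_assoc, ← mul_smul]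
      rfl
  refine ⟨fun w t ht => ?_, fun z α hα t ht u hu => ?_, fun z σ α hα hσ t ht => ?_,
    fun z α hα hz t ht htα => ?_⟩
  · rw [coeff_mul_eq_sum]
    exact sum_mem fun w _ => mul_mem (hP.regular w t ht)
      (smul_mem_regularAt (hQ.regular _ _ (ht.torusAct w)))
  · obtain ⟨σ, hσ⟩ := hα.exists_reflection
    have hπ0 := algebraMap_pullback_ne_zero hdim hu hα hσ ht.1
    apply hhalf
    rw [mul_left_comm, hpair σ, Finset.mul_sum]
    refine sum_mem fun w _ => ?_
    rw [hσmul σ w z α hσ]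
    have h1 := hP.pole w α hα t ht u hu
    have h2 := hP.residue w σ α hα hσ t ht
    have h3 := hQpole w (w⁻¹ * (σ * z)) α hα t ht u hu
    have h4 := hQres w z σ α hα hσ t ht
    have h5 := add_smul_mem_regularAt hdim hu hα hσ ht.1 h3
    set π := algebraMap _ (RationalFunctions O X) (pullback α u)
    set f := P.coeff w
    set f' := P.coeff (σ * w)
    set G := w.1 • Q.coeff (w⁻¹ * z)
    set G' := w.1 • Q.coeff (w⁻¹ * (σ * z))
    -- Every factor on the right is regular: `f + f'` and `G + G'` by the residue conditions, `π f`
    -- and `π G'` by the pole conditions, and `G' + σ G'` because `σ` flips the residue.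
    have hkey : π * (f * G + f' * σ.1 • G') =
        (f + f') * (π * (G' + σ.1 • G') - π * G') + (π * f) * ((G + G') - (G' + σ.1 • G')) := by
      ring
    rw [hkey]
    exact add_mem (mul_mem h2 (sub_mem (mul_mem (algebraMap_mem_regularAt _ _) h5) h3))
      (mul_mem h1 (sub_mem h4 h5))
  · obtain ⟨u, hu⟩ := exists_isLocalParameter (O := O) hdim
    have hπ0 := algebraMap_pullback_ne_zero hdim hu hα hσ ht.1
    apply hhalf
    rw [mul_add, hpair σ, hpair σ, ← Finset.sum_add_distrib]
    refine sum_mem fun w _ => ?_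
    rw [hσmul σ w z α hσ, hσmul σ w (σ * z) α hσ, ← mul_assoc σ σ z, hσ.mul_self, one_mul]
    have h1 := hP.pole w α hα t ht u hu
    have h2 := hP.residue w σ α hα hσ t ht
    have h4 := hQres w z σ α hα hσ t ht
    have h5 := smul_mem_regularAt_of_isReflectionOf hdim hu hα hσ ht.1 h4
    have h6 := sub_smul_div_mem_regularAt hdim hu hα hσ ht.1 h4
    set π := algebraMap _ (RationalFunctions O X) (pullback α u)
    set f := P.coeff w
    set f' := P.coeff (σ * w)
    set G := w.1 • Q.coeff (w⁻¹ * z)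
    set G' := w.1 • Q.coeff (w⁻¹ * (σ * z))
    -- The only pole left is that of `f`, and it meets the divided difference of the regular
    -- function `G + G'`.
    have hkey : f * G + f' * σ.1 • G' + (f * G' + f' * σ.1 • G) =
        (f + f') * σ.1 • (G + G') + (π * f) * (((G + G') - σ.1 • (G + G')) / π) := by
      rw [smul_add]
      field_simp
      ring
    rw [hkey]
    exact add_mem (mul_mem h2 h5) (mul_mem h1 h6)
  · rw [coeff_mul_eq_sum, ← Finset.sum_const_zero (s := (Finset.univ : Finset D.weyl)) (M := ℂ)]
    refine HasValueAt.sum fun w _ => ?_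
    -- If `w⁻¹ α` is positive, `w⁻¹ z` sends it to the negative root `z⁻¹ α` under its inverse, so
    -- the factor from `Q` vanishes; if it is negative, the factor from `P` vanishes.
    rcases (hα.isRealRoot.smul w⁻¹).pos_or_neg hd with h | h
    · obtain ⟨c, hc⟩ := hP.regular w t ht
      have h0 : HasValueAt (w.1 • Q.coeff (w⁻¹ * z)) t 0 := by
        refine HasValueAt.smul (hQ.vanishing _ _ h ?_ _ (ht.torusAct w) ?_)
        · have : ((w⁻¹ * z)⁻¹ : D.weyl).1 ((w⁻¹ : D.weyl).1 α) = (z⁻¹ : D.weyl).1 α := by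
            rw [mul_inv_rev, inv_inv]
            exact congrArg (z⁻¹ : D.weyl).1 (w.1.apply_symm_apply α)
          rwa [this]
        · rw [charVal_smul_torusAct, htα]
      simpa using hc.mul h0
    · obtain ⟨c, hc⟩ := smul_mem_regularAt (w := w.1) (hQ.regular (w⁻¹ * z) _ (ht.torusAct w))
      simpa using (hP.vanishing w α hα h t ht htα).mul hc

/-- The elements of `ℂ(T) * W` that satisfy the residue conditions form a subalgebra. -/
def locallyHeckeAlgebra (hdim : Algebra.trdeg ℂ O = 1) (hd : IsSymmetrizer A d)
    (D : Realization A X) (q : Points O) : Subalgebra ℂ (SkewRing O D) where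
  carrier := {P | IsLocallyHecke D q P}
  mul_mem' := fun hP hQ => hP.mul hdim hd hQ
  add_mem' := fun hP hQ => hP.add hQ
  algebraMap_mem' := fun r => by
    have h := isLocallyHecke_single_one (D := D) (q := q) (algebraMap ℂ _ r)
    rw [← IsScalarTower.algebraMap_apply] at h
    exact h

/-- The generating set is already a subalgebra, so taking the generated subalgebra adds nothing. -/
theorem mem_heckeAlgebra (hdim : Algebra.trdeg ℂ O = 1) (hd : IsSymmetrizer A d) (hq : q ^ 2 ≠ 1) :
    P ∈ heckeAlgebra D q ↔ IsLocallyHecke D q P := by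
  have h : heckeAlgebra D q = locallyHeckeAlgebra hdim hd D q := by
    rw [heckeAlgebra, show {P | IsHeckeElement D q P} =
      (locallyHeckeAlgebra hdim hd D q : Set (SkewRing O D)) from
        Set.ext fun P => isHeckeElement_iff hdim hd hq, Algebra.adjoin_eq]
  rw [h]
  rfl

end LocallyHecke

/-! ### Noetherian rings -/

section Noetherian

/-- Left ideals of `H` are in particular `R`-submodules, and `L` embeds `H` in a Noetherian
`R`-module. -/
theorem isNoetherianRing_of_injective {R H ι : Type*} [CommRing R] [IsNoetherianRing R] [Ring H]
    [Finite ι] (φ : R →+* H) (L : H →+ (ι → R)) (hL : Function.Injective L)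
    (hφ : ∀ r h, L (φ r * h) = r • L h) : IsNoetherianRing H := by
  let _ : Module R H := Module.compHom H φ
  have : IsScalarTower R H H := ⟨fun r x y => mul_assoc (φ r) x y⟩
  have : IsNoetherian R H := isNoetherian_of_injective
    ({ L with map_smul' := hφ } : H →ₗ[R] (ι → R)) hL
  exact isNoetherian_of_tower R this

theorem isLeftGoldie_of_isNoetherianRing (H : Type*) [Ring H] [IsNoetherianRing H] :
    IsLeftGoldie H := by
  refine ⟨fun I hI => ?_, fun S hS => ?_⟩
  · by_contra! h
    have hfin := WellFoundedGT.finite_ne_bot_of_iSupIndep hI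
    rw [Set.eq_univ_of_forall (s := {k | I k ≠ ⊥}) h] at hfin
    exact Set.infinite_univ hfin
  · obtain ⟨N, hN⟩ := monotone_stabilizes_iff_noetherian.2 ‹IsNoetherianRing H›
      ⟨fun k => leftAnnihilator (S k), hS⟩
    exact ⟨N, fun k hk => (hN k hk).symm⟩

end Noetherian

/-! ### Structure of the algebra -/

section Structure

variable {O : Type*} [CommRing O] [HopfAlgebra ℂ O] [Coalgebra.IsCocomm ℂ O]
  {X : Type*} [AddCommGroup X] {n : ℕ} {A : Matrix (Fin n) (Fin n) ℤ}
  [IsDomain O] [Algebra.FiniteType ℂ O] [Module.Free ℤ X] [Module.Finite ℤ X]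
  {D : Realization A X} {d : Fin n → ℝ} {q : Points O} {P Q : SkewRing O D}

open Realization

theorem algebraMap_coordinateRing_injective :
    Function.Injective (algebraMap (coordinateRing O X) (RationalFunctions O X)) :=
  IsFractionRing.injective _ _

theorem pullback_ne_zero {u : O} (hu : IsLocalParameter u) {x : X}
    (hx : x ≠ 0) : pullback x u ≠ 0 := by
  obtain ⟨δ, hδ, hδu⟩ := exists_pointDerivation_ne_zero hu
  rw [← equation_one]
  refine equation_ne_zero hu hδ hδu ?_ (charVal_zero_right x)
  by_contra! h
  exact hx ((Module.Free.chooseBasis ℤ X).ext_elem fun i => by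
    rw [map_zero]; exact h ((Module.Free.chooseBasis ℤ X).coord i))

/-- Automorphisms of `X` act faithfully on `ℂ[T]`. -/
theorem eq_of_smul_eq (hdim : Algebra.trdeg ℂ O = 1) {w w' : X ≃ₗ[ℤ] X}
    (h : ∀ f : coordinateRing O X, w • f = w' • f) : w = w' := by
  refine LinearEquiv.ext fun x => sub_eq_zero.1 ?_
  by_contra hx
  obtain ⟨u, hu⟩ := exists_isLocalParameter (O := O) hdim
  refine pullback_ne_zero hu hx (coordinateRing_ext fun t => ?_)
  have : charVal (w x) t = charVal (w' x) t := Points.ext_eval fun v => by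
    have := congrArg (evalAt t) (h (pullback x v))
    rwa [smul_pullback, smul_pullback, evalAt_pullback, evalAt_pullback] at this
  rw [evalAt_pullback, charVal_sub_left, this, div_self', hu.eval_one, map_zero]

/-- A rational function is regular if it is so at the points that lie on at most one of the
divisors `T_{α,1}`. -/
theorem exists_algebraMap_eq_of_generic (hdim : Algebra.trdeg ℂ O = 1) (hd : IsSymmetrizer A d)
    {f : RationalFunctions O X} (h0 : ∀ t, D.OffDivisors t → f ∈ regularAt t)
    (h1 : ∀ α t, D.IsPosRealRoot α → D.GenericOn α t → f ∈ regularAt t) :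
    ∃ a, algebraMap (coordinateRing O X) (RationalFunctions O X) a = f := by
  classical
  obtain ⟨u, hu⟩ := exists_isLocalParameter (O := O) hdim
  obtain ⟨δ, hδ, hδu⟩ := exists_pointDerivation_ne_zero hu
  refine exists_algebraMap_eq_of_regularAt hu hδ hδu
    ((D.realRoots hd ×ˢ D.realRoots hd).filter fun p => p.2 ≠ p.1 ∧ p.2 ≠ -p.1) ?_ ?_
  · rintro ⟨α, β⟩ h
    simp only [Finset.mem_filter, Finset.mem_product, mem_realRoots] at h
    exact ⟨h.1.1.exists_dual_ne_zero, h.1.1.exists_dual hd h.1.2 h.2.1 h.2.2⟩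
  · intro t ht
    by_cases hoff : D.OffDivisors t
    · exact h0 t hoff
    · obtain ⟨α, hα, hαt⟩ : ∃ α, D.IsRealRoot α ∧ charVal α t = 1 := by
        by_contra! h
        exact hoff h
      have hgen : D.GenericOn α t := ⟨hαt, fun β hβ h2 h3 => ht (α, β) (by
        simp only [Finset.mem_filter, Finset.mem_product, mem_realRoots]
        exact ⟨⟨hα, hβ⟩, h2, h3⟩) hαt⟩
      rcases hα.pos_or_neg hd with h | h
      · exact h1 α t h hgen
      · exact h1 _ t h hgen.neg

/-- The product of the equations of `T_{α,1}` over positive roots clears the simple poles at generic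
points, and regularity there suffices. -/
theorem exists_common_denominator (hdim : Algebra.trdeg ℂ O = 1) (hd : IsSymmetrizer A d)
    (D : Realization A X) (q : Points O) : ∃ Δ : RationalFunctions O X, Δ ≠ 0 ∧
      ∀ P : SkewRing O D, IsLocallyHecke D q P → ∀ w, ∃ a, algebraMap (coordinateRing O X)
        (RationalFunctions O X) a = Δ * P.coeff w := by
  classical
  obtain ⟨u, hu⟩ := exists_isLocalParameter (O := O) hdim
  let π : X → RationalFunctions O X := fun α => algebraMap _ _ (pullback α u)
  let S := (D.realRoots hd).filter D.IsPosRealRoot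
  have hπ : ∀ (T : Finset X) (t : Torus O X), ∏ α ∈ T, π α ∈ regularAt t := fun T t =>
    prod_mem fun α _ => algebraMap_mem_regularAt _ t
  refine ⟨∏ α ∈ S, π α, Finset.prod_ne_zero_iff.2 fun α hα => ?_, fun P hP w =>
    exists_algebraMap_eq_of_generic hdim hd (D := D) (fun t ht => ?_) fun α t hα ht => ?_⟩
  · exact (map_ne_zero_iff _ algebraMap_coordinateRing_injective).2
      (pullback_ne_zero hu (mem_realRoots.1 (Finset.mem_filter.1 hα).1).ne_zero)
  · exact mul_mem (hπ S t) (hP.regular w t ht)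
  · rw [← Finset.prod_erase_mul S π
      (Finset.mem_filter.2 ⟨mem_realRoots.2 hα.isRealRoot, hα⟩), mul_assoc]
    exact mul_mem (hπ _ t) (hP.pole w α hα.isRealRoot t ht u hu)

/-! ### Chain conditions, primeness and center -/

section Hecke

variable (hdim : Algebra.trdeg ℂ O = 1) (hd : IsSymmetrizer A d) (hq : q ^ 2 ≠ 1)
include hdim hd hq

theorem single_one_mem (a : coordinateRing O X) :
    SkewMonoidAlgebra.single (1 : D.weyl) (algebraMap _ (RationalFunctions O X) a) ∈
      heckeAlgebra D q :=
  (mem_heckeAlgebra hdim hd hq).2 (isLocallyHecke_single_one a)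

theorem exists_hom_heckeAlgebra : ∃ φ : coordinateRing O X →+* heckeAlgebra D q,
    ∀ a, (φ a : SkewRing O D) =
      SkewMonoidAlgebra.single 1 (algebraMap _ (RationalFunctions O X) a) := by
  refine ⟨
    { toFun := fun a => ⟨_, single_one_mem hdim hd hq a⟩
      map_one' := Subtype.ext (congrArg (SkewMonoidAlgebra.single 1) (map_one _))
      map_zero' := Subtype.ext ((congrArg (SkewMonoidAlgebra.single 1) (map_zero _)).trans
        (SkewMonoidAlgebra.single_zero _))
      map_add' := fun a b => Subtype.ext ((congrArg (SkewMonoidAlgebra.single 1)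
        (map_add _ a b)).trans (SkewMonoidAlgebra.single_add _ _ _))
      map_mul' := fun a b => Subtype.ext ((congrArg (SkewMonoidAlgebra.single 1)
        (map_mul _ a b)).trans (by
          rw [MulMemClass.coe_mul, SkewMonoidAlgebra.single_mul_single, one_mul, one_smul])) }, fun a => rfl⟩

theorem exists_coeff_embedding : ∃ (Δ : RationalFunctions O X)
    (L : heckeAlgebra D q →+ (D.weyl → coordinateRing O X)), Δ ≠ 0 ∧
      ∀ h w, algebraMap _ (RationalFunctions O X) (L h w) = Δ * (h : SkewRing O D).coeff w := by
  obtain ⟨Δ, hΔ, h⟩ := exists_common_denominator hdim hd D q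
  choose L hL using fun (h' : heckeAlgebra D q) =>
    h h'.1 ((mem_heckeAlgebra hdim hd hq).1 h'.2)
  refine ⟨Δ, AddMonoidHom.mk' L fun x y => funext fun w => ?_, hΔ, hL⟩
  refine algebraMap_coordinateRing_injective ?_
  rw [Pi.add_apply, map_add, hL, hL, hL, ← mul_add, AddMemClass.coe_add,
    SkewMonoidAlgebra.coeff_add]
  rfl

theorem isNoetherianRing_heckeAlgebra : IsNoetherianRing (heckeAlgebra D q) := by
  have := finite_weyl (D := D) hd
  obtain ⟨φ, hφ⟩ := exists_hom_heckeAlgebra (D := D) hdim hd hq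
  obtain ⟨Δ, L, hΔ, hL⟩ := exists_coeff_embedding (D := D) hdim hd hq
  refine isNoetherianRing_of_injective φ L (fun x y hxy => ?_) fun r h => funext fun w => ?_
  · refine Subtype.ext (SkewMonoidAlgebra.ext fun w => mul_left_cancel₀ hΔ ?_)
    rw [← hL, ← hL, hxy]
  · refine algebraMap_coordinateRing_injective ?_
    rw [hL, Pi.smul_apply, smul_eq_mul, map_mul, hL, MulMemClass.coe_mul, hφ,
      SkewMonoidAlgebra.coeff_single_one_mul, mul_left_comm]

/-- Right multiplication by `r` multiplies the coefficient at `w` by `w r`; applying `w⁻¹` to that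
coefficient makes the embedding `ℂ[T]`-linear. -/
theorem isNoetherianRing_op_heckeAlgebra : IsNoetherianRing (heckeAlgebra D q)ᵐᵒᵖ := by
  have := finite_weyl (D := D) hd
  obtain ⟨φ, hφ⟩ := exists_hom_heckeAlgebra (D := D) hdim hd hq
  obtain ⟨Δ, L, hΔ, hL⟩ := exists_coeff_embedding (D := D) hdim hd hq
  refine isNoetherianRing_of_injective
    (φ.toOpposite fun a b => by rw [Commute, SemiconjBy, ← map_mul, mul_comm, map_mul])
    (AddMonoidHom.mk' (fun h w => (w⁻¹ : D.weyl).1 • L h.unop w) fun x y => funext fun w => by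
      rw [MulOpposite.unop_add, map_add, Pi.add_apply, Pi.add_apply, smul_add])
    (fun x y hxy => ?_) fun r h => funext fun w => ?_
  · refine MulOpposite.unop_injective (Subtype.ext (SkewMonoidAlgebra.ext fun w =>
      mul_left_cancel₀ hΔ ?_))
    rw [← hL, ← hL]
    exact congrArg _ (MulAction.injective (w⁻¹ : D.weyl).1 (congrFun hxy w))
  · change (w⁻¹ : D.weyl).1 • L (h.unop * φ r) w = r * (w⁻¹ : D.weyl).1 • L h.unop w
    have hL' : L (h.unop * φ r) w = L h.unop w * w.1 • r := by
      refine algebraMap_coordinateRing_injective ?_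
      rw [hL, map_mul, hL, MulMemClass.coe_mul, hφ, SkewMonoidAlgebra.coeff_mul_single_one,
        ← mul_assoc, ← smul_algebraMap_coordinateRing]
      rfl
    rw [hL', smul_mul', mul_comm, smul_smul]
    congr 1
    exact congrArg (· • r) (inv_mul_cancel w.1) |>.trans (one_smul _ r)

/-- The coefficient at `z` of `a f b = 0`, for all regular `f`, is a linear relation between the
distinct multiplicative maps `f ↦ x f`, `x ∈ W`. By Dedekind all products `a_x * x(b_y)` vanish in
the field `ℂ(T)`. -/
theorem isPrimeRing_heckeAlgebra : IsPrimeRing (heckeAlgebra D q) := by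
  have := finite_weyl (D := D) hd
  have := Fintype.ofFinite D.weyl
  obtain ⟨φ, hφ⟩ := exists_hom_heckeAlgebra (D := D) hdim hd hq
  refine ⟨⟨0, 1, fun h => ?_⟩, fun a b hab => ?_⟩
  · have h1 := congrArg (fun P : SkewRing O D => P.coeff 1) (congrArg Subtype.val h)
    refine zero_ne_one (α := RationalFunctions O X) (h1.trans ?_)
    change (SkewMonoidAlgebra.single (1 : D.weyl) (1 : RationalFunctions O X)).coeff 1 = 1
    classical
    rw [SkewMonoidAlgebra.coeff_single_apply, if_pos rfl]
  · let ψ : D.weyl → coordinateRing O X →* RationalFunctions O X := fun w =>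
      (algebraMap (coordinateRing O X) (RationalFunctions O X)).toMonoidHom.comp
        (MulDistribMulAction.toMonoidHom _ w.1)
    have hψ : Function.Injective ψ := fun w w' h => Subtype.ext (eq_of_smul_eq hdim fun f =>
      algebraMap_coordinateRing_injective (DFunLike.congr_fun h f))
    have hind := (linearIndependent_monoidHom (coordinateRing O X) (RationalFunctions O X)).comp
      ψ hψ
    have key : ∀ x z : D.weyl, (a : SkewRing O D).coeff x *
        x.1 • (b : SkewRing O D).coeff (x⁻¹ * z) = 0 := fun x z => by
      refine Fintype.linearIndependent_iff.1 hind (fun x => (a : SkewRing O D).coeff x *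
        x.1 • (b : SkewRing O D).coeff (x⁻¹ * z)) (funext fun f => ?_) x
      have h1 := congrArg (fun P : SkewRing O D => P.coeff z) (congrArg Subtype.val (hab (φ f)))
      simp only [MulMemClass.coe_mul, hφ, coeff_mul_eq_sum (_ * _),
        SkewMonoidAlgebra.coeff_mul_single_one] at h1
      rw [Finset.sum_apply]
      refine Eq.trans (Finset.sum_congr rfl fun x _ => ?_) h1
      change _ * algebraMap _ (RationalFunctions O X) (x.1 • f) = _
      rw [← smul_algebraMap_coordinateRing, mul_right_comm]
      rfl
    by_contra! h
    obtain ⟨x, hx⟩ : ∃ x, (a : SkewRing O D).coeff x ≠ 0 := by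
      by_contra! h0
      exact h.1 (Subtype.ext (SkewMonoidAlgebra.ext h0))
    refine h.2 (Subtype.ext (SkewMonoidAlgebra.ext fun y => ?_))
    have := (mul_eq_zero.1 (key x (x * y))).resolve_left hx
    rw [inv_mul_cancel_left] at this
    exact (smul_eq_zero_iff_eq _).1 this

/-- A product of equations of all `T_{α,q⁻²}` meets every vanishing condition at once, so the
algebra has a nonzero element supported at each `w`. -/
theorem exists_single_mem (w : D.weyl) : ∃ a : coordinateRing O X, a ≠ 0 ∧
    SkewMonoidAlgebra.single w (algebraMap _ (RationalFunctions O X) a) ∈ heckeAlgebra D q := by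
  classical
  obtain ⟨u, hu⟩ := exists_isLocalParameter (O := O) hdim
  obtain ⟨δ, hδ, hδu⟩ := exists_pointDerivation_ne_zero hu
  have h : ∀ α, D.IsRealRoot α → ∃ a : coordinateRing O X, a ≠ 0 ∧
      ∀ t, charVal α t = (q ^ 2)⁻¹ → evalAt t a = 0 := fun α hα => by
    by_cases ht : ∃ t : Torus O X, charVal α t = (q ^ 2)⁻¹
    · obtain ⟨t, ht⟩ := ht
      exact ⟨_, equation_ne_zero hu hδ hδu hα.exists_dual_ne_zero ht,
        fun t' ht' => evalAt_equation_eq_zero hu ht'⟩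
    · exact ⟨1, one_ne_zero, fun t ht' => absurd ⟨t, ht'⟩ ht⟩
  choose! E hE0 hE using h
  refine ⟨∏ α ∈ D.realRoots hd, E α, Finset.prod_ne_zero_iff.2 fun α hα =>
    hE0 α (mem_realRoots.1 hα), (mem_heckeAlgebra hdim hd hq).2
    (isLocallyHecke_single w _ fun α hα _ t ht => ?_)⟩
  rw [map_prod]
  exact Finset.prod_eq_zero (mem_realRoots.2 hα.isRealRoot) (hE α hα.isRealRoot t ht)

theorem map_center_heckeAlgebra :
    ((Subalgebra.center ℂ (heckeAlgebra D q)).map (heckeAlgebra D q).val : Set (SkewRing O D)) =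
      invariants O D := by
  classical
  ext P
  constructor
  · rintro ⟨⟨P, hP⟩, hPc, rfl⟩
    have hcomm : ∀ Q ∈ heckeAlgebra D q, Q * P = P * Q := fun Q hQ =>
      congrArg Subtype.val (Subalgebra.mem_center_iff.1 hPc ⟨Q, hQ⟩)
    have hP' := (mem_heckeAlgebra hdim hd hq).1 hP
    have h0 : ∀ w, w ≠ 1 → P.coeff w = 0 := fun w hw => by
      by_contra hPw
      refine hw (Subtype.ext (eq_of_smul_eq hdim (w' := 1) fun f =>
        algebraMap_coordinateRing_injective ?_))
      have h := congrArg (fun P : SkewRing O D => P.coeff w)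
        (hcomm _ (single_one_mem hdim hd hq f))
      simp only [SkewMonoidAlgebra.coeff_single_one_mul,
        SkewMonoidAlgebra.coeff_mul_single_one] at h
      rw [mul_comm] at h
      rw [one_smul, ← smul_algebraMap_coordinateRing]
      exact (mul_left_cancel₀ hPw h).symm
    -- The coefficient at `σ ≠ 1` is zero, so the residue condition leaves the coefficient at `1`
    -- without a pole along `T_{α,1}`.
    obtain ⟨a, ha⟩ := exists_algebraMap_eq_of_generic (D := D) hdim hd (hP'.regular 1)
      fun α t hα ht => by
        obtain ⟨σ, hσ⟩ := hα.isRealRoot.exists_reflection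
        have h := hP'.residue 1 σ α hα.isRealRoot hσ t ht
        rwa [mul_one, h0 σ, add_zero] at h
        rintro rfl
        exact hα.not_neg (hσ.apply_self ▸ hα)
    have hPa : P = SkewMonoidAlgebra.single 1 (algebraMap _ (RationalFunctions O X) a) := by
      refine SkewMonoidAlgebra.ext fun w => ?_
      rw [SkewMonoidAlgebra.coeff_single_apply]
      split_ifs with hw
      · rw [← hw, ha]
      · exact h0 w (Ne.symm hw)
    refine ⟨a, fun w => algebraMap_coordinateRing_injective ?_, hPa.symm⟩
    -- Commutation with `E w` gives `E * w(a) = a * E`, and `E ≠ 0` cancels.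
    obtain ⟨E, hE0, hE⟩ := exists_single_mem (D := D) hdim hd hq w
    have h := congrArg (fun P : SkewRing O D => P.coeff w) (hcomm _ hE)
    simp only [hPa, SkewMonoidAlgebra.coeff_single_one_mul,
      SkewMonoidAlgebra.coeff_mul_single_one, SkewMonoidAlgebra.coeff_single_apply, if_pos] at h
    rw [mul_comm] at h
    refine (smul_algebraMap_coordinateRing O X w.1 a).symm.trans ?_
    exact mul_right_cancel₀ ((map_ne_zero_iff _ algebraMap_coordinateRing_injective).2 hE0) h
  · rintro ⟨f, hf, rfl⟩
    refine ⟨⟨_, single_one_mem hdim hd hq f⟩, Subalgebra.mem_center_iff.2 fun Q =>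
      Subtype.ext (SkewMonoidAlgebra.ext fun w => ?_), rfl⟩
    rw [MulMemClass.coe_mul, MulMemClass.coe_mul, SkewMonoidAlgebra.coeff_single_one_mul,
      SkewMonoidAlgebra.coeff_mul_single_one, mul_comm]
    congr 1
    exact (smul_algebraMap_coordinateRing O X w.1 f).trans (congrArg _ (hf w))

end Hecke

end Structure

end

end ResidueHecke

theorem mainTheorem6
    {O : Type*} [CommRing O] [HopfAlgebra ℂ O] [Coalgebra.IsCocomm ℂ O]
    [IsDomain O] [Algebra.FiniteType ℂ O] (hdim : Algebra.trdeg ℂ O = 1)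
    {n : ℕ} (A : Matrix (Fin n) (Fin n) ℤ) (hA : ResidueHecke.IsFiniteType A)
    {X : Type*} [AddCommGroup X] [Module.Free ℤ X] [Module.Finite ℤ X]
    (D : ResidueHecke.Realization A X)
    (q : ResidueHecke.Points O) (hq : q ^ 2 ≠ 1) :
    (ResidueHecke.heckeAlgebra D q : Set (ResidueHecke.SkewRing O D)) =
        {P | ResidueHecke.IsHeckeElement D q P} ∧
      IsNoetherianRing (ResidueHecke.heckeAlgebra D q) ∧
      IsNoetherianRing (ResidueHecke.heckeAlgebra D q)ᵐᵒᵖ ∧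
      ResidueHecke.IsPrimeRing (ResidueHecke.heckeAlgebra D q) ∧
      ResidueHecke.IsGoldie (ResidueHecke.heckeAlgebra D q) ∧
      ((Subalgebra.center ℂ (ResidueHecke.heckeAlgebra D q)).map
          (ResidueHecke.heckeAlgebra D q).val : Set (ResidueHecke.SkewRing O D)) =
        ResidueHecke.invariants O D := by
  obtain ⟨d, hd1, hd2⟩ := hA.2
  have hd : ResidueHecke.IsSymmetrizer A d := ⟨hd1, hd2⟩
  have h1 := ResidueHecke.isNoetherianRing_heckeAlgebra (D := D) hdim hd hq
  have h2 := ResidueHecke.isNoetherianRing_op_heckeAlgebra (D := D) hdim hd hq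
  exact ⟨Set.ext fun P => (ResidueHecke.mem_heckeAlgebra hdim hd hq).trans
      (ResidueHecke.isHeckeElement_iff hdim hd hq).symm, h1, h2,
    ResidueHecke.isPrimeRing_heckeAlgebra hdim hd hq,
    ⟨ResidueHecke.isLeftGoldie_of_isNoetherianRing _,
      ResidueHecke.isLeftGoldie_of_isNoetherianRing _⟩,
    ResidueHecke.map_center_heckeAlgebra hdim hd hq⟩
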